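/- Let $k$ be an algebraically closed field of characteristic $0$. A del Pezzo threefold of degree $4$ is a complete three-dimensional variety $X$ over $k$ with at most terminal Gorenstein singularities such that $-K_X$ is an ample Cartier divisor divisible by $2$ in $\operatorname{Pic}(X)$ and $(-\tfrac12 K_X)^3=4$. Let $X=Q_1\cap Q_2\subset\mathbb{P}^5$ be a del Pezzo threefold of degree $4$, presented as the scheme-theoretic intersection of two quadrics with $Q_2$ nonsingular, where $Q_1,Q_2$ also denote the symmetric $6\times 6$ matrices of the two quadrics. For a root $p=(\bar\lambda:\bar\mu)\in\mathbb{P}^1$ of the discriminant $\Delta(\lambda,\mu)=\det(\lambda Q_1+\mu Q_2)$ let $d\ge 0$ be the integer with $\operatorname{rank}(\bar\lambda Q_1+\bar\mu Q_2)=5-d$, let $l_i$ $(0\le i\le d)$ be the minimal multiplicity of the root $p$ in the minors of order $6-i$ of $\lambda Q_1+\mu Q_2$, and put $e_i=l_i-l_{i+1}$ for $0\le i<d$ and $e_d=l_d$. The numbers $e_0,\dots,e_d$ are the characteristic numbers of $p$, and the Segre symbol of $X$ is the collection of the brackets $(e_0,\dots,e_d)$, one for each root $p$ of $\Delta$. Then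 every bracket of the Segre symbol of $X$ contains at most two characteristic numbers, and every bracket with exactly two characteristic numbers has the form $(a,1)$ for some natural number $a$. -/

import Mathlib

open CategoryTheory AlgebraicGeometry Filter Topology
open scoped LinearAlgebra.Projectivization

universe u

noncomputable section

namespace DelPezzo

/-! ### Differential forms and divisorial valuations of a function field `K / k` -/

section FunctionFields

variable {k K : Type u} [Field k] [Field K] [Algebra k K]

/-- The rational differential `n`-forms of `K / k` that are regular along `R`: the `R`-submodule
generated by the forms `da₁ ∧ ⋯ ∧ daₙ` with all `aᵢ ∈ R`, that is, the image of the `n`-th exterior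
power of `Ω[R⁄k]` in that of `Ω[K⁄k]`. -/
def regularForms (n : ℕ) (R : Subalgebra k K) : Submodule R (⋀[K]^n (Ω[K⁄k])) :=
  Submodule.span R
    {η | ∃ a : Fin n → R,
      η = exteriorPower.ιMulti K n (fun i => KaehlerDifferential.D k K (a i : K))}

/-- `V` is the valuation ring of a divisorial valuation of `K / k`: a discrete valuation ring with
fraction field `K`, containing `k`, whose residue field has transcendence degree one less than
that of `K`.  These are the local rings at prime divisors of normal models of `K / k`. -/
def IsDivisorial (V : Subalgebra k K) : Prop :=
  IsFractionRing V K ∧ ∃ _ : IsDiscreteValuationRing V,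
    Algebra.trdeg k (IsLocalRing.ResidueField V) + 1 = Algebra.trdeg k K

/-- The ring `V` dominates the local ring `R`: it contains `R`, and no non-unit of `R` becomes
a unit in `V`. -/
def Dominates (V R : Subalgebra k K) : Prop :=
  R ≤ V ∧ ∀ a ∈ R, a⁻¹ ∈ V → a⁻¹ ∈ R

/-- The form `η` vanishes along the prime divisor with valuation ring `V`, that is, the order of
`η` along it is positive. -/
def VanishesAlong (n : ℕ) (V : Subalgebra k K) (hV : IsDivisorial V)
    (η : ⋀[K]^n (Ω[K⁄k])) : Prop :=
  haveI : IsDiscreteValuationRing V := hV.2.choose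
  η ∈ IsLocalRing.maximalIdeal V • regularForms n V

end FunctionFields

/-! ### Varieties over `k`: function field, local rings, canonical sheaf, singularities -/

section Varieties

variable {k : Type u} [Field k] {X : Scheme.{u}}

/-- The function field of the integral scheme `X`, as an extension of the base field `k` through
the structure morphism `π`. -/
def FunField [IsIntegral X] (_π : X ⟶ Spec (.of k)) : Type u := X.functionField

variable [IsIntegral X] (π : X ⟶ Spec (.of k))

instance : Field (FunField π) := inferInstanceAs (Field X.functionField)

/-- The pullback of constants `k → Γ(X, 𝒪_X)`. -/
def constants : k →+* Γ(X, ⊤) :=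
  ((Scheme.ΓSpecIso (.of k)).inv ≫ π.appTop).hom

instance : Algebra k (FunField π) :=
  ((X.presheaf.germ ⊤ (genericPoint X) (TopologicalSpace.Opens.mem_top _)).hom.comp
    (constants π)).toAlgebra

/-- The local ring of `X` at `x`, as a subring of the function field. -/
def localRing (x : X) : Subalgebra k (FunField π) where
  __ := (algebraMap (X.presheaf.stalk x) X.functionField).range
  algebraMap_mem' c := ⟨X.presheaf.germ ⊤ x (TopologicalSpace.Opens.mem_top x) (constants π c), by
    have : Nonempty (⊤ : X.Opens) := ⟨⟨x, TopologicalSpace.Opens.mem_top x⟩⟩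
    exact Scheme.algebraMap_germ_eq_germToFunctionField X (TopologicalSpace.Opens.mem_top x) _⟩

/-- The stalk at `x` of the canonical sheaf `𝒪_X(K_X)` of a normal `n`-dimensional variety: the
rational `n`-forms which are regular at every point `y` of codimension at most one of which `x` is
a specialization. -/
def canonicalStalk (n : ℕ) (x : X) : Set (⋀[FunField π]^n (Ω[FunField π⁄k])) :=
  {η | ∀ y : X, y ⤳ x → ringKrullDim (X.presheaf.stalk y) ≤ 1 →
    η ∈ regularForms n (localRing π y)}

/-- The normal `n`-dimensional variety `X`, assumed to be such that `K_X` is Cartier, is terminal: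
every prime divisor `V` over `X` which is exceptional (its centre `x` on `X` has codimension at
least two) has positive discrepancy, that is, the local generator of `𝒪_X(K_X)` at `x`, and
so every section of it, vanishes along `V` as a differential form. -/
def IsTerminal (n : ℕ) : Prop :=
  ∀ (V : Subalgebra k (FunField π)) (hV : IsDivisorial V) (x : X),
    Dominates V (localRing π x) → 2 ≤ ringKrullDim (X.presheaf.stalk x) →
      ∀ η ∈ canonicalStalk π n x, VanishesAlong n V hV η

/-- The canonical sheaf is invertible, i.e. `K_X` is a Cartier divisor. -/
def IsCanonicalCartier (n : ℕ) : Prop :=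
  ∀ x : X, ∃ ω, ω ≠ 0 ∧ canonicalStalk π n x = {η | ∃ f ∈ localRing π x, η = f • ω}

/-- `X` is normal with at most terminal Gorenstein singularities. -/
structure HasTerminalGorensteinSingularities (n : ℕ) : Prop where
  normal : ∀ x : X, IsIntegrallyClosed (X.presheaf.stalk x)
  gorenstein : IsCanonicalCartier π n
  terminal : IsTerminal π n

/-! ### Cartier divisors -/

/-- A Cartier divisor on `X`, given by a local equation `eq x` at every point `x`; local equations
at nearby points differ by units. -/
structure CartierDivisor where
  /-- the local equation at a point -/
  eq : X → FunField π
  ne_zero : ∀ x, eq x ≠ 0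
  locally_eq : ∀ x, ∃ U : X.Opens, x ∈ U ∧ ∀ y ∈ U,
    eq y / eq x ∈ localRing π y ∧ eq x / eq y ∈ localRing π y

variable {π}

/-- The space `H⁰(X, 𝒪_X(mD))` of rational functions `s` with `div s + mD ≥ 0`. -/
def CartierDivisor.sections (D : CartierDivisor π) (m : ℕ) : Submodule k (FunField π) where
  carrier := {s | ∀ x, s * D.eq x ^ m ∈ localRing π x}
  zero_mem' x := by simp
  add_mem' hs ht x := by
    rw [add_mul]
    exact add_mem (hs x) (ht x)
  smul_mem' c s hs x := by
    rw [smul_mul_assoc]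
    exact Subalgebra.smul_mem _ (hs x) c

/-- `D` is ample: every point lies in an affine open set of the form `X_s`, the non-vanishing
locus of some `s ∈ H⁰(X, 𝒪_X(mD))` with `m > 0`. -/
def CartierDivisor.IsAmple (D : CartierDivisor π) : Prop :=
  ∀ x : X, ∃ m : ℕ, 0 < m ∧ ∃ s ∈ D.sections m, ∃ U : X.Opens, IsAffineOpen U ∧ x ∈ U ∧
    ∀ y : X, y ∈ U ↔ ∃ t ∈ localRing π y, s * D.eq y ^ m * t = 1

/-- The top self-intersection number of the ample divisor `D` on the `n`-dimensional projective
variety `X` is `d`: the Hilbert function `h⁰(X, 𝒪_X(mD))` is `d mⁿ / n!` to leading order. -/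
def CartierDivisor.HasDegree (D : CartierDivisor π) (n d : ℕ) : Prop :=
  Tendsto (fun m : ℕ => (n.factorial : ℝ) * Module.finrank k (D.sections m) / (m : ℝ) ^ n)
    atTop (𝓝 (d : ℝ))

/-- `-K_X` is linearly equivalent to `2D`: there is a rational `n`-form `ω` with divisor `-2D`,
i.e. the form `(D.eq x)² ω` generates the canonical sheaf at each point `x`. -/
def CartierDivisor.IsHalfAnticanonical (D : CartierDivisor π) (n : ℕ) : Prop :=
  ∃ ω : ⋀[FunField π]^n (Ω[FunField π⁄k]), ω ≠ 0 ∧ ∀ x : X,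
    canonicalStalk π n x = {η | ∃ f ∈ localRing π x, η = (f * D.eq x ^ 2) • ω}

variable (π)

/-- `X` is a del Pezzo threefold of degree `d` over `k`: a three-dimensional complete variety with
at most terminal Gorenstein singularities whose anticanonical class is ample and divisible by `2`
in the Picard group, with `(-K_X / 2)³ = d`. -/
structure IsDelPezzoThreefold (d : ℕ) : Prop where
  proper : IsProper π
  dim_eq : topologicalKrullDim X = 3
  singularities : HasTerminalGorensteinSingularities π 3
  halfAnticanonical : ∃ D : CartierDivisor π,
    D.IsHalfAnticanonical 3 ∧ D.IsAmple ∧ D.HasDegree 3 d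

end Varieties

/-! ### Intersections of two quadrics in projective space -/

section Quadrics

variable (k : Type u) [Field k] (n : ℕ)

/-- The grading of `k[x₀, …, xₙ]` by degree. -/
abbrev grading : ℕ → Submodule k (MvPolynomial (Fin (n + 1)) k) :=
  MvPolynomial.homogeneousSubmodule (Fin (n + 1)) k

instance : GradedAlgebra (grading k n) := MvPolynomial.gradedAlgebra

/-- Projective space `ℙⁿ` over `k`. -/
def projectiveSpace : Scheme.{u} := Proj (grading k n)

/-- The structure morphism of projective space. -/
def projectiveSpaceToSpec : projectiveSpace k n ⟶ Spec (.of k) :=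
  Proj.toSpecZero (grading k n) ≫ Spec.map (CommRingCat.ofHom (algebraMap k (grading k n 0)))

/-- The standard affine chart `xⱼ ≠ 0` of projective space. -/
def chart (j : Fin (n + 1)) : (projectiveSpace k n).affineOpens :=
  ⟨Proj.basicOpen (grading k n) (MvPolynomial.X j),
    Proj.isAffineOpen_basicOpen (grading k n) (MvPolynomial.X j)
      (MvPolynomial.isHomogeneous_X k j) one_pos⟩

variable {k n}

/-- The quadratic form `∑ Qᵢⱼ xᵢ xⱼ` with matrix `Q`. -/
def quadraticPoly (Q : Matrix (Fin (n + 1)) (Fin (n + 1)) k) : MvPolynomial (Fin (n + 1)) k :=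
  ∑ i, ∑ j, MvPolynomial.C (Q i j) * (MvPolynomial.X i * MvPolynomial.X j)

theorem quadraticPoly_mem (Q : Matrix (Fin (n + 1)) (Fin (n + 1)) k) :
    quadraticPoly Q ∈ grading k n (2 • 1) := by
  refine Submodule.sum_mem _ fun i _ => Submodule.sum_mem _ fun j _ => ?_
  have h := (MvPolynomial.isHomogeneous_C (Fin (n + 1)) (Q i j)).mul
    ((MvPolynomial.isHomogeneous_X k i).mul (MvPolynomial.isHomogeneous_X k j))
  simpa using h

/-- The regular function `q / xⱼ²` on the chart `xⱼ ≠ 0`, where `q` is the quadratic form with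
matrix `Q`. -/
def dehomogenize (Q : Matrix (Fin (n + 1)) (Fin (n + 1)) k) (j : Fin (n + 1)) :
    Γ(projectiveSpace k n, (chart k n j).1) :=
  Proj.awayToSection (grading k n) (MvPolynomial.X j)
    (HomogeneousLocalization.Away.mk (grading k n)
      (MvPolynomial.isHomogeneous_X k j : MvPolynomial.X j ∈ grading k n 1) 2
      (quadraticPoly Q) (quadraticPoly_mem Q))

/-- The `k`-morphism `i` identifies `X` with the scheme-theoretic intersection in `ℙⁿ` of the
quadrics with matrices `Q₁` and `Q₂`: it is a closed immersion, and in each standard chart its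
ideal is generated by the two dehomogenized equations. -/
structure IsIntersectionOfQuadrics {X : Scheme.{u}} (π : X ⟶ Spec (.of k))
    (Q₁ Q₂ : Matrix (Fin (n + 1)) (Fin (n + 1)) k) (i : X ⟶ projectiveSpace k n) : Prop where
  comp_eq : i ≫ projectiveSpaceToSpec k n = π
  closedImmersion : IsClosedImmersion i
  ideal_eq : ∀ j, i.ker.ideal (chart k n j) = Ideal.span {dehomogenize Q₁ j, dehomogenize Q₂ j}

end Quadrics

/-! ### The Segre symbol of a pencil of quadrics -/

section Segre

variable {k : Type u} [Field k] {n : ℕ} (Q₁ Q₂ : Matrix (Fin (n + 1)) (Fin (n + 1)) k)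

/-- The generic matrix `λ Q₁ + μ Q₂` of the pencil, with the variables `λ = X 0`, `μ = X 1`. -/
def pencil : Matrix (Fin (n + 1)) (Fin (n + 1)) (MvPolynomial (Fin 2) k) :=
  (MvPolynomial.X 0 : MvPolynomial (Fin 2) k) • Q₁.map MvPolynomial.C +
    (MvPolynomial.X 1 : MvPolynomial (Fin 2) k) • Q₂.map MvPolynomial.C

/-- The discriminant `Δ(λ, μ) = det (λ Q₁ + μ Q₂)` of the pencil. -/
def discriminant : MvPolynomial (Fin 2) k := (pencil Q₁ Q₂).det

/-- The set of roots of the discriminant in `ℙ¹`. -/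
def roots : Set (ℙ k (Fin 2 → k)) :=
  {p | MvPolynomial.eval p.rep (discriminant Q₁ Q₂) = 0}

/-- The linear form in `λ, μ` vanishing at the point `p` of `ℙ¹`. -/
def linearForm (p : ℙ k (Fin 2 → k)) : MvPolynomial (Fin 2) k :=
  MvPolynomial.C (p.rep 1) * MvPolynomial.X 0 - MvPolynomial.C (p.rep 0) * MvPolynomial.X 1

/-- `lᵢ`: the minimal multiplicity of the root `p` in the minors of order `n + 1 - i` of
`λ Q₁ + μ Q₂`. -/
def minorMultiplicity (p : ℙ k (Fin 2 → k)) (i : ℕ) : ℕ :=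
  (⨅ (r : Fin (n + 1 - i) ↪o Fin (n + 1)) (c : Fin (n + 1 - i) ↪o Fin (n + 1)),
    emultiplicity (linearForm p) ((pencil Q₁ Q₂).submatrix r c).det).toNat

/-- The number `d` such that, at the root `p`, all minors of order `n + 1 - d` vanish, but not all
minors of order `n - d`; i.e. the rank of the matrix at `p` is `n - d`. -/
def vertexDim (p : ℙ k (Fin 2 → k)) : ℕ :=
  n - (p.rep 0 • Q₁ + p.rep 1 • Q₂).rank

/-- The list `(e₀, …, e_d)` of characteristic numbers of the root `p`, where `eᵢ = lᵢ - lᵢ₊₁` for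
`i < d` and `e_d = l_d`. -/
def characteristicNumbers (p : ℙ k (Fin 2 → k)) : List ℕ :=
  (List.range (vertexDim Q₁ Q₂ p)).map
      (fun i => minorMultiplicity Q₁ Q₂ p i - minorMultiplicity Q₁ Q₂ p (i + 1)) ++
    [minorMultiplicity Q₁ Q₂ p (vertexDim Q₁ Q₂ p)]

theorem eval_discriminant (v : Fin 2 → k) :
    MvPolynomial.eval v (discriminant Q₁ Q₂) = (v 0 • Q₁ + v 1 • Q₂).det := by
  rw [discriminant, RingHom.map_det]
  congr 1
  ext i j
  simp [pencil]

theorem roots_finite (hQ₂ : Q₂.det ≠ 0) : (roots Q₁ Q₂).Finite := by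
  set P : Polynomial k :=
    ((Polynomial.X : Polynomial k) • Q₂.map Polynomial.C + Q₁.map Polynomial.C).det with hP
  have hP0 : P ≠ 0 := by
    intro h
    have h1 := Polynomial.coeff_det_X_add_C_card Q₂ Q₁
    rw [← hP, h, Polynomial.coeff_zero] at h1
    exact hQ₂ h1.symm
  have heval : ∀ t, P.eval t = (Q₁ + t • Q₂).det := by
    intro t
    rw [hP, ← Polynomial.coe_evalRingHom, RingHom.map_det]
    congr 1
    ext i j
    simp only [Matrix.add_apply, Matrix.smul_apply, Matrix.map_apply, RingHom.mapMatrix_apply,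
      smul_eq_mul, Polynomial.coe_evalRingHom, Polynomial.eval_add, Polynomial.eval_mul,
      Polynomial.eval_X, Polynomial.eval_C]
    ring
  have h0 : ∀ p ∈ roots Q₁ Q₂, p.rep 0 ≠ 0 := by
    intro p hp h
    have h2 : MvPolynomial.eval p.rep (discriminant Q₁ Q₂) = 0 := hp
    rw [eval_discriminant, h, zero_smul, zero_add, Matrix.det_smul] at h2
    have h1 : p.rep 1 = 0 := by
      rcases mul_eq_zero.mp h2 with h3 | h3
      · exact eq_zero_of_pow_eq_zero h3
      · exact absurd h3 hQ₂
    apply p.rep_nonzero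
    ext j
    fin_cases j
    · exact h
    · exact h1
  refine Set.Finite.of_injOn (f := fun p => p.rep 1 / p.rep 0) (t := {t | P.IsRoot t})
    ?_ ?_ (Polynomial.finite_setOfPred_isRoot hP0)
  · intro p hp
    have hp0 := h0 p hp
    have h2 : MvPolynomial.eval p.rep (discriminant Q₁ Q₂) = 0 := hp
    rw [eval_discriminant] at h2
    have h3 : p.rep 0 • Q₁ + p.rep 1 • Q₂ = p.rep 0 • (Q₁ + (p.rep 1 / p.rep 0) • Q₂) := by
      rw [smul_add, smul_smul, mul_div_cancel₀ _ hp0]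
    rw [h3, Matrix.det_smul] at h2
    change P.eval _ = 0
    rw [heval]
    exact (mul_eq_zero.mp h2).resolve_left (pow_ne_zero _ hp0)
  · intro p hp q hq hpq
    have hp0 := h0 p hp
    have hq0 := h0 q hq
    simp only at hpq
    rw [← p.mk_rep, ← q.mk_rep, Projectivization.mk_eq_mk_iff']
    refine ⟨p.rep 0 / q.rep 0, ?_⟩
    ext j
    fin_cases j
    · simp [hq0]
    · rw [div_eq_div_iff hp0 hq0] at hpq
      simp only [Pi.smul_apply, smul_eq_mul, Fin.mk_one]
      field_simp
      linear_combination -hpq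

/-- The Segre symbol of the pencil spanned by `Q₁` and the nonsingular quadric `Q₂`: the (unordered)
collection of brackets, one for each root of the discriminant, where the bracket of a root is the
list of its characteristic numbers. -/
def segreSymbol (hQ₂ : Q₂.det ≠ 0) : Multiset (List ℕ) :=
  (roots_finite Q₁ Q₂ hQ₂).toFinset.val.map (characteristicNumbers Q₁ Q₂)

end Segre

end DelPezzo

end

/-!
Let `p` be a root of the discriminant, `A = p₀ Q₁ + p₁ Q₂` the singular quadric of the pencil that
belongs to it, `W = ker A` the vertex of `A`, and `B = Q₂`. Since `B` is nonsingular, `p₀ ≠ 0` and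
`X` is also the intersection of `A` and `B` (`IsIntersectionOfQuadrics.of_pencil`). Everything
follows from a statement about the vertex: either `dim W = 1`, or `dim W = 2` and `B` does not
vanish identically on `W` (`rank_of_isDelPezzoThreefold`).

In the first case the bracket of `p` has a single entry. In the second case it has two, `l₀ - l₁`
and `l₁`, and `l₁ = 1`: all minors of order five vanish at `p`, and to first order at `p` the
pencil is `A + ε B`, so a vector of `W` on which `B` does not vanish gives a minor of order five
with a simple zero (`minorMultiplicity_one_eq_one`).

The other possibilities for `A` are excluded as follows.

* If `A = 0`, then `X` is a quadric of dimension four (`topologicalKrullDim_ne_three`).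
* If `A` has rank one or two, it is a product of two linear forms. As `X` is integral, one of the
  forms vanishes on `X`. But at a suitable point of `X` where both forms vanish there are tangent
  vectors of `X`, that is, points with values in the dual numbers, on which it does not vanish
  (`rank_eq_zero_of_rank_le_two`).
* If `A` has rank three, or has rank four and `B` vanishes on `W`, then `X` is not terminal. After
  a change of coordinates `A` is the cone `x₂ x₃ = x₄² + δ x₅²`, with `δ = 0` or `δ = 1`, and `B`
  passes through the point `(0 : 1 : 0 : 0 : 0 : 0)` of its vertex (`exists_isNormalPencil`). The
  equation of `B` is linear in `x₁` along the cone, which gives a rational parametrization of `X`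
  by three parameters `r, s, t`. The divisor `r = 0` of the parameter space defines a discrete
  valuation of the function field whose centre `x` on `X` has codimension at least two. The form
  `N⁻¹ dr ∧ ds ∧ dt`, where `2 N` is the coefficient of `x₁`, is up to a constant the residue
  along `X` of the standard form of projective space. By the Jacobian criterion, in the form that
  at a point of dimension at most one of a normal variety the equations have the expected rank
  (`IsFractionsAt.jacobian`), it is regular at all points of codimension one which specialize to
  `x` (`IsParam.smul_mem_regularForms`). So it lies in the stalk of the canonical sheaf at `x`,
  but it does not vanish along `r = 0` (`not_vanishesAlong`). Hence the discrepancy of this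
  divisor is not positive (`IsNormalPencil.not_isTerminal`).

Only canonical stalks, function fields and local rings inside them occur: no resolution and no
blow-up is constructed, since an exceptional divisor is given by its valuation ring, and the local
rings of `X` are read off from its affine charts as rings of fractions of polynomials in the
coordinate functions.
-/

noncomputable section

namespace DelPezzo

/-! ### Charts of projective space -/

section

open MvPolynomial HomogeneousLocalization

section Chart
variable (k : Type u) [Field k] {n : ℕ} (j : Fin (n + 1))

theorem X_mem_grading (i : Fin (n + 1)) : X i ∈ grading k n 1 :=
  (mem_homogeneousSubmodule _ _).mpr (isHomogeneous_X k i)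

/-- The homomorphism from `k[x₀, …, xₙ]` to the degree-zero part of its localization at `xⱼ` which
sends `xᵢ` to `xᵢ / xⱼ`. -/
def toAway : MvPolynomial (Fin (n + 1)) k →+* Away (grading k n) (X j) :=
  eval₂Hom ((fromZeroRingHom (grading k n) _).comp (algebraMap k (grading k n 0)))
    fun i => Away.mk (grading k n) (X_mem_grading k j) 1 (X i)
      (by rw [smul_eq_mul, one_mul]; exact X_mem_grading k i)

variable {k}

/-- The inclusion of `k[x₀, …, xₙ]` into its localization at `xⱼ`. -/
abbrev toLocalization : MvPolynomial (Fin (n + 1)) k →+*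
    Localization.Away (X j : MvPolynomial (Fin (n + 1)) k) :=
  algebraMap _ _

theorem val_toAway_C (c : k) : (toAway k j (C c)).val = toLocalization j (C c) := by
  simp only [toAway, coe_eval₂Hom, eval₂_C]
  rfl

theorem val_toAway_X_mul (i : Fin (n + 1)) :
    (toAway k j (X i)).val * toLocalization j (X j) = toLocalization j (X i) := by
  simp only [toAway, coe_eval₂Hom, eval₂_X, Away.val_mk, Localization.mk_eq_mk']
  have h := IsLocalization.mk'_spec (Localization.Away (X j : MvPolynomial (Fin (n + 1)) k))
    (X i) (⟨X j ^ 1, ⟨1, rfl⟩⟩ : Submonoid.powers (X j : MvPolynomial (Fin (n + 1)) k))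
  simpa only [pow_one] using h

/-- A form `p` of degree `m` is sent to `p / xⱼᵐ`. -/
theorem val_toAway_mul_pow {p : MvPolynomial (Fin (n + 1)) k} {m : ℕ} (hp : p.IsHomogeneous m) :
    (toAway k j p).val * toLocalization j (X j) ^ m = toLocalization j p := by
  set v : Away (grading k n) (X j) →+* Localization.Away (X j : MvPolynomial (Fin (n + 1)) k) :=
    algebraMap _ _ with hv
  have hval : ∀ y, v y = y.val := fun y => rfl
  have key : ∀ d : Fin (n + 1) →₀ ℕ, ∀ c : k, v (toAway k j (monomial d c)) *
      toLocalization j (X j) ^ d.degree = toLocalization j (monomial d c) := by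
    intro d c
    rw [monomial_eq, Finsupp.prod_fintype _ _ (by simp), map_mul, map_mul, hval, val_toAway_C,
      map_mul, mul_assoc, Finsupp.degree_eq_sum, map_prod, map_prod, map_prod,
      ← Finset.prod_pow_eq_pow_sum, ← Finset.prod_mul_distrib]
    congr 1
    refine Finset.prod_congr rfl fun i _ => ?_
    rw [map_pow, map_pow, map_pow, ← mul_pow, hval, val_toAway_X_mul]
  rw [← hval]
  conv_lhs => rw [p.as_sum]
  conv_rhs => rw [p.as_sum]
  rw [map_sum, map_sum, map_sum, Finset.sum_mul]
  refine Finset.sum_congr rfl fun d hd => ?_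
  rw [← key d, hp.degree_eq_sum_deg_support hd]
  rfl

theorem toAway_eq_mk {p : MvPolynomial (Fin (n + 1)) k} {m : ℕ} (hp : p ∈ grading k n (m • 1)) :
    toAway k j p = Away.mk (grading k n) (X_mem_grading k j) m p hp := by
  apply val_injective
  have h := val_toAway_mul_pow j (p := p) (m := m) (by simpa using hp)
  rw [Away.val_mk, Localization.mk_eq_mk', IsLocalization.eq_mk'_iff_mul_eq, ← h, map_pow]

theorem toAway_surjective : Function.Surjective (toAway k j) := by
  intro x
  obtain ⟨m, a, ha, rfl⟩ := Away.mk_surjective (grading k n) (X_mem_grading k j) x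
  exact ⟨a, toAway_eq_mk j ha⟩

theorem isUnit_toLocalization :
    IsUnit (toLocalization (k := k) j (X j)) :=
  IsLocalization.Away.algebraMap_isUnit _

theorem toAway_X_self : toAway k j (X j) = 1 := by
  apply val_injective
  have h := val_toAway_X_mul (k := k) j j
  rw [val_one]
  exact (isUnit_toLocalization j).mul_right_cancel (by rw [h, one_mul])

/-- Dehomogenization has kernel generated by `xⱼ - 1`: the evaluation `xⱼ ↦ 1` factors through
it. -/
theorem toAway_eq_zero_iff (p : MvPolynomial (Fin (n + 1)) k) :
    toAway k j p = 0 ↔ p ∈ Ideal.span {(X j - 1 : MvPolynomial (Fin (n + 1)) k)} := by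
  constructor
  · intro hp
    set I : Ideal (MvPolynomial (Fin (n + 1)) k) := Ideal.span {X j - 1} with hI
    have hj : Ideal.Quotient.mk I (X j) = 1 := by
      rw [← sub_eq_zero, ← map_one (Ideal.Quotient.mk I), ← map_sub]
      exact Ideal.Quotient.eq_zero_iff_mem.mpr (Ideal.mem_span_singleton_self _)
    let ψ : Localization.Away (X j : MvPolynomial (Fin (n + 1)) k) →+*
        MvPolynomial (Fin (n + 1)) k ⧸ I :=
      IsLocalization.Away.lift (X j) (g := Ideal.Quotient.mk I) (by rw [hj]; exact isUnit_one)
    have e : ∀ p, ψ (toLocalization j p) = Ideal.Quotient.mk I p :=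
      fun p => IsLocalization.Away.lift_eq _ _ _
    let v : Away (grading k n) (X j) →+* Localization.Away (X j : MvPolynomial (Fin (n + 1)) k) :=
      algebraMap _ _
    have hψ : (ψ.comp v).comp (toAway k j) = Ideal.Quotient.mk I := by
      refine MvPolynomial.ringHom_ext (fun c => ?_) (fun i => ?_)
      · change ψ (toAway k j (C c)).val = _
        rw [val_toAway_C, e]
      · have h := congrArg ψ (val_toAway_X_mul (k := k) j i)
        rw [map_mul, e, e, hj, mul_one] at h
        exact h
    rw [← Ideal.Quotient.eq_zero_iff_mem, ← hψ]
    change ψ (v (toAway k j p)) = 0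
    rw [hp, map_zero, map_zero]
  · intro hp
    obtain ⟨q, rfl⟩ := Ideal.mem_span_singleton.mp hp
    rw [map_mul, map_sub, toAway_X_self, map_one, sub_self, zero_mul]

/-- The regular function on the chart `xⱼ ≠ 0` of `ℙⁿ` defined by a polynomial in the `xᵢ / xⱼ`. -/
def toChart : MvPolynomial (Fin (n + 1)) k →+* Γ(projectiveSpace k n, (chart k n j).1) :=
  (Proj.awayToSection (grading k n) (X j)).hom.comp (toAway k j)

theorem awayToSection_bijective :
    Function.Bijective (Proj.awayToSection (grading k n) (X j)).hom := by
  have h := Proj.basicOpenIsoAway_hom (grading k n) (X j) (X_mem_grading k j)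
    one_pos
  rw [← h]
  exact ConcreteCategory.bijective_of_isIso _

theorem toChart_surjective : Function.Surjective (toChart (k := k) j) :=
  (awayToSection_bijective j).2.comp (toAway_surjective j)

theorem toChart_apply (p : MvPolynomial (Fin (n + 1)) k) :
    toChart j p = Proj.awayToSection (grading k n) (X j) (toAway k j p) := rfl

theorem toChart_eq_zero_iff (p : MvPolynomial (Fin (n + 1)) k) :
    toChart j p = 0 ↔ p ∈ Ideal.span {(X j - 1 : MvPolynomial (Fin (n + 1)) k)} := by
  rw [← toAway_eq_zero_iff]
  exact map_eq_zero_iff (Proj.awayToSection (grading k n) (X j)).hom (awayToSection_bijective j).1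

theorem toChart_quadraticPoly (Q : Matrix (Fin (n + 1)) (Fin (n + 1)) k) :
    toChart j (quadraticPoly Q) = dehomogenize Q j :=
  congrArg (Proj.awayToSection (grading k n) (X j)) (toAway_eq_mk j (quadraticPoly_mem Q))

/-- A morphism from a scheme to an affine scheme which restricts on an open set `U` to the morphism
induced by `f` pulls functions back to `U` by `f`. -/
theorem appTop_of_ι_comp {Y : Scheme.{u}} {R : CommRingCat.{u}} (U : Y.Opens) (q : Y ⟶ Spec R)
    (f : R ⟶ Γ(Y, U)) (h : U.ι ≫ q = U.toSpecΓ ≫ Spec.map f) :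
    (Scheme.ΓSpecIso R).inv ≫ q.appTop ≫ Y.presheaf.map (homOfLE le_top).op = f := by
  have h2 := congrArg (fun f => (Scheme.ΓSpecIso R).inv ≫ f.appTop) h
  simp only [Scheme.Hom.comp_appTop, Scheme.Opens.toSpecΓ_appTop] at h2
  rw [← Scheme.ΓSpecIso_inv_naturality_assoc, Iso.inv_hom_id_assoc, ← Category.assoc,
    Iso.eq_comp_inv] at h2
  have e : U.ι.appTop ≫ U.topIso.hom = Y.presheaf.map (homOfLE le_top).op :=
    (Y.presheaf.map_comp _ _).symm
  rw [← h2, Category.assoc, e, Category.assoc]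

theorem toChart_C (c : k) :
    toChart j (C c) = (projectiveSpace k n).presheaf.map (homOfLE le_top).op
      ((projectiveSpaceToSpec k n).appTop ((Scheme.ΓSpecIso (.of k)).inv c)) := by
  have h1 : (Proj.basicOpen (grading k n) (X j)).ι ≫ projectiveSpaceToSpec k n =
      (Proj.basicOpen (grading k n) (X j)).toSpecΓ ≫
        Spec.map (CommRingCat.ofHom (algebraMap k (grading k n 0)) ≫
          CommRingCat.ofHom (fromZeroRingHom (grading k n) _) ≫
            Proj.awayToSection (grading k n) (X j)) := by
    have h := Proj.awayι_toSpecZero (grading k n) (X j) (X_mem_grading k j) one_pos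
    rw [← Proj.basicOpenIsoSpec_inv_ι, Category.assoc, Iso.inv_comp_eq,
      Proj.basicOpenIsoSpec_hom, Proj.basicOpenToSpec] at h
    rw [projectiveSpaceToSpec]
    erw [reassoc_of% h]
    simp only [Spec.map_comp, Category.assoc]
  have h2 := congrArg (fun f => f.hom c) (appTop_of_ι_comp _ _ _ h1)
  refine Eq.trans ?_ h2.symm
  rw [toChart_apply, toAway, coe_eval₂Hom, eval₂_C]
  rfl
end Chart

end

/-! ### Charts and local rings of an intersection of two quadrics -/

section

open MvPolynomial

/-- The ring `R` consists of the fractions `p(ξ) / q(ξ)` with `q` outside the ideal `I`. -/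
def IsFractionsAt {k K σ : Type*} [Field k] [Field K] [Algebra k K] (ξ : σ → K)
    (I : Ideal (MvPolynomial σ k)) (R : Subalgebra k K) : Prop :=
  ∀ f, f ∈ R ↔ ∃ p q : MvPolynomial σ k, q ∉ I ∧ f = aeval ξ p / aeval ξ q

section LocalRings
variable {k : Type u} [Field k] {X : Scheme.{u}} [IsIntegral X] (π : X ⟶ Spec (.of k))

/-- The local ring of `X` at `x` as a stalk and as a subring of the function field. -/
def stalkEquivLocalRing (x : X) : X.presheaf.stalk x ≃+* localRing π x :=
  RingEquiv.ofBijective (algebraMap (X.presheaf.stalk x) X.functionField).rangeRestrict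
    ⟨fun _ _ h => IsFractionRing.injective (X.presheaf.stalk x) X.functionField
      (congrArg Subtype.val h), RingHom.rangeRestrict_surjective _⟩

theorem localRing_le_of_specializes {x y : X} (h : y ⤳ x) : localRing π x ≤ localRing π y := by
  rintro _ ⟨s, rfl⟩
  refine ⟨X.presheaf.stalkSpecializes h s, ?_⟩
  simp only [RingHom.algebraMap_toAlgebra, ← CommRingCat.comp_apply,
    TopCat.Presheaf.stalkSpecializes_comp]
end LocalRings

section ChartOfIntersection
variable {k : Type u} [Field k] {X : Scheme.{u}} {n : ℕ}
  {π : X ⟶ Spec (.of k)} {Q₁ Q₂ : Matrix (Fin (n + 1)) (Fin (n + 1)) k}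
  {i : X ⟶ projectiveSpace k n}

/-- The ideal of the affine chart `xⱼ = 1` of the intersection of the quadrics `Q₁` and `Q₂`. -/
def chartIdeal (Q₁ Q₂ : Matrix (Fin (n + 1)) (Fin (n + 1)) k) (j : Fin (n + 1)) :
    Ideal (MvPolynomial (Fin (n + 1)) k) :=
  Ideal.span {MvPolynomial.X j - 1, quadraticPoly Q₁, quadraticPoly Q₂}

/-- The regular function on the chart `xⱼ ≠ 0` of `X` defined by a polynomial. -/
def toSections (i : X ⟶ projectiveSpace k n) (j : Fin (n + 1)) :
    MvPolynomial (Fin (n + 1)) k →+* Γ(X, i ⁻¹ᵁ (chart k n j).1) :=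
  (i.app (chart k n j).1).hom.comp (toChart j)

theorem toSections_apply (j : Fin (n + 1)) (p : MvPolynomial (Fin (n + 1)) k) :
    toSections i j p = i.app (chart k n j).1 (toChart j p) := rfl

variable (hi : IsIntersectionOfQuadrics π Q₁ Q₂ i) (j : Fin (n + 1))
include hi

theorem isAffineOpen_preimage_chart : IsAffineOpen (i ⁻¹ᵁ (chart k n j).1) :=
  have := hi.closedImmersion
  (chart k n j).2.preimage i

theorem toSections_surjective : Function.Surjective (toSections i j) :=
  have := hi.closedImmersion
  (i.app_surjective _ (chart k n j).2).comp (toChart_surjective j)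

/-- Together with `toSections_surjective` this identifies the coordinate ring of the chart with the
quotient of the polynomial ring by `chartIdeal`. -/
theorem toSections_eq_zero_iff (p : MvPolynomial (Fin (n + 1)) k) :
    toSections i j p = 0 ↔ p ∈ chartIdeal Q₁ Q₂ j := by
  have := hi.closedImmersion
  have hker : ∀ s, i.app (chart k n j).1 s = 0 ↔
      s ∈ Ideal.span {dehomogenize Q₁ j, dehomogenize Q₂ j} := by
    intro s
    rw [← hi.ideal_eq j, Scheme.Hom.ker_apply]
    exact RingHom.mem_ker.symm
  rw [toSections_apply, hker, ← toChart_quadraticPoly, ← toChart_quadraticPoly, chartIdeal,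
    Ideal.mem_span_insert (y := MvPolynomial.X j - 1)]
  constructor
  · intro h
    obtain ⟨a, b, hab⟩ := Ideal.mem_span_pair.mp h
    obtain ⟨a, rfl⟩ := toChart_surjective j a
    obtain ⟨b, rfl⟩ := toChart_surjective j b
    rw [← map_mul, ← map_mul, ← map_add, eq_comm, ← sub_eq_zero, ← map_sub, toChart_eq_zero_iff,
      Ideal.mem_span_singleton'] at hab
    obtain ⟨c, hc⟩ := hab
    refine ⟨c, a * quadraticPoly Q₁ + b * quadraticPoly Q₂, Ideal.mem_span_pair.mpr ⟨a, b, rfl⟩, ?_⟩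
    rw [hc, sub_add_cancel]
  · rintro ⟨c, z, hz, rfl⟩
    obtain ⟨a, b, rfl⟩ := Ideal.mem_span_pair.mp hz
    have h0 : toChart (k := k) j (MvPolynomial.X j - 1) = 0 :=
      (toChart_eq_zero_iff j _).mpr (Ideal.mem_span_singleton_self _)
    rw [map_add, map_mul, h0, mul_zero, zero_add, map_add, map_mul, map_mul]
    exact Ideal.mem_span_pair.mpr ⟨_, _, rfl⟩

/-- A chart of `X` with a point in some nontrivial ring is not empty. -/
theorem nonempty_preimage_chart {T : Type*} [CommRing T] [Nontrivial T]
    (f : MvPolynomial (Fin (n + 1)) k →+* T) (hf : ∀ p ∈ chartIdeal Q₁ Q₂ j, f p = 0) :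
    Nonempty (i ⁻¹ᵁ (chart k n j).1) := by
  by_contra hne
  have h0 : i ⁻¹ᵁ (chart k n j).1 = ⊥ := by
    ext x
    exact ⟨fun hx => hne ⟨x, hx⟩, fun hx => hx.elim⟩
  have : Subsingleton Γ(X, i ⁻¹ᵁ (chart k n j).1) := by
    rw [h0]
    infer_instance
  have h1 := hf 1 ((toSections_eq_zero_iff hi j 1).mp (Subsingleton.elim _ _))
  exact one_ne_zero ((map_one f).symm.trans h1)

variable [IsIntegral X]

variable (i) in
omit hi in
/-- The rational function `xₗ / xⱼ` on `X`, where `xⱼ` does not vanish identically on `X`. -/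
def coord [Nonempty (i ⁻¹ᵁ (chart k n j).1)] (π : X ⟶ Spec (.of k)) (l : Fin (n + 1)) :
    FunField π :=
  X.germToFunctionField (i ⁻¹ᵁ (chart k n j).1) (toSections i j (MvPolynomial.X l))

variable [Nonempty (i ⁻¹ᵁ (chart k n j).1)]

theorem algebraMap_eq_germ_toSections (c : k) : algebraMap k (FunField π) c =
    X.germToFunctionField (i ⁻¹ᵁ (chart k n j).1) (toSections i j (C c)) := by
  have h1 : toSections i j (C c) = X.presheaf.map (homOfLE le_top).op (constants π c) := by
    rw [toSections_apply, toChart_C, ← hi.comp_eq]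
    exact congrArg (fun f : Γ(projectiveSpace k n, ⊤) ⟶ Γ(X, i ⁻¹ᵁ (chart k n j).1) =>
      f.hom ((projectiveSpaceToSpec k n).appTop ((Scheme.ΓSpecIso (.of k)).inv c)))
      (i.naturality (homOfLE le_top : (chart k n j).1 ⟶ ⊤).op)
  rw [h1]
  exact (TopCat.Presheaf.germ_res_apply X.presheaf (homOfLE le_top) _ _ _).symm

theorem aeval_coord (p : MvPolynomial (Fin (n + 1)) k) : aeval (coord i j π) p =
    X.germToFunctionField (i ⁻¹ᵁ (chart k n j).1) (toSections i j p) := by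
  let g : MvPolynomial (Fin (n + 1)) k →+* FunField π :=
    (X.germToFunctionField (i ⁻¹ᵁ (chart k n j).1)).hom.comp (toSections i j)
  have h : (aeval (coord i j π) : _ →ₐ[k] FunField π).toRingHom = g := by
    refine MvPolynomial.ringHom_ext (fun c => ?_) (fun l => ?_)
    · exact (aeval_C _ _).trans (algebraMap_eq_germ_toSections hi j c)
    · exact aeval_X _ _
  exact congrArg (fun f => f p) h

theorem aeval_coord_eq_zero_iff (p : MvPolynomial (Fin (n + 1)) k) :
    aeval (coord i j π) p = 0 ↔ p ∈ chartIdeal Q₁ Q₂ j := by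
  rw [aeval_coord hi, ← toSections_eq_zero_iff hi]
  exact map_eq_zero_iff (X.germToFunctionField (i ⁻¹ᵁ (chart k n j).1)).hom
    (Scheme.germToFunctionField_injective X _)

theorem exists_eq_aeval_coord_div (f : FunField π) : ∃ p q : MvPolynomial (Fin (n + 1)) k,
    aeval (coord i j π) q ≠ 0 ∧ f = aeval (coord i j π) p / aeval (coord i j π) q := by
  have hfrac : IsFractionRing Γ(X, i ⁻¹ᵁ (chart k n j).1) X.functionField :=
    functionField_isFractionRing_of_isAffineOpen X _ (isAffineOpen_preimage_chart hi j)
  obtain ⟨a, b, hb, hab⟩ := IsFractionRing.div_surjective Γ(X, i ⁻¹ᵁ (chart k n j).1)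
    (show X.functionField from f)
  obtain ⟨p, rfl⟩ := toSections_surjective hi j a
  obtain ⟨q, rfl⟩ := toSections_surjective hi j b
  refine ⟨p, q, ?_, ?_⟩
  · rw [Ne, aeval_coord_eq_zero_iff hi, ← toSections_eq_zero_iff hi]
    exact nonZeroDivisors.ne_zero hb
  · rw [aeval_coord hi, aeval_coord hi]
    exact hab.symm

/-- The stalk, seen inside the function field, consists of the fractions of polynomials in the
coordinates whose denominators do not vanish at `x`. -/
theorem isFractionsAt_of_isLocalization {x : X} (hx : x ∈ i ⁻¹ᵁ (chart k n j).1)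
    (I : Ideal Γ(X, i ⁻¹ᵁ (chart k n j).1)) [I.IsPrime]
    (h : @IsLocalization.AtPrime _ _ (X.presheaf.stalk x) _
      (X.presheaf.algebra_section_stalk ⟨x, hx⟩) I _) :
    IsFractionsAt (coord i j π) (I.comap (toSections i j)) (localRing π x) := by
  let := X.presheaf.algebra_section_stalk ⟨x, hx⟩
  let ι : X.presheaf.stalk x →+* FunField π := algebraMap (X.presheaf.stalk x) X.functionField
  let g := X.presheaf.germ (i ⁻¹ᵁ (chart k n j).1) x hx
  have e : ∀ p, aeval (coord i j π) p = ι (g (toSections i j p)) := by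
    intro p
    rw [aeval_coord hi]
    exact (Scheme.algebraMap_germ_eq_germToFunctionField X hx _).symm
  have hu : ∀ q ∉ I.comap (toSections i j), IsUnit (g (toSections i j q)) :=
    fun q hq => IsLocalization.map_units (X.presheaf.stalk x)
      (⟨toSections i j q, hq⟩ : I.primeCompl)
  have hne : ∀ q ∉ I.comap (toSections i j), aeval (coord i j π) q ≠ 0 := by
    intro q hq
    rw [e]
    exact ((hu q hq).map ι).ne_zero
  intro f
  constructor
  · rintro ⟨s, hs⟩
    obtain ⟨⟨a, b⟩, hab⟩ := IsLocalization.surj I.primeCompl s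
    obtain ⟨p, rfl⟩ := toSections_surjective hi j a
    obtain ⟨q, hq⟩ := toSections_surjective hi j b
    have hqI : q ∉ I.comap (toSections i j) := by
      rw [Ideal.mem_comap, hq]
      exact b.2
    refine ⟨p, q, hqI, ?_⟩
    rw [eq_div_iff (hne q hqI), e, e, hq, ← show ι s = f from hs, ← map_mul]
    exact congrArg ι hab
  · rintro ⟨p, q, hq, rfl⟩
    obtain ⟨v, hv⟩ := hu q hq
    have h1 : ι (g (toSections i j p) * ↑v⁻¹) = aeval (coord i j π) p / aeval (coord i j π) q := by
      rw [eq_div_iff (hne q hq), e, e, ← hv, ← map_mul, Units.inv_mul_cancel_right]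
    exact ⟨_, h1⟩

theorem exists_isFractionsAt {x : X} (hx : x ∈ i ⁻¹ᵁ (chart k n j).1) :
    ∃ I : Ideal (MvPolynomial (Fin (n + 1)) k), I.IsPrime ∧ chartIdeal Q₁ Q₂ j ≤ I ∧
      IsFractionsAt (coord i j π) I (localRing π x) := by
  have hU := isAffineOpen_preimage_chart hi j
  refine ⟨_, inferInstance, fun p hp => ?_, isFractionsAt_of_isLocalization hi j hx
    (hU.primeIdealOf ⟨x, hx⟩).asIdeal (hU.isLocalization_stalk ⟨x, hx⟩)⟩
  rw [Ideal.mem_comap, (toSections_eq_zero_iff hi j p).mpr hp]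
  exact zero_mem _

/-- Every prime ideal containing the equations of the chart is a point of `X`. -/
theorem exists_point_isFractionsAt (I : Ideal (MvPolynomial (Fin (n + 1)) k)) [hI : I.IsPrime]
    (hle : chartIdeal Q₁ Q₂ j ≤ I) :
    ∃ x ∈ i ⁻¹ᵁ (chart k n j).1, IsFractionsAt (coord i j π) I (localRing π x) := by
  have hU := isAffineOpen_preimage_chart hi j
  have hsurj := toSections_surjective hi j
  have hker : RingHom.ker (toSections i j) ≤ I :=
    fun p hp => hle ((toSections_eq_zero_iff hi j p).mp hp)
  have hI' : (I.map (toSections i j)).IsPrime := Ideal.map_isPrime_of_surjective hsurj hker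
  have hx : hU.fromSpec ⟨I.map (toSections i j), hI'⟩ ∈ i ⁻¹ᵁ (chart k n j).1 := by
    rw [← SetLike.mem_coe, ← hU.range_fromSpec]
    exact ⟨_, rfl⟩
  refine ⟨_, hx, ?_⟩
  have h := isFractionsAt_of_isLocalization hi j hx (I.map (toSections i j))
    (hU.isLocalization_stalk' ⟨_, hI'⟩ hx)
  rwa [Ideal.comap_map_of_surjective' _ hsurj, sup_eq_left.mpr hker] at h

end ChartOfIntersection

end

/-! ### Derivations and local rings of dimension one -/

section

open MvPolynomial

section ResidueField
variable {k R : Type u} [Field k] [CommRing R] [IsDomain R] [IsLocalRing R] [Algebra k R]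

/-- Lifts of algebraically independent elements of the residue field, together with a nonzero
element of the maximal ideal, are algebraically independent. -/
theorem trdeg_residueField_add_one_le {r : R} (hr : r ∈ IsLocalRing.maximalIdeal R)
    (hr0 : r ≠ 0) :
    Algebra.trdeg k (IsLocalRing.ResidueField R) + 1 ≤ Algebra.trdeg k R := by
  obtain ⟨ι, x, hx⟩ := exists_isTranscendenceBasis' k (IsLocalRing.ResidueField R)
  let res : R →ₐ[k] IsLocalRing.ResidueField R := IsScalarTower.toAlgHom k R _
  have hres : Function.Surjective res := IsLocalRing.residue_surjective
  choose y hy using fun a => hres (x a)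
  have hyx : res ∘ y = x := funext hy
  have hyi : AlgebraicIndependent k y := by
    apply AlgebraicIndependent.of_comp res
    rw [hyx]
    exact hx.1
  have hinj : ∀ a ∈ Algebra.adjoin k (Set.range y), res a = 0 → a = 0 := by
    intro a ha h0
    rw [Algebra.adjoin_range_eq_range_aeval] at ha
    obtain ⟨p, rfl⟩ := ha
    have h1 : aeval x p = 0 := by
      rw [← h0, ← hyx]
      exact (comp_aeval_apply y res p).symm
    rw [(injective_iff_map_eq_zero _).mp hx.1 p h1]
    exact map_zero _
  have htr : Transcendental (Algebra.adjoin k (Set.range y)) r := by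
    intro halg
    obtain ⟨q, hq0, hq⟩ := halg.exists_nonzero_coeff_and_aeval_eq_zero
      (mem_nonZeroDivisors_of_ne_zero hr0)
    apply hq0
    apply Subtype.ext
    refine hinj _ (q.coeff 0).2 ?_
    have hresr : res r = 0 := (IsLocalRing.residue_eq_zero_iff r).mpr hr
    have h2 : (q.coeff 0 : R) = -(r * Polynomial.aeval r q.divX) := by
      have h3 := congrArg (Polynomial.aeval r) q.X_mul_divX_add
      rw [map_add, map_mul, Polynomial.aeval_X, Polynomial.aeval_C, hq] at h3
      exact eq_neg_of_add_eq_zero_right h3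
    rw [h2, map_neg, map_mul, hresr, zero_mul, neg_zero]
  have h := ((hyi.option_iff_transcendental r).mpr htr).cardinalMk_le_trdeg
  rwa [Cardinal.mk_option, hx.cardinalMk_eq_trdeg] at h

/-- In characteristic zero a derivation of a field which vanishes on a transcendence basis is
zero. -/
theorem derivation_eq_zero_of_isTranscendenceBasis {k κ ι : Type*} [Field k] [CharZero k] [Field κ]
    [Algebra k κ] {x : ι → κ} (hx : IsTranscendenceBasis k x) (d : Derivation k κ κ)
    (hd : ∀ a, d (x a) = 0) : d = 0 := by
  let F := IntermediateField.adjoin k (Set.range x)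
  have : CharZero F := charZero_of_injective_algebraMap (algebraMap k F).injective
  have := hx.isAlgebraic_field
  have hF : ∀ a ∈ F, d a = 0 := by
    intro a ha
    induction ha using IntermediateField.adjoin_induction with
    | mem a ha =>
      obtain ⟨b, rfl⟩ := ha
      exact hd b
    | algebraMap c => exact d.map_algebraMap c
    | add a b _ _ h1 h2 => rw [map_add, h1, h2, add_zero]
    | inv a _ h => rw [d.leibniz_inv, h, smul_zero]
    | mul a b _ _ h1 h2 => rw [d.leibniz, h1, h2, smul_zero, smul_zero, add_zero]
  let L : κ →ₗ[F] κ :=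
    { toFun := d
      map_add' := map_add d
      map_smul' := fun c a => by
        rw [Algebra.smul_def, d.leibniz, hF _ (show algebraMap F κ c ∈ F from c.2), smul_zero,
          add_zero]
        rfl }
  -- Over `F` the extension `κ / F` is algebraic and separable, so it has no derivations.
  let d' : Derivation F κ κ := Derivation.mk' L d.leibniz
  have hu : Algebra.FormallyUnramified F κ := Algebra.FormallyUnramified.of_isSeparable F κ
  have h0 : ∀ a, d' a = 0 := by
    intro a
    rw [← d'.liftKaehlerDifferential_comp_D, Subsingleton.elim (KaehlerDifferential.D F κ a) 0,
      map_zero]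
  ext a
  exact h0 a

omit [IsDomain R] in
/-- In characteristic zero a derivation from a local ring with principal maximal ideal to the
residue field is determined by its values at a uniformizer and at lifts of a transcendence basis. -/
theorem derivation_residueField_eq_zero [CharZero k] {ι : Type*}
    {y : ι → R} (hy : IsTranscendenceBasis k fun a => IsLocalRing.residue R (y a))
    {r : R} (hr : IsLocalRing.maximalIdeal R = Ideal.span {r})
    (d : Derivation k R (IsLocalRing.ResidueField R)) (hdr : d r = 0) (hd : ∀ a, d (y a) = 0) :
    d = 0 := by
  have hm : ∀ a ∈ IsLocalRing.maximalIdeal R, d a = 0 := by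
    intro a ha
    obtain ⟨b, rfl⟩ := Ideal.mem_span_singleton'.mp (hr ▸ ha)
    have h1 : (IsLocalRing.residue R) r = 0 := by
      rw [IsLocalRing.residue_eq_zero_iff, hr]
      exact Ideal.mem_span_singleton_self r
    rw [d.leibniz, hdr, smul_zero, zero_add, Algebra.smul_def]
    exact mul_eq_zero_of_left h1 _
  have hs := IsLocalRing.residue_surjective (R := R)
  have hcongr : ∀ a b, IsLocalRing.residue R a = IsLocalRing.residue R b → d a = d b := by
    intro a b hab
    rw [← sub_eq_zero, ← map_sub] at hab ⊢
    exact hm _ ((IsLocalRing.residue_eq_zero_iff _).mp hab)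
  -- The derivation kills the maximal ideal, so it descends to the residue field.
  let s := Function.surjInv hs
  have hss : ∀ z, IsLocalRing.residue R (s z) = z := Function.surjInv_eq hs
  let L : IsLocalRing.ResidueField R →ₗ[k] IsLocalRing.ResidueField R :=
    { toFun := fun z => d (s z)
      map_add' := fun z w => by
        rw [← map_add]
        apply hcongr
        rw [map_add, hss, hss, hss]
      map_smul' := fun c z => by
        rw [← d.map_smul, RingHom.id_apply]
        apply hcongr
        rw [hss, Algebra.smul_def, Algebra.smul_def, map_mul, hss]
        rfl }
  let d' : Derivation k (IsLocalRing.ResidueField R) (IsLocalRing.ResidueField R) :=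
    Derivation.mk' L fun z w => by
      change d (s (z * w)) = z • d (s w) + w • d (s z)
      have h1 : d (s (z * w)) = d (s z * s w) := by
        apply hcongr
        rw [map_mul, hss, hss, hss]
      rw [h1, d.leibniz, Algebra.smul_def, Algebra.smul_def]
      exact congrArg₂ (· + ·) (congrArg (· * _) (hss z)) (congrArg (· * _) (hss w))
  have h0 : d' = 0 := derivation_eq_zero_of_isTranscendenceBasis hy d' fun a =>
    (hcongr _ _ (hss _)).trans (hd a)
  ext a
  exact (hcongr _ _ (hss _)).symm.trans (DFunLike.congr_fun h0 (IsLocalRing.residue R a))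

/-- The tangent space of a local domain of dimension at most one, with principal maximal ideal, has
dimension at most the transcendence degree. -/
theorem finrank_derivation_le [CharZero k] {m : ℕ} (hm : Algebra.trdeg k R ≤ m)
    (hR : (IsLocalRing.maximalIdeal R).IsPrincipal) :
    Module.Finite (IsLocalRing.ResidueField R) (Derivation k R (IsLocalRing.ResidueField R)) ∧
    Module.finrank (IsLocalRing.ResidueField R)
      (Derivation k R (IsLocalRing.ResidueField R)) ≤ m := by
  let κ := IsLocalRing.ResidueField R
  obtain ⟨r, hr⟩ := hR
  obtain ⟨ι, x, hx⟩ := exists_isTranscendenceBasis' k κ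
  choose y hy using fun a => IsLocalRing.residue_surjective (x a)
  have hy' : IsTranscendenceBasis k fun a => IsLocalRing.residue R (y a) := by
    convert hx using 1
    exact funext hy
  have hcard := hx.cardinalMk_eq_trdeg
  have key : ∀ (α : Type u) (g : α → R), Cardinal.mk α ≤ m →
      (∀ d : Derivation k R κ, (∀ a, d (g a) = 0) → d = 0) →
      Module.Finite κ (Derivation k R κ) ∧ Module.finrank κ (Derivation k R κ) ≤ m := by
    intro α g hα hg
    have hfin : Finite α :=
      Cardinal.lt_aleph0_iff_finite.mp (hα.trans_lt (Cardinal.natCast_lt_aleph0))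
    have := Fintype.ofFinite α
    let E : Derivation k R κ →ₗ[κ] (α → κ) :=
      { toFun := fun d a => d (g a)
        map_add' := fun _ _ => rfl
        map_smul' := fun _ _ => rfl }
    have hE : Function.Injective E := by
      rw [injective_iff_map_eq_zero]
      exact fun d hd => hg d fun a => congrFun hd a
    refine ⟨Module.Finite.of_injective E hE,
      (LinearMap.finrank_le_finrank_of_injective hE).trans ?_⟩
    rw [Module.finrank_fintype_fun_eq_card]
    rw [Cardinal.mk_fintype] at hα
    exact_mod_cast hα
  by_cases h0 : r = 0
  · subst h0
    have hbot : IsLocalRing.maximalIdeal R = ⊥ := by rw [hr]; exact Submodule.span_zero_singleton _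
    refine key ι y ?_ fun d hd => derivation_residueField_eq_zero hy' hr d (map_zero d) hd
    rw [hcard]
    refine le_trans ?_ hm
    exact trdeg_le_of_surjective (IsScalarTower.toAlgHom k R κ) IsLocalRing.residue_surjective
  · have hrm : r ∈ IsLocalRing.maximalIdeal R := by
      rw [hr]
      exact Submodule.mem_span_singleton_self r
    refine key (Option ι) (fun o => o.elim r y) ?_ fun d hd =>
      derivation_residueField_eq_zero hy' hr d (hd none) fun a => hd (some a)
    rw [Cardinal.mk_option, hcard]
    exact (trdeg_residueField_add_one_le hrm h0).trans hm

end ResidueField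

section Fractions
variable {k K : Type u} [Field k] [Field K] [Algebra k K] {σ : Type}
  {ξ : σ → K} {I : Ideal (MvPolynomial σ k)} [I.IsPrime] {R : Subalgebra k K}

/-- A ring of fractions of a polynomial subring is a quotient of a localized polynomial ring. -/
theorem IsFractionsAt.exists_surjective (hR : IsFractionsAt ξ I R)
    (hI : ∀ p : MvPolynomial σ k, aeval ξ p = 0 → p ∈ I) :
    ∃ a : Localization.AtPrime I →+* R, Function.Surjective a ∧
      ∀ p : MvPolynomial σ k, (a (algebraMap _ _ p) : K) = aeval ξ p := by
  have hu : ∀ q : I.primeCompl, IsUnit ((aeval ξ : MvPolynomial σ k →ₐ[k] K).toRingHom q) :=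
    fun q => isUnit_iff_ne_zero.mpr fun h => q.2 (hI _ h)
  let b : Localization.AtPrime I →+* K := IsLocalization.lift hu
  have hb : ∀ p : MvPolynomial σ k, b (algebraMap _ _ p) = aeval ξ p :=
    fun p => IsLocalization.lift_eq hu p
  have hbR : ∀ (p q : MvPolynomial σ k) (hq : q ∉ I),
      b (IsLocalization.mk' _ p (⟨q, hq⟩ : I.primeCompl)) = aeval ξ p / aeval ξ q := by
    intro p q hq
    rw [eq_div_iff (fun h => hq (hI _ h)), ← hb q, ← hb p, ← map_mul]
    exact congrArg b (IsLocalization.mk'_spec _ _ _)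
  have hmem : ∀ z, b z ∈ R := by
    intro z
    obtain ⟨p, q, rfl⟩ := IsLocalization.exists_mk'_eq I.primeCompl z
    exact (hR _).mpr ⟨p, q, q.2, hbR p q q.2⟩
  refine ⟨b.codRestrict R hmem, fun f => ?_, hb⟩
  obtain ⟨p, q, hq, hf⟩ := (hR f).mp f.2
  exact ⟨IsLocalization.mk' _ p (⟨q, hq⟩ : I.primeCompl), Subtype.ext ((hbR p q hq).trans hf.symm)⟩

theorem IsFractionsAt.isNoetherianRing [Finite σ] (hR : IsFractionsAt ξ I R)
    (hI : ∀ p : MvPolynomial σ k, aeval ξ p = 0 → p ∈ I) : IsNoetherianRing R := by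
  obtain ⟨a, ha, -⟩ := hR.exists_surjective hI
  have : IsNoetherianRing (Localization.AtPrime I) :=
    IsLocalization.isNoetherianRing I.primeCompl _ inferInstance
  exact isNoetherianRing_of_surjective _ _ a ha

theorem IsFractionsAt.aeval_mem (hR : IsFractionsAt ξ I R) (p : MvPolynomial σ k) :
    aeval ξ p ∈ R :=
  (hR _).mpr ⟨p, 1, fun h => Ideal.IsPrime.ne_top ‹_› ((Ideal.eq_top_iff_one _).mpr h), by simp⟩

/-- A homomorphism out of the polynomial ring which kills the relations and inverts the elements
outside `I` extends to the ring of fractions. -/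
theorem IsFractionsAt.exists_lift (hR : IsFractionsAt ξ I R)
    (hI : ∀ p : MvPolynomial σ k, aeval ξ p = 0 → p ∈ I) {T : Type*} [CommRing T]
    (φ : MvPolynomial σ k →+* T)
    (hu : ∀ q ∉ I, IsUnit (φ q)) (h0 : ∀ p : MvPolynomial σ k, aeval ξ p = 0 → φ p = 0) :
    ∃ ψ : R →+* T, ∀ p : MvPolynomial σ k, ψ ⟨aeval ξ p, hR.aeval_mem p⟩ = φ p := by
  obtain ⟨a, ha, hap⟩ := hR.exists_surjective hI
  have hu' : ∀ q : I.primeCompl, IsUnit (φ q) := fun q => hu q q.2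
  let b : Localization.AtPrime I →+* T := IsLocalization.lift hu'
  have hb : ∀ p : MvPolynomial σ k, b (algebraMap _ _ p) = φ p :=
    fun p => IsLocalization.lift_eq hu' p
  have hker : RingHom.ker a ≤ RingHom.ker b := by
    intro z hz
    obtain ⟨p, q, rfl⟩ := IsLocalization.exists_mk'_eq I.primeCompl z
    rw [RingHom.mem_ker] at hz ⊢
    have h1 := IsLocalization.mk'_spec (Localization.AtPrime I) p q
    have h2 : aeval ξ p = 0 := by
      rw [← hap, ← h1, map_mul, hz, zero_mul]
      rfl
    have h3 := congrArg b h1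
    rw [map_mul, hb, hb, h0 p h2] at h3
    exact (hu' q).mul_left_eq_zero.mp h3
  refine ⟨a.liftOfSurjective ha ⟨b, hker⟩, fun p => ?_⟩
  have h1 : (⟨aeval ξ p, hR.aeval_mem p⟩ : R) = a (algebraMap _ _ p) := Subtype.ext (hap p).symm
  rw [h1, RingHom.liftOfSurjective_comp_apply]
  exact hb p

end Fractions

end

/-! ### The Jacobian criterion -/

section

open MvPolynomial Matrix

/-- Normal Noetherian local rings of dimension at most one have a principal maximal ideal. -/
theorem maximalIdeal_isPrincipal_of_ringKrullDim_le_one {R : Type*} [CommRing R] [IsDomain R]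
    [IsLocalRing R] [IsNoetherianRing R] [IsIntegrallyClosed R] (h : ringKrullDim R ≤ 1) :
    (IsLocalRing.maximalIdeal R).IsPrincipal := by
  have h34 := (tfae_of_isNoetherianRing_of_isLocalRing_of_isDomain R).out 3 4
  refine h34.mp ⟨inferInstance, fun P hP hP' => ?_⟩
  have : Ring.KrullDimLE 1 R := Ring.krullDimLE_iff.mpr h
  exact IsLocalRing.eq_maximalIdeal (Ring.krullDimLE_one_iff_of_isPrime_bot.mp this P hP hP')

section Quadric
variable {k : Type*} [Field k] {n : ℕ}

theorem aeval_quadraticPoly {T : Type*} [CommRing T] [Algebra k T] (v : Fin (n + 1) → T)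
    (Q : Matrix (Fin (n + 1)) (Fin (n + 1)) k) :
    aeval v (quadraticPoly Q) = v ⬝ᵥ Q.map (algebraMap k T) *ᵥ v := by
  simp only [quadraticPoly, map_sum, map_mul, aeval_C, aeval_X, dotProduct, mulVec, map_apply,
    Finset.mul_sum]
  refine Finset.sum_congr rfl fun a _ => Finset.sum_congr rfl fun b _ => by ring

theorem aeval_dualNumber_quadraticPoly {T : Type*} [CommRing T] [Algebra k T]
    (v c : Fin (n + 1) → T) (Q : Matrix (Fin (n + 1)) (Fin (n + 1)) k) (hQ : Q.IsSymm)
    (hv : v ⬝ᵥ Q.map (algebraMap k T) *ᵥ v = 0) (hc : c ⬝ᵥ Q.map (algebraMap k T) *ᵥ v = 0) :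
    aeval (fun l => (TrivSqZeroExt.inl (v l) + TrivSqZeroExt.inr (c l) : DualNumber T))
      (quadraticPoly Q) = 0 := by
  have hd : v ⬝ᵥ Q.map (algebraMap k T) *ᵥ c = 0 := by
    rw [dotProduct_mulVec, dotProduct_comm, ← mulVec_transpose, ← transpose_map, hQ.eq, hc]
  rw [aeval_quadraticPoly]
  ext
  · simpa [dotProduct, mulVec, TrivSqZeroExt.fst_sum, TrivSqZeroExt.algebraMap_eq_inl'] using hv
  · have h := congrArg₂ (· + ·) hd hc
    simpa [dotProduct, mulVec, TrivSqZeroExt.fst_sum, TrivSqZeroExt.snd_sum,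
      TrivSqZeroExt.algebraMap_eq_inl', Finset.sum_add_distrib] using h

/-- The dual number point `v + ε c` lies on the chart `xⱼ = 1` of the intersection of quadrics. -/
theorem aeval_dualNumber_eq_zero {T : Type*} [CommRing T] [Algebra k T]
    (v c : Fin (n + 1) → T) {A B : Matrix (Fin (n + 1)) (Fin (n + 1)) k}
    (hA : A.IsSymm) (hB : B.IsSymm) {j : Fin (n + 1)} (hvj : v j = 1) (hcj : c j = 0)
    (hvA : v ⬝ᵥ A.map (algebraMap k T) *ᵥ v = 0) (hvB : v ⬝ᵥ B.map (algebraMap k T) *ᵥ v = 0)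
    (hcA : c ⬝ᵥ A.map (algebraMap k T) *ᵥ v = 0) (hcB : c ⬝ᵥ B.map (algebraMap k T) *ᵥ v = 0)
    (p : MvPolynomial (Fin (n + 1)) k) (hp : p ∈ chartIdeal A B j) :
    aeval (fun l => (TrivSqZeroExt.inl (v l) + TrivSqZeroExt.inr (c l) : DualNumber T)) p = 0 := by
  have h : chartIdeal A B j ≤ RingHom.ker
      (aeval (R := k) fun l =>
        (TrivSqZeroExt.inl (v l) + TrivSqZeroExt.inr (c l) : DualNumber T)) := by
    refine Ideal.span_le.mpr ?_
    rintro q (rfl | rfl | rfl)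
    · rw [SetLike.mem_coe, RingHom.mem_ker]
      ext <;> simp [hvj, hcj]
    · exact aeval_dualNumber_quadraticPoly v c A hA hvA hcA
    · exact aeval_dualNumber_quadraticPoly v c B hB hvB hcB
  exact h hp
end Quadric

section Derivations
variable {k K : Type u} [Field k] [Field K] [Algebra k K] {σ : Type}
  {ξ : σ → K} {I : Ideal (MvPolynomial σ k)} [I.IsPrime] {R : Subalgebra k K}

/-- A derivation of a ring of fractions may be prescribed on the generators, provided that the
resulting homomorphism to the dual numbers respects the relations. -/
theorem IsFractionsAt.exists_derivation (hR : IsFractionsAt ξ I R)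
    (hI : ∀ p : MvPolynomial σ k, aeval ξ p = 0 → p ∈ I)
    {T : Type*} [CommRing T] [Algebra k T] [Algebra R T] [IsScalarTower k R T]
    (y : σ → R) (hy : ∀ l, (y l : K) = ξ l) (c : σ → T)
    (h0 : ∀ p : MvPolynomial σ k, aeval ξ p = 0 → aeval (fun l =>
      (TrivSqZeroExt.inl (algebraMap R T (y l)) + TrivSqZeroExt.inr (c l) : DualNumber T)) p = 0) :
    ∃ d : Derivation k R T, ∀ l, d (y l) = c l := by
  let φ : MvPolynomial σ k →ₐ[k] DualNumber T :=
    aeval fun l => TrivSqZeroExt.inl (algebraMap R T (y l)) + TrivSqZeroExt.inr (c l)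
  have hyp : ∀ p : MvPolynomial σ k, ((aeval y p : R) : K) = aeval ξ p := by
    intro p
    have h := comp_aeval_apply y R.val p
    rw [show (fun l => R.val (y l)) = ξ from funext hy] at h
    exact h
  have hfst : ∀ p, (φ p).fst = algebraMap R T (aeval y p) := by
    intro p
    have h1 := comp_aeval_apply (fun l => (TrivSqZeroExt.inl (algebraMap R T (y l)) +
      TrivSqZeroExt.inr (c l) : DualNumber T)) (TrivSqZeroExt.fstHom k T T) p
    have h2 := comp_aeval_apply y (IsScalarTower.toAlgHom k R T) p
    refine h1.trans (Eq.trans ?_ h2.symm)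
    congr 2
    ext l
    simp
  have hunit : ∀ q ∉ I, IsUnit (aeval y q : R) := by
    intro q hq
    have h1 : aeval ξ q ≠ 0 := fun h => hq (hI q h)
    have h2 : (aeval ξ q)⁻¹ ∈ R := (hR _).mpr ⟨1, q, hq, by simp⟩
    refine IsUnit.of_mul_eq_one ⟨_, h2⟩ (Subtype.ext ?_)
    change ((aeval y q : R) : K) * _ = 1
    rw [hyp, mul_inv_cancel₀ h1]
  obtain ⟨ψ, hψ⟩ := hR.exists_lift hI φ.toRingHom
    (fun q hq => TrivSqZeroExt.isUnit_iff_isUnit_fst.mpr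
      ((hfst q).symm ▸ (hunit q hq).map (algebraMap R T))) h0
  have hψ' : ∀ p, ψ (aeval y p) = φ p := by
    intro p
    rw [← show φ.toRingHom p = φ p from rfl, ← hψ p]
    exact congrArg ψ (Subtype.ext (hyp p))
  have hres : ∀ a, (ψ a).fst = algebraMap R T a := by
    intro a
    obtain ⟨p, q, hq, hpq⟩ := (hR a).mp a.2
    have h1 : a * aeval y q = aeval y p := by
      apply Subtype.ext
      change (a : K) * ((aeval y q : R) : K) = _
      rw [hyp, hyp, hpq, div_mul_cancel₀ _ fun h => hq (hI q h)]
    have h2 := congrArg (fun z => (ψ z).fst) h1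
    have h3 := congrArg (algebraMap R T) h1
    simp only [map_mul, TrivSqZeroExt.fst_mul, hψ', hfst] at h2
    rw [map_mul, ← h2] at h3
    exact (((hunit q hq).map (algebraMap R T)).mul_left_injective h3).symm
  let L : R →ₗ[k] T :=
    { toFun := fun a => (ψ a).snd
      map_add' := fun a b => by rw [map_add, TrivSqZeroExt.snd_add]
      map_smul' := fun t a => by
        have h1 : t • a = aeval y (C t) * a := by rw [aeval_C, Algebra.smul_def]
        rw [h1, map_mul, hψ', ← algebraMap_eq, AlgHom.commutes, ← Algebra.smul_def,
          TrivSqZeroExt.snd_smul, RingHom.id_apply] }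
  refine ⟨Derivation.mk' L fun a b => ?_, fun l => ?_⟩
  · change (ψ (a * b)).snd = a • (ψ b).snd + b • (ψ a).snd
    rw [map_mul, TrivSqZeroExt.snd_mul, hres, hres, op_smul_eq_smul, algebraMap_smul,
      algebraMap_smul]
  · change (ψ (y l)).snd = c l
    have h := hψ' (X l)
    rw [aeval_X] at h
    rw [h]
    simp [φ]
end Derivations

section Jacobian
variable {k K : Type u} [Field k] [Field K] [Algebra k K] {n : ℕ}
  {ξ : Fin (n + 1) → K} {I : Ideal (MvPolynomial (Fin (n + 1)) k)} [I.IsPrime] {R : Subalgebra k K}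
  [IsLocalRing R] {A B : Matrix (Fin (n + 1)) (Fin (n + 1)) k} {j : Fin (n + 1)}

open IsLocalRing in
/-- A tangent vector of an intersection of quadrics, as a derivation of the local ring. -/
theorem IsFractionsAt.exists_derivation_of_tangent (hR : IsFractionsAt ξ I R)
    (hI : chartIdeal A B j ≤ I) (hker : ∀ p : MvPolynomial (Fin (n + 1)) k,
      aeval ξ p = 0 ↔ p ∈ chartIdeal A B j) (hA : A.IsSymm) (hB : B.IsSymm)
    (y : Fin (n + 1) → R) (hy : ∀ l, (y l : K) = ξ l) (c : Fin (n + 1) → ResidueField R)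
    (hcj : c j = 0)
    (hcA : c ⬝ᵥ A.map (algebraMap k _) *ᵥ (fun l => residue R (y l)) = 0)
    (hcB : c ⬝ᵥ B.map (algebraMap k _) *ᵥ (fun l => residue R (y l)) = 0) :
    ∃ d : Derivation k R (ResidueField R), ∀ l, d (y l) = c l := by
  let v : Fin (n + 1) → ResidueField R := fun l => residue R (y l)
  have hv : ∀ p ∈ chartIdeal A B j, aeval v p = 0 := by
    intro p hp
    have h1 := comp_aeval_apply y R.val p
    rw [show (fun l => R.val (y l)) = ξ from funext hy, (hker p).mpr hp] at h1
    have h2 := comp_aeval_apply y (IsScalarTower.toAlgHom k R (ResidueField R)) p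
    rw [show aeval y p = 0 from Subtype.ext h1, map_zero] at h2
    exact h2.symm
  have hvj : v j = 1 := by
    have h := hv (X j - 1) (Ideal.subset_span (Or.inl rfl))
    rwa [map_sub, aeval_X, map_one, sub_eq_zero] at h
  refine hR.exists_derivation (fun p hp => hI ((hker p).mp hp)) y hy c fun p hp => ?_
  refine aeval_dualNumber_eq_zero v c hA hB hvj hcj ?_ ?_ hcA hcB p ((hker p).mp hp)
  · rw [← aeval_quadraticPoly]
    exact hv _ (Ideal.subset_span (Or.inr (Or.inl rfl)))
  · rw [← aeval_quadraticPoly]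
    exact hv _ (Ideal.subset_span (Or.inr (Or.inr rfl)))

open IsLocalRing in
set_option synthInstance.maxHeartbeats 100000 in
/-- The Jacobian criterion at a point of codimension at most one of a normal intersection of two
quadrics of codimension two: there the two equations have independent differentials. -/
theorem IsFractionsAt.jacobian [CharZero k] (hR : IsFractionsAt ξ I R)
    (hI : chartIdeal A B j ≤ I) (hker : ∀ p : MvPolynomial (Fin (n + 1)) k,
      aeval ξ p = 0 ↔ p ∈ chartIdeal A B j) (hA : A.IsSymm) (hB : B.IsSymm)
    (y : Fin (n + 1) → R) (hy : ∀ l, (y l : K) = ξ l)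
    {m : ℕ} (hm : m + 2 = n) (htr : Algebra.trdeg k R ≤ m)
    (hprin : (maximalIdeal R).IsPrincipal) {a b : ResidueField R}
    (hab : a • A.map (algebraMap k _) *ᵥ (fun l => residue R (y l)) +
      b • B.map (algebraMap k _) *ᵥ (fun l => residue R (y l)) = 0) : a = 0 ∧ b = 0 := by
  by_contra hne
  obtain ⟨hfin, hle⟩ := finrank_derivation_le htr hprin
  let v : Fin (n + 1) → ResidueField R := fun l => residue R (y l)
  -- The tangent vectors form the kernel of `F`, and each of them is the value `E d` of a
  -- derivation.
  -- If the differentials are dependent, `F` has rank at most `2`, so the kernel has dimension more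
  -- than `m`.
  let E : Derivation k R (ResidueField R) →ₗ[ResidueField R] (Fin (n + 1) → ResidueField R) :=
    { toFun := fun d l => d (y l)
      map_add' := fun _ _ => rfl
      map_smul' := fun _ _ => rfl }
  let F : (Fin (n + 1) → ResidueField R) →ₗ[ResidueField R] (Fin 3 → ResidueField R) :=
    { toFun := fun c => ![c j, c ⬝ᵥ A.map (algebraMap k _) *ᵥ v, c ⬝ᵥ B.map (algebraMap k _) *ᵥ v]
      map_add' := fun c d => by simp [add_dotProduct]
      map_smul' := fun t c => by simp [smul_dotProduct] }
  have h1 : LinearMap.ker F ≤ LinearMap.range E := by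
    intro c hc
    have hc' : ![c j, c ⬝ᵥ A.map (algebraMap k _) *ᵥ v, c ⬝ᵥ B.map (algebraMap k _) *ᵥ v] = 0 := hc
    obtain ⟨d, hd⟩ := hR.exists_derivation_of_tangent hI hker hA hB y hy c (congrFun hc' 0)
      (congrFun hc' 1) (congrFun hc' 2)
    exact ⟨d, funext hd⟩
  have h2 : LinearMap.range F ≠ ⊤ := by
    intro htop
    have h3 : ∀ z : Fin 3 → ResidueField R, a * z 1 + b * z 2 = 0 := by
      intro z
      obtain ⟨c, rfl⟩ := LinearMap.range_eq_top.mp htop z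
      have h4 := congrArg (fun w => c ⬝ᵥ w) hab
      rw [dotProduct_add, dotProduct_smul, dotProduct_smul, dotProduct_zero] at h4
      exact h4
    exact hne ⟨by simpa using h3 ![0, 1, 0], by simpa using h3 ![0, 0, 1]⟩
  have h3 := Submodule.finrank_lt h2
  have h4 := F.finrank_range_add_finrank_ker
  have h5 := (Submodule.finrank_mono h1).trans ((LinearMap.finrank_range_le E).trans hle)
  rw [Module.finrank_fintype_fun_eq_card, Fintype.card_fin] at h3 h4
  omega

end Jacobian

end

/-! ### The valuation ring of a coordinate hyperplane -/

section

open MvPolynomial Matrix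

section DivisorRing
variable {k K : Type u} [Field k] [Field K] [Algebra k K] {n : ℕ} {ρ : Fin (n + 1) → K}

/-- The valuation ring of the divisor `ρ₀ = 0`: the localization of `k[ρ₀, …, ρₙ]` at the prime
ideal generated by `ρ₀`. -/
def divisorRing (hρ : AlgebraicIndependent k ρ) : Subalgebra k K where
  carrier := {f | ∃ p q : MvPolynomial (Fin (n + 1)) k, ¬ X 0 ∣ q ∧ f = aeval ρ p / aeval ρ q}
  mul_mem' := by
    rintro _ _ ⟨p, q, hq, rfl⟩ ⟨p', q', hq', rfl⟩
    refine ⟨p * p', q * q', fun h => (X_dvd_mul_iff.mp h).elim hq hq', ?_⟩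
    rw [map_mul, map_mul, div_mul_div_comm]
  add_mem' := by
    rintro _ _ ⟨p, q, hq, rfl⟩ ⟨p', q', hq', rfl⟩
    have h0 : ∀ q : MvPolynomial (Fin (n + 1)) k, ¬ X 0 ∣ q → aeval ρ q ≠ 0 := fun q hq h =>
      hq ((injective_iff_map_eq_zero _).mp hρ q h ▸ dvd_zero _)
    refine ⟨p * q' + q * p', q * q', fun h => (X_dvd_mul_iff.mp h).elim hq hq', ?_⟩
    rw [div_add_div _ _ (h0 q hq) (h0 q' hq')]
    simp only [map_mul, map_add]
  algebraMap_mem' c := ⟨C c, 1, fun h => X_prime.not_isUnit (isUnit_of_dvd_one h), by simp⟩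

instance : (Ideal.span {(X 0 : MvPolynomial (Fin (n + 1)) k)}).IsPrime :=
  (Ideal.span_singleton_prime (X_ne_zero 0)).mpr X_prime

variable (hρ : AlgebraicIndependent k ρ)
include hρ

theorem aeval_ne_zero_of_not_dvd {q : MvPolynomial (Fin (n + 1)) k} (hq : ¬ X 0 ∣ q) :
    aeval ρ q ≠ 0 := fun h => hq ((injective_iff_map_eq_zero _).mp hρ q h ▸ dvd_zero _)

theorem isFractionsAt_divisorRing : IsFractionsAt ρ (Ideal.span {X 0}) (divisorRing hρ) := by
  intro f
  simp only [Ideal.mem_span_singleton]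
  rfl

theorem mem_span_of_aeval_eq_zero (p : MvPolynomial (Fin (n + 1)) k) (hp : aeval ρ p = 0) :
    p ∈ Ideal.span {(X 0 : MvPolynomial (Fin (n + 1)) k)} := by
  rw [(injective_iff_map_eq_zero _).mp hρ p hp]
  exact zero_mem _

theorem aeval_mem_divisorRing (p : MvPolynomial (Fin (n + 1)) k) : aeval ρ p ∈ divisorRing hρ :=
  (isFractionsAt_divisorRing hρ).aeval_mem p

theorem inv_aeval_mem_divisorRing {q : MvPolynomial (Fin (n + 1)) k} (hq : ¬ X 0 ∣ q) :
    (aeval ρ q)⁻¹ ∈ divisorRing hρ :=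
  ⟨1, q, hq, by simp⟩

instance isLocalRing_divisorRing : IsLocalRing (divisorRing hρ) := by
  obtain ⟨a, ha, -⟩ :=
    (isFractionsAt_divisorRing hρ).exists_surjective (mem_span_of_aeval_eq_zero hρ)
  exact IsLocalRing.of_surjective' a ha

theorem aeval_mem_maximalIdeal_iff (p : MvPolynomial (Fin (n + 1)) k) :
    (⟨aeval ρ p, aeval_mem_divisorRing hρ p⟩ : divisorRing hρ) ∈
      IsLocalRing.maximalIdeal (divisorRing hρ) ↔ X 0 ∣ p := by
  rw [IsLocalRing.mem_maximalIdeal, mem_nonunits_iff]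
  constructor
  · intro h
    by_contra hp
    exact h (IsUnit.of_mul_eq_one ⟨_, inv_aeval_mem_divisorRing hρ hp⟩
      (Subtype.ext (mul_inv_cancel₀ (aeval_ne_zero_of_not_dvd hρ hp))))
  · rintro ⟨q, rfl⟩ hu
    obtain ⟨⟨_, a, b, hb, rfl⟩, hv⟩ := hu.exists_right_inv
    have h1 : aeval ρ (X 0 * q) * (aeval ρ a / aeval ρ b) = 1 := congrArg Subtype.val hv
    rw [← mul_div_assoc, div_eq_one_iff_eq (aeval_ne_zero_of_not_dvd hρ hb), ← map_mul] at h1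
    exact hb (hρ h1 ▸ (dvd_mul_right _ _).mul_right _)

theorem maximalIdeal_divisorRing : IsLocalRing.maximalIdeal (divisorRing hρ) =
    Ideal.span {⟨aeval ρ (X 0), aeval_mem_divisorRing hρ (X 0)⟩} := by
  refine le_antisymm ?_ ?_
  · rintro ⟨_, p, q, hq, rfl⟩ hf
    have h1 : (⟨aeval ρ p, aeval_mem_divisorRing hρ p⟩ : divisorRing hρ) ∈
        IsLocalRing.maximalIdeal (divisorRing hρ) := by
      convert! Ideal.mul_mem_right (⟨aeval ρ q, aeval_mem_divisorRing hρ q⟩ : divisorRing hρ) _ hf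
      exact (div_mul_cancel₀ _ (aeval_ne_zero_of_not_dvd hρ hq)).symm
    obtain ⟨p', rfl⟩ := (aeval_mem_maximalIdeal_iff hρ p).mp h1
    refine Ideal.mem_span_singleton'.mpr ⟨⟨_, p', q, hq, rfl⟩, Subtype.ext ?_⟩
    change aeval ρ p' / aeval ρ q * aeval ρ (X 0) = aeval ρ (X 0 * p') / aeval ρ q
    rw [map_mul]
    ring
  · rw [Ideal.span_singleton_le_iff_mem, aeval_mem_maximalIdeal_iff]

theorem isDiscreteValuationRing_divisorRing : IsDiscreteValuationRing (divisorRing hρ) := by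
  have : IsNoetherianRing (divisorRing hρ) :=
    (isFractionsAt_divisorRing hρ).isNoetherianRing (mem_span_of_aeval_eq_zero hρ)
  have hf : ¬ IsField (divisorRing hρ) := by
    rw [IsLocalRing.isField_iff_maximalIdeal_eq, maximalIdeal_divisorRing,
      Ideal.span_singleton_eq_bot]
    intro h
    exact X_ne_zero (R := k) (0 : Fin (n + 1))
      (hρ ((congrArg Subtype.val h).trans (map_zero _).symm))
  have h := (IsDiscreteValuationRing.TFAE (divisorRing hρ) hf).out 4 0
  exact h.mp ⟨_, maximalIdeal_divisorRing hρ⟩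

open IsLocalRing in
/-- The remaining coordinates `ρ₁, …, ρₙ` restrict to independent functions on the divisor. -/
theorem algebraicIndependent_residue_divisorRing :
    AlgebraicIndependent k fun a : Fin n =>
      residue (divisorRing hρ) ⟨aeval ρ (X a.succ), aeval_mem_divisorRing hρ _⟩ := by
  refine (injective_iff_map_eq_zero _).mpr fun p hp => ?_
  have h1 := comp_aeval_apply
    (fun a : Fin n => (⟨aeval ρ (X a.succ), aeval_mem_divisorRing hρ _⟩ : divisorRing hρ))
    (IsScalarTower.toAlgHom k (divisorRing hρ) (ResidueField (divisorRing hρ))) p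
  have h2 : aeval (fun a : Fin n =>
      (⟨aeval ρ (X a.succ), aeval_mem_divisorRing hρ _⟩ : divisorRing hρ)) p =
      ⟨aeval ρ (rename Fin.succ p), aeval_mem_divisorRing hρ _⟩ := by
    apply Subtype.ext
    have h3 := comp_aeval_apply
      (fun a : Fin n => (⟨aeval ρ (X a.succ), aeval_mem_divisorRing hρ _⟩ : divisorRing hρ))
      (divisorRing hρ).val p
    refine h3.trans ?_
    change _ = aeval ρ (rename Fin.succ p)
    rw [aeval_rename]
    congr 2
    ext a
    exact aeval_X _ _
  have h3 := h1.trans hp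
  rw [h2] at h3
  obtain ⟨q, hq⟩ := (aeval_mem_maximalIdeal_iff hρ _).mp ((residue_eq_zero_iff _).mp h3)
  have h4 := congrArg (aeval (Fin.cons 0 X : Fin (n + 1) → MvPolynomial (Fin n) k)) hq
  rw [map_mul, aeval_X, Fin.cons_zero, zero_mul, aeval_rename,
    show ((Fin.cons 0 X : Fin (n + 1) → MvPolynomial (Fin n) k) ∘ Fin.succ) = X from
      funext fun a => Fin.cons_succ _ _ a, aeval_X_left_apply] at h4
  exact h4

variable (hfrac : ∀ f : K, ∃ p q : MvPolynomial (Fin (n + 1)) k,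
  aeval ρ q ≠ 0 ∧ f = aeval ρ p / aeval ρ q)
include hfrac

theorem trdeg_eq_of_fractions : Algebra.trdeg k K = (n + 1 : ℕ) := by
  have h : Algebra.IsAlgebraic (Algebra.adjoin k (Set.range ρ)) K := by
    refine ⟨fun f => ?_⟩
    obtain ⟨p, q, hq, rfl⟩ := hfrac f
    have hp : ∀ p, aeval ρ p ∈ Algebra.adjoin k (Set.range ρ) := fun p => by
      rw [Algebra.adjoin_range_eq_range_aeval]
      exact ⟨p, rfl⟩
    rw [div_eq_mul_inv]
    exact (isAlgebraic_algebraMap (⟨_, hp p⟩ : Algebra.adjoin k (Set.range ρ))).mul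
      (isAlgebraic_algebraMap (⟨_, hp q⟩ : Algebra.adjoin k (Set.range ρ))).inv
  have hb : IsTranscendenceBasis k ρ :=
    isTranscendenceBasis_iff_algebraicIndependent_isAlgebraic.mpr ⟨hρ, h⟩
  have := hb.lift_cardinalMk_eq_trdeg
  simpa using this.symm

open IsLocalRing in
theorem trdeg_residueField_divisorRing :
    Algebra.trdeg k (ResidueField (divisorRing hρ)) = (n : ℕ) := by
  refine le_antisymm ?_ ?_
  · have h1 : Algebra.trdeg k (ResidueField (divisorRing hρ)) + 1 ≤
        Algebra.trdeg k (divisorRing hρ) :=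
      trdeg_residueField_add_one_le ((aeval_mem_maximalIdeal_iff hρ (X 0)).mpr dvd_rfl) fun h =>
        X_ne_zero (R := k) (0 : Fin (n + 1))
          (hρ ((congrArg Subtype.val h).trans (map_zero _).symm))
    have h2 := h1.trans (trdeg_le_of_injective (divisorRing hρ).val Subtype.val_injective)
    rw [trdeg_eq_of_fractions hρ hfrac, Nat.cast_add, Nat.cast_one] at h2
    exact (Cardinal.add_one_le_add_one_iff).mp h2
  · have h := (algebraicIndependent_residue_divisorRing hρ).lift_cardinalMk_le_trdeg
    simpa using h

theorem isDivisorial_divisorRing : IsDivisorial (divisorRing hρ) := by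
  refine ⟨IsFractionRing.of_field _ _ fun f => ?_, isDiscreteValuationRing_divisorRing hρ, ?_⟩
  · obtain ⟨p, q, -, rfl⟩ := hfrac f
    exact ⟨⟨_, aeval_mem_divisorRing hρ p⟩, ⟨_, aeval_mem_divisorRing hρ q⟩, rfl⟩
  · rw [trdeg_eq_of_fractions hρ hfrac, Nat.cast_add, Nat.cast_one]
    congr 1
    exact trdeg_residueField_divisorRing hρ hfrac

end DivisorRing

section Forms
variable {k K : Type u} [Field k] [Field K] [Algebra k K] {n : ℕ} {ρ : Fin n → K}

/-- Derivations of a field generated by elements `ρₗ` agree if they agree on the `ρₗ`. -/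
theorem derivation_eq_of_fractions {M : Type*} [AddCommGroup M] [Module k M] [Module K M]
    (hfrac : ∀ f : K, ∃ p q : MvPolynomial (Fin n) k,
      aeval ρ q ≠ 0 ∧ f = aeval ρ p / aeval ρ q)
    {d e : Derivation k K M} (h : ∀ l, d (ρ l) = e (ρ l)) : d = e := by
  have h1 : ∀ p : MvPolynomial (Fin n) k, d (aeval ρ p) = e (aeval ρ p) := by
    intro p
    induction p using MvPolynomial.induction_on with
    | C c => rw [aeval_C, d.map_algebraMap, e.map_algebraMap]
    | add p q hp hq => rw [map_add, map_add, map_add, hp, hq]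
    | mul_X p l hp => rw [map_mul, aeval_X, d.leibniz, e.leibniz, hp, h]
  ext f
  obtain ⟨p, q, -, rfl⟩ := hfrac f
  rw [d.leibniz_div, e.leibniz_div, h1, h1]

/-- The derivations of a rational function field may be prescribed on the coordinates. -/
theorem exists_partialDerivative (hρ : AlgebraicIndependent k ρ)
    (hfrac : ∀ f : K, ∃ p q : MvPolynomial (Fin n) k,
      aeval ρ q ≠ 0 ∧ f = aeval ρ p / aeval ρ q) (c : Fin n → K) :
    ∃ d : Derivation k K K, ∀ l, d (ρ l) = c l := by
  have hR : IsFractionsAt ρ (⊥ : Ideal (MvPolynomial (Fin n) k)) ⊤ := by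
    intro f
    obtain ⟨p, q, hq, hf⟩ := hfrac f
    exact ⟨fun _ => ⟨p, q, fun h => hq (by rw [(Submodule.mem_bot _).mp h, map_zero]), hf⟩,
      fun _ => Algebra.mem_top⟩
  have h0 : ∀ p : MvPolynomial (Fin n) k, aeval ρ p = 0 → p = 0 :=
    (injective_iff_map_eq_zero _).mp hρ
  obtain ⟨d, hd⟩ := hR.exists_derivation (fun p hp => (Submodule.mem_bot _).mpr (h0 p hp))
    (T := K) (fun l => ⟨ρ l, Algebra.mem_top⟩) (fun _ => rfl) c
    fun p hp => by rw [h0 p hp, map_zero]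
  refine ⟨Derivation.mk' (d.toLinearMap ∘ₗ (Subalgebra.topEquiv (R := k) (A := K)).symm.toLinearMap)
    fun a b => ?_, hd⟩
  exact d.leibniz ((Subalgebra.topEquiv (R := k) (A := K)).symm a)
    ((Subalgebra.topEquiv (R := k) (A := K)).symm b)

/-- The form `da₁ ∧ ⋯ ∧ daₙ` in terms of the coordinates `ρ`, by the Jacobian determinant. -/
theorem ιMulti_D_eq_det_smul {d : Fin n → Derivation k K K}
    (hd : ∀ l m, d l (ρ m) = if l = m then 1 else 0)
    (hfrac : ∀ f : K, ∃ p q : MvPolynomial (Fin n) k,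
      aeval ρ q ≠ 0 ∧ f = aeval ρ p / aeval ρ q) (a : Fin n → K) :
    exteriorPower.ιMulti K n (fun m => KaehlerDifferential.D k K (a m)) =
      (Matrix.of fun m l => d l (a m)).det •
        exteriorPower.ιMulti K n (fun m => KaehlerDifferential.D k K (ρ m)) := by
  let L : (Fin n → K) →ₗ[K] Ω[K⁄k] :=
    Fintype.linearCombination K fun m => KaehlerDifferential.D k K (ρ m)
  have hL : ∀ f, KaehlerDifferential.D k K f = L fun l => d l f := by
    let e : Derivation k K (Ω[K⁄k]) :=
      ∑ l, (LinearMap.toSpanSingleton K _ (KaehlerDifferential.D k K (ρ l))).compDer (d l)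
    have he : ∀ f, e f = L fun l => d l f := by
      intro f
      rw [Fintype.linearCombination_apply, ← Derivation.coeFnAddMonoidHom_apply, map_sum,
        Finset.sum_apply]
      rfl
    intro f
    rw [← he]
    refine DFunLike.congr_fun (derivation_eq_of_fractions hfrac fun m => ?_) f
    rw [he, Fintype.linearCombination_apply, Finset.sum_eq_single m]
    · rw [hd, if_pos rfl, one_smul]
    · intro l _ hl
      rw [hd, if_neg hl, zero_smul]
    · exact fun h => absurd (Finset.mem_univ m) h
  let τ := exteriorPower.ιMulti K n (fun m => KaehlerDifferential.D k K (ρ m))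
  have h : (exteriorPower.ιMulti K n).compLinearMap L =
      (LinearMap.toSpanSingleton K _ τ).compAlternatingMap Matrix.detRowAlternating := by
    refine Module.Basis.ext_alternating (Pi.basisFun K (Fin n)) fun v hv => ?_
    obtain ⟨σ, rfl⟩ : ∃ σ : Equiv.Perm (Fin n), v = σ :=
      ⟨Equiv.ofBijective v (Finite.injective_iff_bijective.mp hv), rfl⟩
    have h1 : ∀ f : (Fin n → K) [⋀^Fin n]→ₗ[K] ⋀[K]^n (Ω[K⁄k]),
        (f fun i => Pi.basisFun K (Fin n) (σ i)) = Equiv.Perm.sign σ • f (Pi.basisFun K (Fin n)) :=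
      fun f => f.map_perm _ σ
    rw [h1, h1]
    congr 1
    change exteriorPower.ιMulti K n (fun m => L (Pi.basisFun K (Fin n) m)) =
      (Matrix.of (Pi.basisFun K (Fin n))).det • τ
    rw [show (Matrix.of (Pi.basisFun K (Fin n)) : Matrix (Fin n) (Fin n) K) = 1 from by
      ext i j; simp [Matrix.one_apply, Pi.single_apply, eq_comm], Matrix.det_one, one_smul]
    congr 1
    ext m
    simp [L, Fintype.linearCombination_apply_single]
  have h1 := DFunLike.congr_fun h fun m l => d l (a m)
  refine Eq.trans ?_ h1
  exact congrArg (exteriorPower.ιMulti K n) (funext fun m => hL (a m))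

/-- If the partial derivatives with respect to the coordinates `ρ` preserve `V`, then the coordinate
form `dρ₁ ∧ ⋯ ∧ dρₙ` does not vanish along `V`, nor do its multiples by inverses of elements
of `V`: evaluation on the partial derivatives is integral on the regular forms. -/
theorem not_vanishesAlong {V : Subalgebra k K} (hV : IsDivisorial V)
    {d : Fin n → Derivation k K K} (hd : ∀ l m, d l (ρ m) = if l = m then 1 else 0)
    (hdV : ∀ l, ∀ f ∈ V, d l f ∈ V) {h : K} (hh : h⁻¹ ∈ V) (h0 : h ≠ 0) :
    ¬ VanishesAlong n V hV
      (h • exteriorPower.ιMulti K n (fun m => KaehlerDifferential.D k K (ρ m))) := by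
  have hloc : IsDiscreteValuationRing V := hV.2.choose
  let g : Ω[K⁄k] [⋀^Fin n]→ₗ[K] K := Matrix.detRowAlternating.compLinearMap
    (LinearMap.pi fun l => (d l).liftKaehlerDifferential)
  -- The linear functional which evaluates an `n`-form on the partial derivatives `d`.
  let Φ := exteriorPower.alternatingMapLinearEquiv g
  have hΦ : ∀ a : Fin n → K, Φ (exteriorPower.ιMulti K n fun m => KaehlerDifferential.D k K (a m)) =
      (Matrix.of fun m l => d l (a m)).det := by
    intro a
    rw [exteriorPower.alternatingMapLinearEquiv_apply_ιMulti]
    change (Matrix.of fun m l =>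
      (d l).liftKaehlerDifferential (KaehlerDifferential.D k K (a m))).det = _
    simp only [Derivation.liftKaehlerDifferential_comp_D]
  have h1 : ∀ η ∈ regularForms n V, Φ η ∈ V := by
    intro η hη
    induction hη using Submodule.span_induction with
    | mem η hη =>
      obtain ⟨a, rfl⟩ := hη
      rw [hΦ, Matrix.det_apply]
      exact sum_mem fun σ _ => V.toSubring.zsmul_mem (prod_mem fun m _ => hdV _ _ (a _).2) _
    | zero => rw [map_zero]; exact zero_mem V
    | add η η' _ _ hη hη' => rw [map_add]; exact add_mem hη hη'
    | smul c η _ hη =>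
      rw [show c • η = (c : K) • η from rfl, map_smul]
      exact mul_mem c.2 hη
  intro hvan
  have h2 : ∀ η ∈ IsLocalRing.maximalIdeal V • regularForms n V,
      ∃ a ∈ IsLocalRing.maximalIdeal V, (a : K) = Φ η := by
    intro η hη
    induction hη using Submodule.smul_induction_on' with
    | smul c hc η hη =>
      refine ⟨c * ⟨Φ η, h1 η hη⟩, Ideal.mul_mem_right _ _ hc, ?_⟩
      rw [show c • η = (c : K) • η from rfl, map_smul]
      rfl
    | add η _ η' _ hη hη' =>
      obtain ⟨a, ha, haη⟩ := hη
      obtain ⟨b, hb, hbη⟩ := hη'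
      refine ⟨a + b, add_mem ha hb, ?_⟩
      rw [map_add, ← haη, ← hbη]
      rfl
  obtain ⟨a, ha, haΦ⟩ := h2 _ hvan
  have h3 : (Matrix.of fun m l => d l (ρ m)) = (1 : Matrix (Fin n) (Fin n) K) := by
    ext m l
    rw [Matrix.of_apply, hd, Matrix.one_apply]
    exact if_congr eq_comm rfl rfl
  rw [map_smul, hΦ, h3, Matrix.det_one, smul_eq_mul, mul_one] at haΦ
  refine (IsLocalRing.mem_maximalIdeal a).mp ha (IsUnit.of_mul_eq_one ⟨h⁻¹, hh⟩ (Subtype.ext ?_))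
  change (a : K) * h⁻¹ = 1
  rw [haΦ, mul_inv_cancel₀ h0]

/-- A derivation preserves the divisorial ring as soon as its values on the coordinates lie
there. -/
theorem derivation_mem_divisorRing {ρ : Fin (n + 1) → K} (hρ : AlgebraicIndependent k ρ)
    (d : Derivation k K K) (hd : ∀ l, d (ρ l) ∈ divisorRing hρ) {f : K}
    (hf : f ∈ divisorRing hρ) : d f ∈ divisorRing hρ := by
  have h1 : ∀ p : MvPolynomial (Fin (n + 1)) k, d (aeval ρ p) ∈ divisorRing hρ := by
    intro p
    induction p using MvPolynomial.induction_on with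
    | C c => rw [aeval_C, d.map_algebraMap]; exact zero_mem _
    | add p q hp hq => rw [map_add, map_add]; exact add_mem hp hq
    | mul_X p l hp =>
      rw [map_mul, d.leibniz]
      refine add_mem (mul_mem (aeval_mem_divisorRing hρ p) ?_)
        (mul_mem (aeval_mem_divisorRing hρ (X l)) hp)
      rw [aeval_X]
      exact hd l
  obtain ⟨p, q, hq, rfl⟩ := hf
  rw [d.leibniz_div]
  exact mul_mem (pow_mem (inv_aeval_mem_divisorRing hρ hq) 2)
    (sub_mem (mul_mem (aeval_mem_divisorRing hρ q) (h1 p))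
      (mul_mem (aeval_mem_divisorRing hρ p) (h1 q)))
end Forms

end

/-! ### The centre of a valuation -/

section

open MvPolynomial Matrix

section Centre
variable {k K : Type u} [Field k] [Field K] [Algebra k K] {σ : Type} {V R : Subalgebra k K}
  {ξ : σ → K}

/-- The local ring at the prime ideal of the polynomials which are non-units in `V` is dominated
by `V`. -/
theorem IsFractionsAt.dominates [IsLocalRing V] {y : σ → V} (hy : ∀ l, (y l : K) = ξ l)
    (hR : IsFractionsAt ξ ((IsLocalRing.maximalIdeal V).comap (aeval (R := k) y)) R) :
    Dominates V R := by
  have hyp : ∀ p : MvPolynomial σ k, ((aeval y p : V) : K) = aeval ξ p := by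
    intro p
    have h := comp_aeval_apply y V.val p
    rw [show (fun l => V.val (y l)) = ξ from funext hy] at h
    exact h
  have hinv : ∀ q ∉ (IsLocalRing.maximalIdeal V).comap (aeval (R := k) y),
      (aeval ξ q)⁻¹ ∈ V ∧ aeval ξ q ≠ 0 := by
    intro q hq
    have hu : IsUnit (aeval y q) := by
      by_contra h
      exact hq h
    obtain ⟨v, hv⟩ := hu.exists_right_inv
    have h1 : aeval ξ q * v = 1 := by
      rw [← hyp]
      exact congrArg Subtype.val hv
    rw [inv_eq_of_mul_eq_one_right h1]
    exact ⟨v.2, left_ne_zero_of_mul_eq_one h1⟩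
  refine ⟨fun a ha => ?_, fun a ha ha' => ?_⟩
  · obtain ⟨p, q, hq, rfl⟩ := (hR a).mp ha
    rw [div_eq_mul_inv, ← hyp]
    exact mul_mem (aeval y p).2 (hinv q hq).1
  · obtain ⟨p, q, hq, rfl⟩ := (hR a).mp ha
    by_cases h0 : aeval ξ p = 0
    · rw [h0, zero_div, _root_.inv_zero]
      exact zero_mem R
    · refine (hR _).mpr ⟨q, p, ?_, inv_div _ _⟩
      have h2 : (aeval ξ p)⁻¹ ∈ V := by
        have h3 := mul_mem ha' (hinv q hq).1
        rwa [inv_div, div_mul_eq_mul_div, mul_inv_cancel₀ (hinv q hq).2, one_div] at h3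
      intro hp
      refine hp (IsUnit.of_mul_eq_one ⟨_, h2⟩ (Subtype.ext ?_))
      change ((aeval y p : V) : K) * _ = 1
      rw [hyp, mul_inv_cancel₀ h0]

/-- A valuation ring is not properly dominated. -/
theorem Dominates.le_of_valuationRing (h : Dominates V R) (hR : ValuationRing R)
    (hfrac : ∀ f : K, ∃ a ∈ R, ∃ b ∈ R, b ≠ 0 ∧ f = a / b) : V ≤ R := by
  intro f hf
  obtain ⟨a, ha, b, hb, hb0, rfl⟩ := hfrac f
  obtain ⟨c, hc | hc⟩ := ValuationRing.cond (⟨a, ha⟩ : R) ⟨b, hb⟩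
  · have h1 : a * c = b := congrArg Subtype.val hc
    have ha0 : a ≠ 0 := fun h0 => hb0 (by rw [← h1, h0, zero_mul])
    have h2 : (c : K) = (a / b)⁻¹ := by
      rw [inv_div, eq_div_iff ha0, mul_comm, h1]
    have h3 := h.2 c c.2 (by rwa [h2, inv_inv])
    rwa [h2, inv_inv] at h3
  · have h1 : b * c = a := congrArg Subtype.val hc
    rw [← h1, mul_div_cancel_left₀ _ hb0]
    exact c.2

open IsLocalRing IntermediateField in
/-- If `V` is the local ring of a point whose coordinates are generated by a single element of
the residue field, then the point has dimension at most one. -/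
theorem IsFractionsAt.trdeg_residueField_le_one [IsLocalRing V] {y : σ → V}
    (hy : ∀ l, (y l : K) = ξ l)
    (hV : IsFractionsAt ξ ((maximalIdeal V).comap (aeval (R := k) y)) V)
    (c : ResidueField V) (hc : ∀ l, residue V (y l) ∈ k⟮c⟯) :
    Algebra.trdeg k (ResidueField V) ≤ 1 := by
  have hyp : ∀ p : MvPolynomial σ k, ((aeval y p : V) : K) = aeval ξ p := by
    intro p
    have h := comp_aeval_apply y V.val p
    rw [show (fun l => V.val (y l)) = ξ from funext hy] at h
    exact h
  have hp : ∀ p : MvPolynomial σ k, residue V (aeval y p) ∈ k⟮c⟯ := by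
    intro p
    induction p using MvPolynomial.induction_on with
    | C t =>
      rw [aeval_C]
      exact k⟮c⟯.algebraMap_mem t
    | add p q hp hq => rw [map_add, map_add]; exact add_mem hp hq
    | mul_X p l hp => rw [map_mul, map_mul, aeval_X]; exact mul_mem hp (hc l)
  have htop : ∀ z : ResidueField V, z ∈ k⟮c⟯ := by
    intro z
    obtain ⟨f, rfl⟩ := residue_surjective z
    obtain ⟨p, q, hq, hf⟩ := (hV f).mp f.2
    have hq0 : residue V (aeval y q) ≠ 0 := fun h => hq ((residue_eq_zero_iff _).mp h)
    have hq1 : aeval ξ q ≠ 0 := fun h => hq0 (by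
      rw [show aeval y q = 0 from Subtype.ext ((hyp q).trans h), map_zero])
    have h1 : f * aeval y q = aeval y p := by
      apply Subtype.ext
      change (f : K) * ((aeval y q : V) : K) = _
      rw [hyp, hyp, hf, div_mul_cancel₀ _ hq1]
    have h2 : residue V f = residue V (aeval y p) / residue V (aeval y q) := by
      rw [eq_div_iff hq0, ← map_mul, h1]
    rw [h2]
    exact div_mem (hp p) (hp q)
  have halg : Algebra.IsAlgebraic (Algebra.adjoin k {c}) (ResidueField V) := by
    refine ⟨fun z => ?_⟩
    obtain ⟨r, s, rfl⟩ := mem_adjoin_simple_iff k z |>.mp (htop z)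
    have hr : ∀ r : Polynomial k, Polynomial.aeval c r ∈ Algebra.adjoin k {c} :=
      fun r => Polynomial.aeval_mem_adjoin_singleton k c
    rw [div_eq_mul_inv]
    exact (isAlgebraic_algebraMap (⟨_, hr r⟩ : Algebra.adjoin k {c})).mul
      (isAlgebraic_algebraMap (⟨_, hr s⟩ : Algebra.adjoin k {c})).inv
  have h := Algebra.IsAlgebraic.trdeg_le_cardinalMk k ({c} : Set (ResidueField V))
  rwa [Cardinal.mk_singleton] at h
end Centre

end

/-! ### The parametrization of a pencil in normal form -/

section

open MvPolynomial Matrix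

section Parametrization

theorem quadratic_add_smul_single {T : Type*} [CommRing T] {m : ℕ} (B : Matrix (Fin m) (Fin m) T)
    (hB : B.IsSymm) (v : Fin m → T) (z : T) (a : Fin m) :
    (v + z • Pi.single a 1) ⬝ᵥ B *ᵥ (v + z • Pi.single a 1) =
      v ⬝ᵥ B *ᵥ v + 2 * z * (B *ᵥ v) a + z ^ 2 * B a a := by
  have h : v ⬝ᵥ B *ᵥ Pi.single a 1 = (B *ᵥ v) a := by
    rw [dotProduct_mulVec, ← mulVec_transpose, hB.eq, dotProduct_single_one]
  rw [mulVec_add, mulVec_smul, add_dotProduct, dotProduct_add, dotProduct_add, smul_dotProduct,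
    smul_dotProduct, dotProduct_smul, dotProduct_smul, h, single_one_dotProduct,
    single_one_dotProduct, mulVec_single_one]
  simp only [smul_eq_mul, col_apply]
  ring

variable {k : Type u} [Field k]

/-- The matrix of the quadratic form `2 (x₂ x₃ - x₄² - δ x₅²)`. -/
def coneMatrix (δ : k) : Matrix (Fin 6) (Fin 6) k :=
  !![0, 0, 0, 0, 0, 0;
     0, 0, 0, 0, 0, 0;
     0, 0, 0, 1, 0, 0;
     0, 0, 1, 0, 0, 0;
     0, 0, 0, 0, -2, 0;
     0, 0, 0, 0, 0, -2 * δ]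

theorem coneMatrix_mulVec {T : Type*} [CommRing T] [Algebra k T] (δ : k) (v : Fin 6 → T) :
    (coneMatrix δ).map (algebraMap k T) *ᵥ v =
      ![0, 0, v 3, v 2, -2 * v 4, -2 * algebraMap k T δ * v 5] := by
  ext l
  fin_cases l <;> simp [coneMatrix, mulVec, dotProduct, Fin.sum_univ_six, map_ofNat]

theorem coneMatrix_quadratic {T : Type*} [CommRing T] [Algebra k T] (δ : k) (v : Fin 6 → T) :
    v ⬝ᵥ (coneMatrix δ).map (algebraMap k T) *ᵥ v =
      2 * (v 2 * v 3 - v 4 ^ 2 - algebraMap k T δ * v 5 ^ 2) := by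
  rw [coneMatrix_mulVec]
  simp only [dotProduct, Fin.sum_univ_six]
  simp
  ring

/-- The pencil spanned by the cone `x₂ x₃ = x₄² + δ x₅²` and a quadric `B` through the vertex
point `(0 : 1 : 0 : 0 : 0 : 0)` of the cone.  Either (`e = 1`) the quadric contains the line
`x₂ = ⋯ = x₅ = 0` of vertices, or (`e = 0`) the cone has a vertex plane, and the hyperplane tangent
to the quadric at the point is `x₀ = 0`. -/
structure IsNormalPencil (B : Matrix (Fin 6) (Fin 6) k) (δ : k) (e : ℕ) : Prop where
  symm : B.IsSymm
  det_ne_zero : B.det ≠ 0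
  apply_one_one : B 1 1 = 0
  cases : (e = 1 ∧ B 0 0 = 0 ∧ B 1 0 = 0) ∨
    (e = 0 ∧ δ = 0 ∧ B 1 2 = 0 ∧ B 1 3 = 0 ∧ B 1 4 = 0 ∧ B 1 5 = 0)

/-- The point `(1 : 0 : r (s² + δ t²) : r : r s : rᵉ t)` of the cone `x₂ x₃ = x₄² + δ x₅²`, where
`(r, s, t) = (X 0, X 1, X 2)`.  For `e = 1` the divisor `r = 0` is the exceptional divisor of the
blow-up of the vertex line, for `e = 0` that of the blow-up of the vertex plane; in the latter case
`δ = 0`. -/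
def conePoint (δ : k) (e : ℕ) : Fin 6 → MvPolynomial (Fin 3) k :=
  ![1, 0, X 0 * (X 1 ^ 2 + C δ * X 2 ^ 2), X 0, X 0 * X 1, X 0 ^ e * X 2]

/-- The intersection of the cone with the second quadric, parametrized through projection from the
vertex point: the coordinate `x₁` of the point over `conePoint δ e` is `-b / (2 N)`. -/
def paramPoint (δ : k) (e : ℕ) (N b : MvPolynomial (Fin 3) k) : Fin 6 → MvPolynomial (Fin 3) k :=
  (2 * N) • conePoint δ e - b • Pi.single 1 1

/-- `N` and `b` are, up to the factor `X₀ᵉ`, the coefficients of the equation `2 N x₁ + b = 0` which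
the second quadric imposes on the coordinate `x₁` of a point over `conePoint δ e`. -/
structure IsParam (B : Matrix (Fin 6) (Fin 6) k) (δ : k) (e : ℕ) (N b : MvPolynomial (Fin 3) k) :
    Prop where
  symm : B.IsSymm
  apply_one_one : B 1 1 = 0
  cone : e = 1 ∨ (e = 0 ∧ δ = 0 ∧ ∃ c : k, N = C c)
  not_dvd : ¬ X 0 ∣ N
  linear : (B.map (algebraMap k _) *ᵥ conePoint δ e) 1 = X 0 ^ e * N
  constant : conePoint δ e ⬝ᵥ B.map (algebraMap k _) *ᵥ conePoint δ e = X 0 ^ e * b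

theorem IsNormalPencil.exists_isParam [CharZero k] {B : Matrix (Fin 6) (Fin 6) k} {δ : k} {e : ℕ}
    (h : IsNormalPencil B δ e) : ∃ N b, IsParam B δ e N b := by
  have hrow : ∀ l, B l 1 = B 1 l := fun l => h.symm.apply 1 l
  have hne : ¬ ∀ l, B 1 l = 0 := fun h0 => h.det_ne_zero (det_eq_zero_of_row_eq_zero 1 h0)
  rcases h.cases with ⟨rfl, h00, h10⟩ | ⟨rfl, rfl, h2, h3, h4, h5⟩
  · let G : Fin 4 → MvPolynomial (Fin 3) k := ![X 1 ^ 2 + C δ * X 2 ^ 2, 1, X 1, X 2]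
    let N : MvPolynomial (Fin 3) k :=
      C (B 1 2) * (X 1 ^ 2 + C δ * X 2 ^ 2) + C (B 1 3) + C (B 1 4) * X 1 + C (B 1 5) * X 2
    refine ⟨N, ∑ a : Fin 4, C (B 0 (Fin.natAdd 2 a)) * G a +
      ∑ a : Fin 4, C (B (Fin.natAdd 2 a) 0) * G a +
      X 0 * ∑ a : Fin 4, ∑ b : Fin 4, C (B (Fin.natAdd 2 a) (Fin.natAdd 2 b)) * (G a * G b),
      h.symm, h.apply_one_one, Or.inl rfl, ?_, ?_, ?_⟩
    -- If `N` vanished for `r = 0`, then the row `B 1` would be zero, and `B` would be singular.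
    · rintro ⟨q, hq⟩
      have hev : ∀ s t : k, B 1 2 * (s ^ 2 + δ * t ^ 2) + B 1 3 + B 1 4 * s + B 1 5 * t = 0 := by
        intro s t
        have h1 := congrArg (aeval ![0, s, t]) hq
        simpa [N] using h1
      have h3 : B 1 3 = 0 := by simpa using hev 0 0
      have h4 : B 1 2 + B 1 4 = 0 := by simpa [h3] using hev 1 0
      have h4' : B 1 2 - B 1 4 = 0 := by simpa [h3, sub_eq_add_neg] using hev (-1) 0
      have h2 : B 1 2 = 0 := by
        have : (2 : k) * B 1 2 = 0 := by linear_combination h4 + h4'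
        simpa using this
      rw [h2, zero_add] at h4
      have h5 : B 1 5 = 0 := by simpa [h3, h2, h4] using hev 0 1
      refine hne fun l => ?_
      fin_cases l
      exacts [h10, h.apply_one_one, h2, h3, h4, h5]
    · simp [mulVec, dotProduct, Fin.sum_univ_six, conePoint, h10, h.apply_one_one, N, algebraMap_eq]
      ring
    · simp [mulVec, dotProduct, Fin.sum_univ_six, Fin.sum_univ_four, conePoint, h00, hrow, h10,
        algebraMap_eq, G]
      ring
  · refine ⟨C (B 1 0), _, h.symm, h.apply_one_one, Or.inr ⟨rfl, rfl, _, rfl⟩, ?_, ?_,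
      ((one_mul _).symm.trans (congrArg (· * _) (pow_zero _).symm))⟩
    · rintro ⟨q, hq⟩
      have h0 : B 1 0 = 0 := by
        have h1 := congrArg (aeval (0 : Fin 3 → k)) hq
        simpa using h1
      refine hne fun l => ?_
      fin_cases l
      exacts [h0, h.apply_one_one, h2, h3, h4, h5]
    · simp [mulVec, dotProduct, Fin.sum_univ_six, conePoint, h2, h3, h4, h5, h.apply_one_one,
        algebraMap_eq]

section IsParam
variable {B : Matrix (Fin 6) (Fin 6) k} {δ : k} {e : ℕ} {N b : MvPolynomial (Fin 3) k}
  (h : IsParam B δ e N b)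
include h

theorem IsParam.conePoint_eq : conePoint δ e 2 * conePoint δ e 3 =
    conePoint δ e 4 ^ 2 + C δ * conePoint δ e 5 ^ 2 := by
  rcases h.cone with rfl | ⟨rfl, rfl, -⟩ <;> simp [conePoint] <;> ring

omit h in
/-- The parametrized point in the affine chart `u₀ = 1`, for values of the parameters in a field. -/
def affinePoint {L : Type*} [Field L] [Algebra k L] (θ : MvPolynomial (Fin 3) k →ₐ[k] L)
    (δ : k) (e : ℕ) (N b : MvPolynomial (Fin 3) k) : Fin 6 → L :=
  fun l => θ (paramPoint δ e N b l) / (2 * θ N)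

section Values
variable {L : Type*} [Field L] [CharZero L] [Algebra k L] {θ : MvPolynomial (Fin 3) k →ₐ[k] L}
  (hN : θ N ≠ 0)
include hN

omit h in
theorem affinePoint_eq : affinePoint θ δ e N b =
    (fun l => θ (conePoint δ e l)) + (-(θ b) / (2 * θ N)) • Pi.single 1 1 := by
  have h2 : 2 * θ N ≠ 0 := mul_ne_zero two_ne_zero hN
  ext l
  rw [affinePoint, div_eq_iff h2]
  by_cases hl : l = 1
  · subst hl
    simp [paramPoint, map_ofNat]
    field_simp
    ring
  · simp [paramPoint, hl, map_ofNat]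
    ring

omit h in
theorem affinePoint_apply {l : Fin 6} (hl : l ≠ 1) :
    affinePoint θ δ e N b l = θ (conePoint δ e l) := by
  rw [affinePoint_eq hN]
  simp [hl]

omit hN [CharZero L] in
theorem IsParam.linear_map : (B.map (algebraMap k L) *ᵥ fun l => θ (conePoint δ e l)) 1 =
    θ (X 0) ^ e * θ N := by
  have h1 := congrArg θ h.linear
  rw [map_mul, map_pow] at h1
  rw [← h1]
  simp [mulVec, dotProduct]

omit hN [CharZero L] in
theorem IsParam.constant_map : (fun l => θ (conePoint δ e l)) ⬝ᵥ B.map (algebraMap k L) *ᵥ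
    (fun l => θ (conePoint δ e l)) = θ (X 0) ^ e * θ b := by
  have h1 := congrArg θ h.constant
  rw [map_mul, map_pow] at h1
  rw [← h1]
  simp [mulVec, dotProduct]

omit hN [CharZero L] in
theorem IsParam.quadratic_add (z : L) :
    ((fun l => θ (conePoint δ e l)) + z • Pi.single 1 1) ⬝ᵥ B.map (algebraMap k L) *ᵥ
      ((fun l => θ (conePoint δ e l)) + z • Pi.single 1 1) = θ (X 0) ^ e * (θ b + 2 * z * θ N) := by
  rw [quadratic_add_smul_single _ (h.symm.map _), h.constant_map,
    h.linear_map, map_apply, h.apply_one_one, map_zero]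
  ring

theorem IsParam.quadratic_affinePoint :
    affinePoint θ δ e N b ⬝ᵥ B.map (algebraMap k L) *ᵥ affinePoint θ δ e N b = 0 := by
  rw [affinePoint_eq hN, h.quadratic_add]
  field_simp
  ring

theorem IsParam.cone_affinePoint :
    affinePoint θ δ e N b ⬝ᵥ (coneMatrix δ).map (algebraMap k L) *ᵥ affinePoint θ δ e N b = 0 := by
  have h1 := congrArg θ h.conePoint_eq
  rw [map_mul, map_add, map_mul, map_pow, map_pow] at h1
  rw [coneMatrix_quadratic, affinePoint_apply hN (by decide), affinePoint_apply hN (by decide),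
    affinePoint_apply hN (by decide), affinePoint_apply hN (by decide), h1,
    show θ (C δ) = algebraMap k L δ from θ.commutes δ]
  ring

theorem IsParam.mulVec_affinePoint :
    (B.map (algebraMap k L) *ᵥ affinePoint θ δ e N b) 1 = θ (X 0) ^ e * θ N := by
  rw [affinePoint_eq hN, mulVec_add, mulVec_smul, Pi.add_apply, h.linear_map, mulVec_single_one]
  simp [h.apply_one_one]

/-- A point on both quadrics is determined by its parameters. -/
theorem IsParam.eq_smul_affinePoint {w : Fin 6 → L} (h0 : w 0 ≠ 0) (h3 : w 3 ≠ 0)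
    (hA : w ⬝ᵥ (coneMatrix δ).map (algebraMap k L) *ᵥ w = 0)
    (hB : w ⬝ᵥ B.map (algebraMap k L) *ᵥ w = 0) (hr : θ (X 0) = w 3 / w 0)
    (hs : θ (X 1) = w 4 / w 3) (ht : θ (X 2) = w 5 / (w 0 * (w 3 / w 0) ^ e)) :
    w = w 0 • affinePoint θ δ e N b := by
  let z := (w 0)⁻¹ • w
  have hz : ∀ l, z l = w l / w 0 := fun l => by simp [z, div_eq_inv_mul]
  have hzw : w = w 0 • z := by simp [z, smul_smul, h0]
  have hr0 : θ (X 0) ≠ 0 := by rw [hr]; exact div_ne_zero h3 h0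
  have hquad : ∀ M : Matrix (Fin 6) (Fin 6) L, w ⬝ᵥ M *ᵥ w = 0 → z ⬝ᵥ M *ᵥ z = 0 := by
    intro M hM
    rw [mulVec_smul, smul_dotProduct, dotProduct_smul, hM, smul_zero, smul_zero]
  have hz0 : z 0 = θ (conePoint δ e 0) := by
    rw [hz, div_self h0]
    simp [conePoint]
  have hz3 : z 3 = θ (conePoint δ e 3) := by
    rw [hz, ← hr]
    simp [conePoint]
  have hz4 : z 4 = θ (conePoint δ e 4) := by
    have : θ (conePoint δ e 4) = θ (X 0) * θ (X 1) := by simp [conePoint]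
    rw [this, hz, hr, hs]
    field_simp
  have hz5 : z 5 = θ (conePoint δ e 5) := by
    have : θ (conePoint δ e 5) = θ (X 0) ^ e * θ (X 2) := by simp [conePoint]
    rw [this, hz, ht, ← hr]
    field_simp
  have hz2 : z 2 = θ (conePoint δ e 2) := by
    have h1 := hquad _ hA
    have h2 := congrArg θ h.conePoint_eq
    rw [map_mul, map_add, map_mul, map_pow, map_pow, show θ (C δ) = algebraMap k L δ from
      θ.commutes δ, ← hz3, ← hz4, ← hz5] at h2
    rw [coneMatrix_quadratic, mul_eq_zero, or_iff_right two_ne_zero, sub_sub, ← h2, ← sub_mul,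
      mul_eq_zero] at h1
    refine sub_eq_zero.mp (h1.resolve_right ?_)
    rw [hz, ← hr]
    exact hr0
  have hz1 : z = (fun l => θ (conePoint δ e l)) + (z 1 - θ (conePoint δ e 1)) • Pi.single 1 1 := by
    ext l
    by_cases hl : l = 1
    · subst hl
      simp
    · have : z l = θ (conePoint δ e l) := by
        fin_cases l
        exacts [hz0, absurd rfl hl, hz2, hz3, hz4, hz5]
      simp [hl, this]
  have hB' := hquad _ hB
  rw [hz1, h.quadratic_add, mul_eq_zero, or_iff_right (pow_ne_zero _ hr0)] at hB'
  have hz1' : z 1 - θ (conePoint δ e 1) = -(θ b) / (2 * θ N) := by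
    rw [eq_div_iff (mul_ne_zero two_ne_zero hN)]
    linear_combination hB'
  rw [affinePoint_eq hN, ← hz1', ← hz1]
  exact hzw

open IntermediateField in
/-- The divisor `X₀ = 0` is contracted to a curve: its points depend on only one function.  For
`e = 1` this is the position on the vertex line, for `e = 0` it is the parameter `X 2`. -/
theorem IsParam.exists_mem_adjoin (h0 : θ (X 0) = 0) :
    ∃ c, ∀ l, affinePoint θ δ e N b l ∈ k⟮c⟯ := by
  rcases h.cone with rfl | ⟨rfl, rfl, c, rfl⟩
  · refine ⟨affinePoint θ δ 1 N b 1, fun l => ?_⟩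
    by_cases hl : l = 1
    · rw [hl]
      exact mem_adjoin_simple_self k _
    · rw [affinePoint_apply hN hl]
      fin_cases l <;> simp [conePoint, h0] at hl ⊢
  · refine ⟨θ (X 2), fun l => ?_⟩
    have hc : ∀ l, θ (conePoint (0 : k) 0 l) ∈ k⟮θ (X 2)⟯ := by
      intro l
      fin_cases l <;> simp [conePoint, h0, mem_adjoin_simple_self]
    have hb := h.constant_map (θ := θ)
    rw [pow_zero, one_mul] at hb
    rw [affinePoint_eq hN, ← hb]
    have hm : ∀ a : k, algebraMap k L a ∈ k⟮θ (X 2)⟯ := fun a => _root_.algebraMap_mem _ a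
    have hC : θ (C c) = algebraMap k L c := θ.commutes c
    refine add_mem (hc l) (mul_mem (div_mem (neg_mem ?_) (mul_mem ?_ (hC ▸ hm c))) ?_)
    · refine sum_mem fun a _ => mul_mem (hc a) ?_
      simp only [mulVec, dotProduct, map_apply]
      exact sum_mem fun a' _ => mul_mem (hm _) (hc a')
    · exact ofNat_mem _ 2
    · rw [Pi.single_apply]
      split_ifs
      exacts [one_mem _, zero_mem _]
end Values

end IsParam

end Parametrization

end

/-! ### Regularity of the residue form -/

section

open MvPolynomial Matrix

section Determinants

/-- The minors of a matrix `M` whose columns are annihilated by `N` are proportional to the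
complementary minors of `N`. -/
theorem det_fromBlocks_mul_det {F : Type*} [CommRing F] {m n : Type*} [Fintype m] [DecidableEq m]
    [Fintype n] [DecidableEq n]
    {N₁ : Matrix m m F} {N₂ : Matrix m n F} {C₁ : Matrix n m F} {C₂ : Matrix n n F}
    {M₁ : Matrix m n F} {M₂ : Matrix n n F} (h : N₁ * M₁ + N₂ * M₂ = 0) :
    (fromBlocks N₁ N₂ C₁ C₂).det * M₂.det = N₁.det * (C₁ * M₁ + C₂ * M₂).det := by
  have h1 : fromBlocks N₁ N₂ C₁ C₂ * fromBlocks 1 M₁ 0 M₂ =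
      fromBlocks N₁ 0 C₁ (C₁ * M₁ + C₂ * M₂) := by
    rw [fromBlocks_multiply, h]
    simp
  have h2 := congrArg det h1
  rwa [det_mul, det_fromBlocks_zero₂₁, det_one, one_mul, det_fromBlocks_zero₁₂] at h2

/-- Linearly independent rows can be completed to an invertible matrix. -/
theorem exists_isUnit_det_fromBlocks {κ : Type*} [Field κ] {m n : ℕ}
    {N₁ : Matrix (Fin m) (Fin m) κ} {N₂ : Matrix (Fin m) (Fin n) κ}
    (h : LinearIndependent κ (fromCols N₁ N₂).row) :
    ∃ (C₁ : Matrix (Fin n) (Fin m) κ) (C₂ : Matrix (Fin n) (Fin n) κ),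
      IsUnit (fromBlocks N₁ N₂ C₁ C₂).det := by
  let S := Submodule.span κ (Set.range (fromCols N₁ N₂).row)
  obtain ⟨T, hT⟩ := Submodule.exists_isCompl S
  have hS : Module.finrank κ S = m := by
    rw [finrank_span_eq_card h, Fintype.card_fin]
  have hT' : Module.finrank κ T = n := by
    have h1 := Submodule.finrank_add_eq_of_isCompl hT
    rw [hS, Module.finrank_fintype_fun_eq_card, Fintype.card_sum, Fintype.card_fin,
      Fintype.card_fin] at h1
    omega
  let b := Module.finBasisOfFinrankEq κ T hT'
  let w : Fin n → Fin m ⊕ Fin n → κ := fun a => b a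
  have hw : LinearIndependent κ w := b.linearIndependent.map' T.subtype T.ker_subtype
  have hspan : Submodule.span κ (Set.range w) ≤ T := by
    rw [Submodule.span_le]
    rintro _ ⟨a, rfl⟩
    exact (b a).2
  have hli := h.sum_type hw (hT.disjoint.mono_right hspan)
  refine ⟨Matrix.of fun a l => w a (Sum.inl l), Matrix.of fun a l => w a (Sum.inr l), ?_⟩
  rw [← isUnit_iff_isUnit_det, ← linearIndependent_rows_iff_isUnit]
  convert! hli using 1
  ext (a | a) (l | l) <;> rfl

open IsLocalRing in
theorem exists_isUnit_det_fromBlocks_of_residue {R : Type*} [CommRing R] [IsLocalRing R] {m n : ℕ}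
    {N₁ : Matrix (Fin m) (Fin m) R} {N₂ : Matrix (Fin m) (Fin n) R}
    (h : LinearIndependent (ResidueField R)
      (fromCols (N₁.map (residue R)) (N₂.map (residue R))).row) :
    ∃ (C₁ : Matrix (Fin n) (Fin m) R) (C₂ : Matrix (Fin n) (Fin n) R),
      IsUnit (fromBlocks N₁ N₂ C₁ C₂).det := by
  obtain ⟨C₁, C₂, hC⟩ := exists_isUnit_det_fromBlocks h
  choose s hs using residue_surjective (R := R)
  refine ⟨C₁.map s, C₂.map s, ?_⟩
  have h1 : ∀ {p q : ℕ} (C : Matrix (Fin p) (Fin q) (ResidueField R)),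
      (C.map s).map (residue R) = C := fun C => by ext; exact hs _
  refine isUnit_of_map_unit (residue R) _ ?_
  rw [RingHom.map_det, RingHom.mapMatrix_apply, fromBlocks_map, h1, h1]
  exact hC

end Determinants

section RegularForms
variable {k K : Type u} [Field k] [Field K] [Algebra k K]

/-- Expanding the determinant of the product by multilinearity exhibits the form as a combination of
the forms `du_{l₁} ∧ ⋯ ∧ du_{lₙ}` with coefficients in `R`. -/
theorem det_smul_mem_regularForms {n m : ℕ} {ρ : Fin n → K} {d : Fin n → Derivation k K K}
    (hd : ∀ l m, d l (ρ m) = if l = m then 1 else 0)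
    (hfrac : ∀ f : K, ∃ p q : MvPolynomial (Fin n) k,
      aeval ρ q ≠ 0 ∧ f = aeval ρ p / aeval ρ q) {R : Subalgebra k K} (u : Fin m → R)
    (C : Matrix (Fin n) (Fin m) R) :
    (C.map (algebraMap R K) * Matrix.of fun l j => d j (u l)).det •
      exteriorPower.ιMulti K n (fun m => KaehlerDifferential.D k K (ρ m)) ∈ regularForms n R := by
  have h1 : (C.map (algebraMap R K) * Matrix.of fun l j => d j (u l)).det =
      ∑ f : Fin n → Fin m, (∏ a, (C a (f a) : K)) * (Matrix.of fun a j => d j (u (f a))).det := by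
    have h2 : (C.map (algebraMap R K) * Matrix.of fun l j => d j (u l)) =
        Matrix.of fun a => ∑ l, (C a l : K) • fun j => d j (u l) := by
      ext a j
      simp [Matrix.mul_apply, Finset.sum_apply]
    rw [h2]
    have h3 := (Matrix.detRowAlternating (R := K) (n := Fin n)).toMultilinearMap.map_sum
      (g := fun a l => (C a l : K) • fun j => d j (u l : K))
    refine h3.trans (Finset.sum_congr rfl fun f _ => ?_)
    exact (Matrix.detRowAlternating (R := K) (n := Fin n)).toMultilinearMap.map_smul_univ
      (fun a => (C a (f a) : K)) fun a j => d j (u (f a) : K)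
  rw [h1, Finset.sum_smul]
  refine sum_mem fun f _ => ?_
  rw [mul_smul, ← ιMulti_D_eq_det_smul hd hfrac]
  have h4 : (∏ a, (C a (f a) : K)) = ((∏ a, C a (f a) : R) : K) := by
    simp
  rw [h4]
  exact Submodule.smul_mem _ (∏ a, C a (f a)) (Submodule.subset_span ⟨fun a => u (f a), rfl⟩)

theorem derivation_quadratic {m : ℕ} (d : Derivation k K K) (A : Matrix (Fin m) (Fin m) k)
    (hA : A.IsSymm) (u : Fin m → K) :
    d (u ⬝ᵥ A.map (algebraMap k K) *ᵥ u) =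
      2 * ((A.map (algebraMap k K) *ᵥ u) ⬝ᵥ fun l => d (u l)) := by
  have h1 : d (u ⬝ᵥ A.map (algebraMap k K) *ᵥ u) =
      (fun l => d (u l)) ⬝ᵥ A.map (algebraMap k K) *ᵥ u +
      u ⬝ᵥ A.map (algebraMap k K) *ᵥ fun l => d (u l) := by
    simp only [dotProduct, mulVec, map_sum, d.leibniz, map_apply, smul_eq_mul, d.map_algebraMap,
      mul_zero, add_zero, Finset.sum_add_distrib]
    rw [add_comm]
    congr 1
    exact Finset.sum_congr rfl fun l _ => mul_comm _ _
  rw [h1, dotProduct_mulVec u, ← mulVec_transpose, (hA.map _).eq, dotProduct_comm, two_mul]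

theorem algHom_mulVec {R T : Type*} [CommRing R] [CommRing T] [Algebra k R] [Algebra k T]
    (f : R →ₐ[k] T) {m : ℕ} (A : Matrix (Fin m) (Fin m) k) (u : Fin m → R) (l : Fin m) :
    f ((A.map (algebraMap k R) *ᵥ u) l) = (A.map (algebraMap k T) *ᵥ fun l => f (u l)) l := by
  simp [mulVec, dotProduct]

theorem algHom_quadratic {R T : Type*} [CommRing R] [CommRing T] [Algebra k R] [Algebra k T]
    (f : R →ₐ[k] T) {m : ℕ} (A : Matrix (Fin m) (Fin m) k) (u : Fin m → R) :
    f (u ⬝ᵥ A.map (algebraMap k R) *ᵥ u) =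
      (fun l => f (u l)) ⬝ᵥ A.map (algebraMap k T) *ᵥ fun l => f (u l) := by
  simp [mulVec, dotProduct]

theorem isSymm_coneMatrix (δ : k) : (coneMatrix δ).IsSymm := by
  ext a b
  fin_cases a <;> fin_cases b <;> rfl

open IsLocalRing in
/-- The form `N⁻¹ dr ∧ ds ∧ dt` is the residue of the standard form along the two quadrics, and so
it is regular wherever the Jacobian criterion holds.  In terms of matrices, the differentials of the
equations (and `e₀`, for the equation `u₀ = 1`) annihilate the matrix of the derivatives of the
`uₗ`, so its `3 × 3` minors are proportional to the complementary ones. -/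
theorem IsParam.smul_mem_regularForms [CharZero K] {B : Matrix (Fin 6) (Fin 6) k} {δ : k} {e : ℕ}
    {N b : MvPolynomial (Fin 3) k} (h : IsParam B δ e N b) {ρ : Fin 3 → K}
    {d : Fin 3 → Derivation k K K} (hd : ∀ l m, d l (ρ m) = if l = m then 1 else 0)
    (hfrac : ∀ f : K, ∃ p q : MvPolynomial (Fin 3) k,
      aeval ρ q ≠ 0 ∧ f = aeval ρ p / aeval ρ q) (hr : ρ 0 ≠ 0) (hN : aeval ρ N ≠ 0)
    {R : Subalgebra k K} [IsLocalRing R] (u : Fin 6 → R)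
    (hu : ∀ l, (u l : K) = affinePoint (aeval ρ) δ e N b l)
    (hjac : ∀ a c : ResidueField R, a • (coneMatrix δ).map (algebraMap k _) *ᵥ
      (fun l => residue R (u l)) + c • B.map (algebraMap k _) *ᵥ (fun l => residue R (u l)) = 0 →
      a = 0 ∧ c = 0) :
    (aeval ρ N)⁻¹ • exteriorPower.ιMulti K 3 (fun m => KaehlerDifferential.D k K (ρ m)) ∈
      regularForms 3 R := by
  let A := coneMatrix δ
  have hu' : (fun l => (u l : K)) = affinePoint (aeval ρ) δ e N b := funext hu
  have hA0 : u ⬝ᵥ A.map (algebraMap k R) *ᵥ u = 0 := by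
    apply Subtype.ext
    refine (algHom_quadratic R.val A u).trans ?_
    exact (congrArg (fun v => v ⬝ᵥ A.map (algebraMap k K) *ᵥ v) hu').trans (h.cone_affinePoint hN)
  have hB0 : u ⬝ᵥ B.map (algebraMap k R) *ᵥ u = 0 := by
    apply Subtype.ext
    refine (algHom_quadratic R.val B u).trans ?_
    exact (congrArg (fun v => v ⬝ᵥ B.map (algebraMap k K) *ᵥ v) hu').trans
      (h.quadratic_affinePoint hN)
  have hval : ∀ l, l ≠ 1 → (u l : K) = aeval ρ (conePoint δ e l) := fun l hl =>
    (hu l).trans (affinePoint_apply hN hl)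
  have hu0 : u 0 = 1 := Subtype.ext ((hval 0 (by decide)).trans (by simp [conePoint]))
  have hu3 : (u 3 : K) = ρ 0 := (hval 3 (by decide)).trans (by simp [conePoint])
  have hu4 : (u 4 : K) = ρ 0 * ρ 1 := (hval 4 (by decide)).trans (by simp [conePoint])
  have hu5 : (u 5 : K) = ρ 0 ^ e * ρ 2 := (hval 5 (by decide)).trans (by simp [conePoint])
  -- The differentials of the three equations; by `hjac` they remain independent in the residue
  -- field.
  let Nh : Matrix (Fin 3) (Fin 6) R := Matrix.of ![Pi.single 0 1, A.map (algebraMap k R) *ᵥ u,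
    B.map (algebraMap k R) *ᵥ u]
  let N₁ : Matrix (Fin 3) (Fin 3) R := Nh.submatrix id (Fin.castAdd 3)
  let N₂ : Matrix (Fin 3) (Fin 3) R := Nh.submatrix id (Fin.natAdd 3)
  let res : R →ₐ[k] ResidueField R := IsScalarTower.toAlgHom k R _
  have hli : LinearIndependent (ResidueField R)
      (fromCols (N₁.map (residue R)) (N₂.map (residue R))).row := by
    rw [Fintype.linearIndependent_iff]
    intro g hg
    have hg' : g 0 • Pi.single 0 1 + (g 1 • A.map (algebraMap k _) *ᵥ (fun l => residue R (u l)) +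
        g 2 • B.map (algebraMap k _) *ᵥ (fun l => residue R (u l))) = 0 := by
      have h1 : ∀ l : Fin (3 + 3), ∑ a, g a * residue R (Nh a l) = 0 := by
        intro l
        refine Fin.addCases (fun l => ?_) (fun l => ?_) l
        · have h2 := congrFun hg (Sum.inl l)
          rw [Finset.sum_apply] at h2
          exact h2
        · have h2 := congrFun hg (Sum.inr l)
          rw [Finset.sum_apply] at h2
          exact h2
      ext l
      have h2 := h1 l
      rw [Fin.sum_univ_three] at h2
      have h3 : residue R (Nh 0 l) = Pi.single (M := fun _ => ResidueField R) 0 1 l := by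
        change residue R (Pi.single (M := fun _ => R) 0 1 l) = _
        rw [Pi.single_apply, Pi.single_apply]
        split_ifs <;> simp
      have h4 : residue R (Nh 1 l) = (A.map (algebraMap k _) *ᵥ (fun l => residue R (u l))) l :=
        algHom_mulVec res A u l
      have h5 : residue R (Nh 2 l) = (B.map (algebraMap k _) *ᵥ (fun l => residue R (u l))) l :=
        algHom_mulVec res B u l
      rw [h3, h4, h5, add_assoc] at h2
      exact h2
    have hz : ∀ M : Matrix (Fin 6) (Fin 6) k, u ⬝ᵥ M.map (algebraMap k R) *ᵥ u = 0 →
        (fun l => residue R (u l)) ⬝ᵥ M.map (algebraMap k _) *ᵥ (fun l => residue R (u l)) = 0 := by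
      intro M hM
      refine (algHom_quadratic res M u).symm.trans ?_
      rw [hM, map_zero]
    have h0 : g 0 = 0 := by
      have h1 := congrArg (fun v => (fun l => residue R (u l)) ⬝ᵥ v) hg'
      simp only [dotProduct_add, dotProduct_smul, hz A hA0, hz B hB0, dotProduct_single_one, hu0,
        map_one, smul_eq_mul, mul_one, mul_zero, add_zero, dotProduct_zero] at h1
      exact h1
    rw [h0, zero_smul, zero_add] at hg'
    obtain ⟨h1, h2⟩ := hjac _ _ hg'
    intro a
    fin_cases a
    exacts [h0, h1, h2]
  obtain ⟨C₁, C₂, hC⟩ := exists_isUnit_det_fromBlocks_of_residue hli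
  -- The derivatives of the coordinates of the point, annihilated by the equations.
  let M : Matrix (Fin 6) (Fin 3) K := Matrix.of fun l j => d j (u l)
  let M₁ : Matrix (Fin 3) (Fin 3) K := M.submatrix (Fin.castAdd 3) id
  let M₂ : Matrix (Fin 3) (Fin 3) K := M.submatrix (Fin.natAdd 3) id
  let ι := algebraMap R K
  have hNM : Nh.map ι * M = 0 := by
    have hz : ∀ (D : Matrix (Fin 6) (Fin 6) k), D.IsSymm → u ⬝ᵥ D.map (algebraMap k R) *ᵥ u = 0 →
        ∀ j, (D.map (algebraMap k K) *ᵥ fun l => (u l : K)) ⬝ᵥ (fun l => d j (u l)) = 0 := by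
      intro D hD hD0 j
      have h1 := derivation_quadratic (d j) D hD fun l => (u l : K)
      have h2 : (fun l => (u l : K)) ⬝ᵥ D.map (algebraMap k K) *ᵥ (fun l => (u l : K)) = 0 :=
        (algHom_quadratic R.val D u).symm.trans (by rw [hD0, map_zero])
      rw [h2, map_zero] at h1
      exact (mul_eq_zero.mp h1.symm).resolve_left two_ne_zero
    ext a j
    have ha : (Nh.map ι * M) a j = (fun l => (Nh a l : K)) ⬝ᵥ fun l => d j (u l) := rfl
    rw [ha]
    fin_cases a
    · have h1 : (fun l => ((Nh 0 l : R) : K)) = Pi.single 0 1 := by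
        ext l
        change ((Pi.single (M := fun _ => R) 0 1 l : R) : K) = _
        rw [Pi.single_apply, Pi.single_apply]
        split_ifs <;> simp
      refine (congrArg (· ⬝ᵥ _) h1).trans ?_
      rw [single_one_dotProduct, hu0]
      exact (d j).map_one_eq_zero
    · exact (congrArg (· ⬝ᵥ _) (funext fun l => algHom_mulVec R.val A u l)).trans
        (hz A (isSymm_coneMatrix δ) hA0 j)
    · exact (congrArg (· ⬝ᵥ _) (funext fun l => algHom_mulVec R.val B u l)).trans
        (hz B h.symm hB0 j)
  have hsplit : ∀ Z : Matrix (Fin 3) (Fin 6) K, Z.submatrix id (Fin.castAdd 3) * M₁ +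
      Z.submatrix id (Fin.natAdd 3) * M₂ = Z * M := by
    intro Z
    ext a j
    exact (Fin.sum_univ_add (a := 3) (b := 3) fun l => Z a l * M l j).symm
  let C : Matrix (Fin 3) (Fin 6) R :=
    Matrix.of fun a => Fin.addCases (m := 3) (n := 3) (C₁ a) (C₂ a)
  have hC₁ : C.submatrix id (Fin.castAdd 3) = C₁ := by
    refine Matrix.ext fun a l => ?_
    exact Fin.addCases_left (motive := fun _ => R) (left := C₁ a) (right := C₂ a) l
  have hC₂ : C.submatrix id (Fin.natAdd 3) = C₂ := by
    refine Matrix.ext fun a l => ?_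
    exact Fin.addCases_right (motive := fun _ => R) (left := C₁ a) (right := C₂ a) l
  have hdet := det_fromBlocks_mul_det (C₁ := C₁.map ι) (C₂ := C₂.map ι)
    ((hsplit (Nh.map ι)).trans hNM)
  have hCM : C₁.map ι * M₁ + C₂.map ι * M₂ = C.map ι * M := by
    rw [← hsplit]
    exact congrArg₂ (· + ·) (congrArg (fun Z => Z.map ι * M₁) hC₁.symm)
      (congrArg (fun Z => Z.map ι * M₂) hC₂.symm)
  have hN₁ : ((Nh.map ι).submatrix id (Fin.castAdd 3)).det = -(ρ 0 * (ρ 0 ^ e * aeval ρ N)) := by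
    have h0 : ∀ l, ((Nh 0 l : R) : K) = ((Pi.single (M := fun _ => R) 0 1 l : R) : K) :=
      fun _ => rfl
    have h1 : ∀ l, ((Nh 1 l : R) : K) =
        ![0, 0, (u 3 : K), u 2, -2 * u 4, -2 * algebraMap k K δ * u 5] l := by
      intro l
      rw [← coneMatrix_mulVec δ fun l => (u l : K)]
      exact algHom_mulVec R.val A u l
    have h2 : ((Nh 2 1 : R) : K) = ρ 0 ^ e * aeval ρ N := by
      have h3 := h.mulVec_affinePoint hN
      rw [aeval_X, ← hu'] at h3
      exact (algHom_mulVec R.val B u 1).trans h3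
    rw [det_fin_three]
    change ((Nh 0 0 : R) : K) * (Nh 1 1 : R) * (Nh 2 2 : R) -
      (Nh 0 0 : R) * (Nh 1 2 : R) * (Nh 2 1 : R) - (Nh 0 1 : R) * (Nh 1 0 : R) * (Nh 2 2 : R) +
      (Nh 0 1 : R) * (Nh 1 2 : R) * (Nh 2 0 : R) + (Nh 0 2 : R) * (Nh 1 0 : R) * (Nh 2 1 : R) -
      (Nh 0 2 : R) * (Nh 1 1 : R) * (Nh 2 0 : R) = _
    rw [h1, h1, h1, h2, h0, h0, h0]
    simp [hu3]
  have hM₂ : M₂.det = ρ 0 * ρ 0 ^ e := by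
    have h3 : ∀ j, M₂ 0 j = d j (ρ 0) := fun j => congrArg (d j) hu3
    have h4 : ∀ j, M₂ 1 j = d j (ρ 0 * ρ 1) := fun j => congrArg (d j) hu4
    have h5 : ∀ j, M₂ 2 j = d j (ρ 0 ^ e * ρ 2) := fun j => congrArg (d j) hu5
    rw [det_fin_three]
    simp [h3, h4, h5, hd, Derivation.leibniz, Derivation.leibniz_pow]
  have hblock : (fromBlocks ((Nh.map ι).submatrix id (Fin.castAdd 3))
      ((Nh.map ι).submatrix id (Fin.natAdd 3)) (C₁.map ι) (C₂.map ι)).det =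
      ι (fromBlocks N₁ N₂ C₁ C₂).det := by
    rw [RingHom.map_det, RingHom.mapMatrix_apply, fromBlocks_map]
    rfl
  rw [hCM, hN₁, hM₂, hblock] at hdet
  obtain ⟨v, hv⟩ := hC
  -- Both `N₁` and `M₂` contain the factor `ρ₀ᵉ⁺¹`, which cancels.
  have hfinal : (aeval ρ N)⁻¹ = -((↑v⁻¹ : R) : K) * (C.map ι * M).det := by
    have hvv : ι (fromBlocks N₁ N₂ C₁ C₂).det * ((↑v⁻¹ : R) : K) = 1 := by
      rw [← hv]
      exact congrArg Subtype.val v.mul_inv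
    have hρe : ρ 0 * ρ 0 ^ e ≠ 0 := mul_ne_zero hr (pow_ne_zero e hr)
    have h1 : ι (fromBlocks N₁ N₂ C₁ C₂).det = -(aeval ρ N) * (C.map ι * M).det := by
      refine mul_right_cancel₀ hρe ?_
      linear_combination hdet
    rw [inv_eq_iff_eq_inv, eq_comm]
    refine inv_eq_of_mul_eq_one_left ?_
    linear_combination hvv - ((↑v⁻¹ : R) : K) * h1
  rw [hfinal, mul_smul]
  exact Submodule.smul_mem _ (-(↑v⁻¹ : R)) (det_smul_mem_regularForms hd hfrac u C)

end RegularForms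

end

/-! ### Birationality of the parametrization -/

section

open MvPolynomial Matrix

section ChangeOfCoordinates
variable {k : Type u} [Field k]

theorem quadratic_smul_mulVec {T : Type*} [CommRing T] [Algebra k T] {m : ℕ}
    (A P : Matrix (Fin m) (Fin m) k) (s : T) (u : Fin m → T) :
    (s • (P.map (algebraMap k T) *ᵥ u)) ⬝ᵥ A.map (algebraMap k T) *ᵥ
      (s • (P.map (algebraMap k T) *ᵥ u)) =
      s ^ 2 * (u ⬝ᵥ (Pᵀ * A * P).map (algebraMap k T) *ᵥ u) := by
  rw [mulVec_smul, dotProduct_smul, smul_dotProduct, smul_smul, ← sq, smul_eq_mul, Matrix.map_mul,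
    Matrix.map_mul, ← mulVec_mulVec, ← mulVec_mulVec, dotProduct_mulVec u, transpose_map,
    vecMul_transpose]

/-- The homogeneous coordinates of the parametrized point. -/
def paramCoord (P : Matrix (Fin 6) (Fin 6) k) (δ : k) (e : ℕ) (N b : MvPolynomial (Fin 3) k) :
    Fin 6 → MvPolynomial (Fin 3) k :=
  P.map C *ᵥ paramPoint δ e N b

variable {B : Matrix (Fin 6) (Fin 6) k} {δ : k} {e : ℕ} {N b : MvPolynomial (Fin 3) k}
  (h : IsParam B δ e N b) {P S A' B' : Matrix (Fin 6) (Fin 6) k}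
  (hS : S * P = 1) (hA : Pᵀ * A' * P = coneMatrix δ) (hB : Pᵀ * B' * P = B)

theorem paramCoord_eq {L : Type*} [Field L] [CharZero L] [Algebra k L]
    {θ : MvPolynomial (Fin 3) k →ₐ[k] L} (hN : θ N ≠ 0) (l : Fin 6) :
    θ (paramCoord P δ e N b l) =
      2 * θ N * (P.map (algebraMap k L) *ᵥ affinePoint θ δ e N b) l := by
  have h1 : θ (paramCoord P δ e N b l) =
      (P.map (algebraMap k L) *ᵥ fun l => θ (paramPoint δ e N b l)) l :=
    algHom_mulVec θ P (paramPoint δ e N b) l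
  have h2 : (fun l => θ (paramPoint δ e N b l)) = (2 * θ N) • affinePoint θ δ e N b := by
    ext l
    exact (mul_div_cancel₀ _ (mul_ne_zero two_ne_zero hN)).symm
  rw [h1, h2, mulVec_smul]
  rfl

include h hS in
theorem IsParam.exists_not_dvd_paramCoord [CharZero k] : ∃ j, ¬ X 0 ∣ paramCoord P δ e N b j := by
  by_contra! hall
  have h1 : S.map C *ᵥ paramCoord P δ e N b = paramPoint δ e N b := by
    rw [paramCoord, mulVec_mulVec, ← Matrix.map_mul, hS, Matrix.map_one _ (map_zero _) (map_one _),
      one_mulVec]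
  have h2 : X 0 ∣ paramPoint δ e N b 0 := by
    rw [← h1]
    change X 0 ∣ ∑ l, S.map C 0 l * paramCoord P δ e N b l
    exact Finset.dvd_sum fun l _ => (hall l).mul_left _
  have h3 : paramPoint δ e N b 0 = C 2 * N := by
    simp [paramPoint, conePoint, map_ofNat C 2]
  rw [h3] at h2
  refine h.not_dvd ((IsUnit.dvd_mul_left ?_).mp h2)
  exact (isUnit_iff_ne_zero.mpr two_ne_zero).map C

include h hA hB in
/-- The parametrized points lie on the intersection of the two quadrics. -/
theorem IsParam.aeval_paramCoord {L : Type*} [Field L] [CharZero L] [Algebra k L]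
    {θ : MvPolynomial (Fin 3) k →ₐ[k] L} (hN : θ N ≠ 0) {j : Fin 6}
    (hj : θ (paramCoord P δ e N b j) ≠ 0) (p : MvPolynomial (Fin 6) k)
    (hp : p ∈ chartIdeal A' B' j) :
    aeval (fun l => θ (paramCoord P δ e N b l) / θ (paramCoord P δ e N b j)) p = 0 := by
  have hv : (fun l => θ (paramCoord P δ e N b l) / θ (paramCoord P δ e N b j)) =
      (2 * θ N / θ (paramCoord P δ e N b j)) •
        (P.map (algebraMap k L) *ᵥ affinePoint θ δ e N b) := by
    ext l
    rw [paramCoord_eq hN l, Pi.smul_apply, smul_eq_mul]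
    ring
  have hle : chartIdeal A' B' j ≤ RingHom.ker (aeval (R := k)
      fun l => θ (paramCoord P δ e N b l) / θ (paramCoord P δ e N b j)) := by
    refine Ideal.span_le.mpr ?_
    rintro q (rfl | rfl | rfl)
    · rw [SetLike.mem_coe, RingHom.mem_ker, map_sub, aeval_X, map_one, div_self hj, sub_self]
    · rw [SetLike.mem_coe, RingHom.mem_ker, aeval_quadraticPoly, hv, quadratic_smul_mulVec, hA,
        h.cone_affinePoint hN, mul_zero]
    · rw [SetLike.mem_coe, RingHom.mem_ker, aeval_quadraticPoly, hv, quadratic_smul_mulVec, hB,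
        h.quadratic_affinePoint hN, mul_zero]
  exact hle hp

theorem div_div_pow_eq {F : Type*} [Field F] {x z f n : F} (hx : x ≠ 0) (hf : f ≠ 0) (hn : n ≠ 0)
    (e : ℕ) : n * (x ^ e * z) / f * (n / f) ^ e / (n / f * (n * x / f) ^ e) = z := by
  rw [show n * x / f = x * (n / f) by ring, mul_pow]
  field_simp

include h hS hA hB in
/-- The parametrization is birational: the function field of the intersection of the quadrics is
the field of rational functions in the parameters. -/
theorem IsParam.exists_parameters [CharZero k] {K : Type u} [Field K] [Algebra k K] {j : Fin 6}
    (hj : ¬ X 0 ∣ paramCoord P δ e N b j) {ξ : Fin 6 → K}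
    (hker : ∀ p : MvPolynomial (Fin 6) k, aeval ξ p = 0 ↔ p ∈ chartIdeal A' B' j)
    (hgen : ∀ f : K, ∃ p q : MvPolynomial (Fin 6) k,
      aeval ξ q ≠ 0 ∧ f = aeval ξ p / aeval ξ q)
    (hpt : ∀ I : Ideal (MvPolynomial (Fin 6) k), I.IsPrime → chartIdeal A' B' j ≤ I →
      ∃ R : Subalgebra k K, IsFractionsAt ξ I R) :
    ∃ ρ : Fin 3 → K, AlgebraicIndependent k ρ ∧
      (∀ f : K, ∃ p q : MvPolynomial (Fin 3) k, aeval ρ q ≠ 0 ∧ f = aeval ρ p / aeval ρ q) ∧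
      ∀ l, ξ l = aeval ρ (paramCoord P δ e N b l) / aeval ρ (paramCoord P δ e N b j) := by
  have hP : P * S = 1 := mul_eq_one_comm.mp hS
  have : CharZero K := charZero_of_injective_algebraMap (algebraMap k K).injective
  let L := FractionRing (MvPolynomial (Fin 3) k)
  have : CharZero L := charZero_of_injective_algebraMap (algebraMap k L).injective
  let θ : MvPolynomial (Fin 3) k →ₐ[k] L := IsScalarTower.toAlgHom k _ L
  have hθ : Function.Injective θ := IsFractionRing.injective (MvPolynomial (Fin 3) k) L
  have hne : ∀ {q : MvPolynomial (Fin 3) k}, ¬ X 0 ∣ q → θ q ≠ 0 := fun {q} hq h0 =>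
    hq ((injective_iff_map_eq_zero _).mp hθ q h0 ▸ dvd_zero _)
  have hθX : ∀ a, θ (X a) ≠ 0 := fun a h0 =>
    X_ne_zero a ((injective_iff_map_eq_zero _).mp hθ _ h0)
  let F := paramCoord P δ e N b
  have hF : θ (F j) ≠ 0 := hne hj
  have hN : θ N ≠ 0 := hne h.not_dvd
  let φ : MvPolynomial (Fin 6) k →ₐ[k] L := aeval fun l => θ (F l) / θ (F j)
  have hφ : ∀ p ∈ chartIdeal A' B' j, φ p = 0 := h.aeval_paramCoord hA hB hN hF
  let I : Ideal (MvPolynomial (Fin 6) k) := RingHom.ker φ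
  have hI : I.IsPrime := RingHom.ker_isPrime φ
  -- `R` is the local ring of the image of the parametrization; the parametrization induces a
  -- homomorphism `ψ` from `R` to the field of rational functions.
  obtain ⟨R, hR⟩ := hpt I hI hφ
  have hkerI : ∀ p : MvPolynomial (Fin 6) k, aeval ξ p = 0 → p ∈ I :=
    fun p hp => hφ p ((hker p).mp hp)
  obtain ⟨ψ, hψ⟩ := hR.exists_lift hkerI φ.toRingHom (fun q hq => isUnit_iff_ne_zero.mpr hq)
    fun p hp => hkerI p hp
  have hmem : ∀ (p q : MvPolynomial (Fin 6) k), φ q ≠ 0 → aeval ξ p / aeval ξ q ∈ R :=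
    fun p q hq => (hR _).mpr ⟨p, q, hq, rfl⟩
  have hξ0 : ∀ q : MvPolynomial (Fin 6) k, φ q ≠ 0 → aeval ξ q ≠ 0 :=
    fun q hq h0 => hq (hkerI q h0)
  have hψdiv : ∀ (p q : MvPolynomial (Fin 6) k) (hq : φ q ≠ 0),
      ψ ⟨_, hmem p q hq⟩ = φ p / φ q := by
    intro p q hq
    rw [eq_div_iff hq, ← show φ.toRingHom q = φ q from rfl, ← show φ.toRingHom p = φ p from rfl,
      ← hψ q, ← hψ p, ← map_mul]
    exact congrArg ψ (Subtype.ext (div_mul_cancel₀ _ (hξ0 q hq)))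
  -- The coordinates `W` in which the pencil has its normal form, and their values `w` in `K`.
  let W : Fin 6 → MvPolynomial (Fin 6) k := S.map C *ᵥ X
  let w : Fin 6 → K := fun l => aeval ξ (W l)
  have hw : w = S.map (algebraMap k K) *ᵥ ξ := by
    ext l
    refine (algHom_mulVec (aeval ξ) S X l).trans ?_
    simp only [aeval_X]
  have hξw : ξ = (1 : K) • (P.map (algebraMap k K) *ᵥ w) := by
    rw [one_smul, hw, mulVec_mulVec, ← Matrix.map_mul, hP]
    simp
  have hφW : ∀ l, φ (W l) = θ (paramPoint δ e N b l) / θ (F j) := by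
    intro l
    refine (algHom_mulVec φ S X l).trans ?_
    have h1 : (fun l => φ (X l)) = (θ (F j))⁻¹ •
        (P.map (algebraMap k L) *ᵥ fun l => θ (paramPoint δ e N b l)) := by
      ext l
      rw [Pi.smul_apply, smul_eq_mul, ← show θ (F l) = _ from algHom_mulVec θ P _ l, aeval_X,
        div_eq_inv_mul]
    rw [h1, mulVec_smul, mulVec_mulVec, ← Matrix.map_mul, hS]
    simp [div_eq_inv_mul]
  have hp0 : θ (paramPoint δ e N b 0) = 2 * θ N := by simp [paramPoint, conePoint, map_ofNat]
  have hp3 : θ (paramPoint δ e N b 3) = 2 * θ N * θ (X 0) := by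
    simp [paramPoint, conePoint, map_ofNat]
  have hp4 : θ (paramPoint δ e N b 4) = 2 * θ N * (θ (X 0) * θ (X 1)) := by
    simp [paramPoint, conePoint, map_ofNat]
  have hp5 : θ (paramPoint δ e N b 5) = 2 * θ N * (θ (X 0) ^ e * θ (X 2)) := by
    simp [paramPoint, conePoint, map_ofNat]
  have h2N : 2 * θ N ≠ 0 := mul_ne_zero two_ne_zero hN
  have hW0 : φ (W 0) ≠ 0 := by
    rw [hφW, hp0]
    exact div_ne_zero h2N hF
  have hW3 : φ (W 3) ≠ 0 := by
    rw [hφW, hp3]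
    exact div_ne_zero (mul_ne_zero h2N (hθX 0)) hF
  have hW03 : φ (W 0 * W 3 ^ e) ≠ 0 := by
    rw [map_mul, map_pow]
    exact mul_ne_zero hW0 (pow_ne_zero e hW3)
  -- The parameters `r = w₃ / w₀`, `s = w₄ / w₃` and `t = w₅ / (w₀ rᵉ)`.
  let ρ : Fin 3 → R := ![⟨_, hmem (W 3) (W 0) hW0⟩, ⟨_, hmem (W 4) (W 3) hW3⟩,
    ⟨_, hmem (W 5 * W 0 ^ e) (W 0 * W 3 ^ e) hW03⟩]
  have hψρ : ∀ a, ψ (ρ a) = θ (X a) := by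
    have hX0 := hθX 0
    intro a
    fin_cases a
    · refine (hψdiv _ _ hW0).trans ?_
      rw [hφW, hφW, hp0, hp3, div_div_div_cancel_right₀ hF, mul_div_cancel_left₀ _ h2N]
      rfl
    · refine (hψdiv _ _ hW3).trans ?_
      rw [hφW, hφW, hp3, hp4, div_div_div_cancel_right₀ hF, mul_div_mul_left _ _ h2N,
        mul_div_cancel_left₀ _ hX0]
      rfl
    · refine (hψdiv _ _ hW03).trans ?_
      rw [map_mul, map_mul, map_pow, map_pow, hφW, hφW, hφW, hp0, hp3, hp5]
      exact div_div_pow_eq hX0 hF h2N e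
  let ρK : Fin 3 → K := fun a => ρ a
  have hψp : ∀ p : MvPolynomial (Fin 3) k, ψ (aeval ρ p) = θ p := by
    have h1 : ψ.comp (aeval (R := k) ρ).toRingHom = θ.toRingHom := by
      refine MvPolynomial.ringHom_ext (fun c => ?_) fun a => ?_
      · have h2 : (aeval (R := k) ρ (C c) : R) = ⟨aeval ξ (C c), hR.aeval_mem _⟩ := by
          apply Subtype.ext
          change _ = aeval ξ (C c)
          rw [aeval_C, aeval_C]
          rfl
        change ψ (aeval (R := k) ρ (C c)) = θ (C c)
        rw [h2, hψ]
        exact (φ.commutes c).trans (θ.commutes c).symm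
      · change ψ (aeval (R := k) ρ (X a)) = _
        rw [aeval_X, hψρ]
        rfl
    exact fun p => congrArg (fun f => f p) h1
  have hval : ∀ p : MvPolynomial (Fin 3) k, ((aeval ρ p : R) : K) = aeval ρK p := fun p =>
    comp_aeval_apply ρ R.val p
  have hρ : AlgebraicIndependent k ρK := by
    refine (injective_iff_map_eq_zero _).mpr fun p hp => ?_
    have h1 : aeval ρ p = 0 := Subtype.ext ((hval p).trans hp)
    have h2 := hψp p
    rw [h1, map_zero] at h2
    exact (injective_iff_map_eq_zero _).mp hθ p h2.symm
  have hneK : ∀ {q : MvPolynomial (Fin 3) k}, ¬ X 0 ∣ q → aeval ρK q ≠ 0 := fun hq =>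
    aeval_ne_zero_of_not_dvd hρ hq
  have hNK : aeval ρK N ≠ 0 := hneK h.not_dvd
  have hFK : aeval ρK (F j) ≠ 0 := hneK hj
  have hquad : ∀ M : Matrix (Fin 6) (Fin 6) k, quadraticPoly M ∈ chartIdeal A' B' j →
      w ⬝ᵥ (Pᵀ * M * P).map (algebraMap k K) *ᵥ w = 0 := by
    intro M hM
    have h1 := (hker _).mpr hM
    rw [aeval_quadraticPoly, hξw, quadratic_smul_mulVec, one_pow, one_mul] at h1
    exact h1
  have hwA := hquad A' (Ideal.subset_span (Or.inr (Or.inl rfl)))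
  have hwB := hquad B' (Ideal.subset_span (Or.inr (Or.inr rfl)))
  rw [hA] at hwA
  rw [hB] at hwB
  have hw0 : w 0 ≠ 0 := hξ0 _ hW0
  have hw3 : w 3 ≠ 0 := hξ0 _ hW3
  have hweq := h.eq_smul_affinePoint (θ := aeval ρK) hNK hw0 hw3 hwA hwB (aeval_X _ _)
    (aeval_X _ _) (by
      rw [aeval_X]
      change aeval ξ (W 5 * W 0 ^ e) / aeval ξ (W 0 * W 3 ^ e) = _
      rw [map_mul, map_mul, map_pow, map_pow]
      change w 5 * w 0 ^ e / (w 0 * w 3 ^ e) = _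
      rw [div_pow]
      field_simp)
  have hξF : ∀ l, ξ l = w 0 / (2 * aeval ρK N) * aeval ρK (F l) := by
    intro l
    rw [paramCoord_eq hNK l]
    have h1 := congrFun hξw l
    rw [one_smul, hweq, mulVec_smul, Pi.smul_apply, smul_eq_mul] at h1
    rw [h1]
    field_simp
  have hξj : ξ j = 1 := by
    have h1 := (hker (X j - 1)).mpr (Ideal.subset_span (Or.inl rfl))
    rwa [map_sub, aeval_X, map_one, sub_eq_zero] at h1
  have hξ : ∀ l, ξ l = aeval ρK (F l) / aeval ρK (F j) := by
    intro l
    have h1 := hξF j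
    rw [hξj] at h1
    rw [eq_div_iff hFK, hξF l, mul_right_comm, ← h1, one_mul]
  refine ⟨ρK, hρ, fun f => ?_, hξ⟩
  have hadj : ∀ p : MvPolynomial (Fin 6) k,
      aeval ξ p ∈ IntermediateField.adjoin k (Set.range ρK) := by
    have hp : ∀ p : MvPolynomial (Fin 3) k,
        aeval ρK p ∈ IntermediateField.adjoin k (Set.range ρK) :=
      fun p => (IntermediateField.mem_adjoin_range_iff k ρK _).mpr ⟨p, 1, by simp⟩
    intro p
    induction p using MvPolynomial.induction_on with
    | C c => rw [aeval_C]; exact IntermediateField.algebraMap_mem _ c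
    | add p q hp hq => rw [map_add]; exact add_mem hp hq
    | mul_X p l h1 =>
      rw [map_mul, aeval_X, hξ l]
      exact mul_mem h1 (div_mem (hp _) (hp _))
  obtain ⟨p, q, -, hf⟩ := hgen f
  have hmemf : f ∈ IntermediateField.adjoin k (Set.range ρK) := hf ▸ div_mem (hadj p) (hadj q)
  obtain ⟨r, s, hrs⟩ := (IntermediateField.mem_adjoin_range_iff k ρK _).mp hmemf
  by_cases hs : aeval ρK s = 0
  · refine ⟨0, 1, by simp, ?_⟩
    rw [hrs, hs, div_zero, map_zero, zero_div]
  · exact ⟨r, s, hs, hrs⟩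

end ChangeOfCoordinates

end

/-! ### The discrepancy of the exceptional divisor -/

section

open MvPolynomial Matrix

section NormalPoints
variable {k : Type u} [Field k] {X : Scheme.{u}} [IsIntegral X] (π : X ⟶ Spec (.of k))

instance isLocalRing_localRing (x : X) : IsLocalRing (localRing π x) :=
  (stalkEquivLocalRing π x).isLocalRing

/-- The local ring of a normal variety at a point of codimension at most one. -/
theorem isPrincipal_localRing {σ : Type} [Finite σ] {x : X}
    [IsIntegrallyClosed (X.presheaf.stalk x)] (hx : ringKrullDim (X.presheaf.stalk x) ≤ 1)
    {ξ : σ → FunField π} {I : Ideal (MvPolynomial σ k)} [I.IsPrime]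
    (hR : IsFractionsAt ξ I (localRing π x))
    (hI : ∀ p : MvPolynomial σ k, aeval ξ p = 0 → p ∈ I) :
    (IsLocalRing.maximalIdeal (localRing π x)).IsPrincipal ∧ ValuationRing (localRing π x) := by
  have h1 : IsNoetherianRing (localRing π x) := hR.isNoetherianRing hI
  have h2 : IsIntegrallyClosed (localRing π x) :=
    IsIntegrallyClosed.of_equiv (stalkEquivLocalRing π x)
  have h3 : (IsLocalRing.maximalIdeal (localRing π x)).IsPrincipal := by
    apply maximalIdeal_isPrincipal_of_ringKrullDim_le_one
    rwa [← ringKrullDim_eq_of_ringEquiv (stalkEquivLocalRing π x)]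
  have h4 := (tfae_of_isNoetherianRing_of_isLocalRing_of_isDomain (localRing π x)).out 4 1
  exact ⟨h3, h4.mp h3⟩

end NormalPoints

section Discrepancy
variable {k : Type u} [Field k] [CharZero k]
  {B : Matrix (Fin 6) (Fin 6) k} {δ : k} {e : ℕ} {N b : MvPolynomial (Fin 3) k}
  (h : IsParam B δ e N b) {P S A' B' : Matrix (Fin 6) (Fin 6) k}
  (hS : S * P = 1) (hA : Pᵀ * A' * P = coneMatrix δ) (hB : Pᵀ * B' * P = B)
  (hA' : A'.IsSymm) (hB' : B'.IsSymm) {j : Fin 6} (hj : ¬ X 0 ∣ paramCoord P δ e N b j)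
include h hj

/-- The valuation ring of the exceptional divisor is not the local ring of a point of the
intersection of the quadrics, as the divisor is contracted. -/
theorem IsParam.not_isFractionsAt_divisorRing {K : Type u} [Field K] [Algebra k K]
    {ρ : Fin 3 → K}
    (hρ : AlgebraicIndependent k ρ) (hfrac : ∀ f : K, ∃ p q : MvPolynomial (Fin 3) k,
      aeval ρ q ≠ 0 ∧ f = aeval ρ p / aeval ρ q) {y : Fin 6 → divisorRing hρ}
    (hy : ∀ l, (y l : K) =
      aeval ρ (paramCoord P δ e N b l) / aeval ρ (paramCoord P δ e N b j))
    (hV : IsFractionsAt (fun l => (y l : K))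
      ((IsLocalRing.maximalIdeal (divisorRing hρ)).comap (aeval (R := k) y)) (divisorRing hρ)) :
    False := by
  let κ := IsLocalRing.ResidueField (divisorRing hρ)
  have : CharZero κ := charZero_of_injective_algebraMap (algebraMap k κ).injective
  let z : Fin 3 → divisorRing hρ := fun a => ⟨aeval ρ (X a), aeval_mem_divisorRing hρ _⟩
  let θ : MvPolynomial (Fin 3) k →ₐ[k] κ :=
    (IsScalarTower.toAlgHom k (divisorRing hρ) κ).comp (aeval z)
  have hz : ∀ p : MvPolynomial (Fin 3) k,
      aeval z p = ⟨aeval ρ p, aeval_mem_divisorRing hρ p⟩ := by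
    intro p
    apply Subtype.ext
    have h1 := comp_aeval_apply z (divisorRing hρ).val p
    rw [show (fun a => (divisorRing hρ).val (z a)) = ρ from
      funext fun a => aeval_X (R := k) ρ a] at h1
    exact h1
  have hθ : ∀ p, θ p =
      IsLocalRing.residue (divisorRing hρ) ⟨aeval ρ p, aeval_mem_divisorRing hρ p⟩ := by
    intro p
    rw [← hz p]
    exact AlgHom.comp_apply _ _ _
  have hθ0 : ∀ p, θ p = 0 ↔ X 0 ∣ p := by
    intro p
    rw [hθ, IsLocalRing.residue_eq_zero_iff, aeval_mem_maximalIdeal_iff]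
  have hN : θ N ≠ 0 := fun h0 => h.not_dvd ((hθ0 _).mp h0)
  have hF : θ (paramCoord P δ e N b j) ≠ 0 := fun h0 => hj ((hθ0 _).mp h0)
  obtain ⟨c, hc⟩ := h.exists_mem_adjoin hN ((hθ0 _).mpr dvd_rfl)
  have hle := IsFractionsAt.trdeg_residueField_le_one (fun _ => rfl) hV c fun l => by
    have h1 : y l * ⟨_, aeval_mem_divisorRing hρ (paramCoord P δ e N b j)⟩ =
        ⟨_, aeval_mem_divisorRing hρ (paramCoord P δ e N b l)⟩ := by
      apply Subtype.ext
      change (y l : K) * _ = _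
      rw [hy, div_mul_cancel₀ _ (aeval_ne_zero_of_not_dvd hρ hj)]
    have h2 := congrArg (IsLocalRing.residue (divisorRing hρ)) h1
    rw [map_mul, ← hθ, ← hθ, ← eq_div_iff hF, paramCoord_eq hN, paramCoord_eq hN,
      mul_div_mul_left _ _ (mul_ne_zero two_ne_zero hN)] at h2
    rw [h2]
    have hm : ∀ l, (P.map (algebraMap k κ) *ᵥ affinePoint θ δ e N b) l ∈
        IntermediateField.adjoin k {c} := by
      intro l
      simp only [mulVec, dotProduct, map_apply]
      exact sum_mem fun m _ => mul_mem (IntermediateField.algebraMap_mem _ _) (hc m)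
    exact div_mem (hm l) (hm j)
  rw [trdeg_residueField_divisorRing hρ hfrac] at hle
  exact absurd hle (by norm_num)

variable {X : Scheme.{u}} [IsIntegral X] {π : X ⟶ Spec (.of k)} {i : X ⟶ projectiveSpace k 5}

include hS hA hB hA' hB' in
open IsLocalRing in
/-- At a point of codimension at most one where the coordinate `u₀` does not vanish, the form
`N⁻¹ dr ∧ ds ∧ dt` is regular. -/
theorem IsParam.smul_mem_regularForms_localRing
    (hi : IsIntersectionOfQuadrics π A' B' i) [Nonempty (i ⁻¹ᵁ (chart k 5 j).1)]
    {ρ : Fin 3 → FunField π} (hρ : AlgebraicIndependent k ρ)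
    (hfrac : ∀ f : FunField π, ∃ p q : MvPolynomial (Fin 3) k,
      aeval ρ q ≠ 0 ∧ f = aeval ρ p / aeval ρ q)
    (hξ : ∀ l, coord i j π l =
      aeval ρ (paramCoord P δ e N b l) / aeval ρ (paramCoord P δ e N b j))
    {d : Fin 3 → Derivation k (FunField π) (FunField π)}
    (hd : ∀ l m, d l (ρ m) = if l = m then 1 else 0)
    {y : X} (hy : y ∈ i ⁻¹ᵁ (chart k 5 j).1) [IsIntegrallyClosed (X.presheaf.stalk y)]
    (hdim : ringKrullDim (X.presheaf.stalk y) ≤ 1)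
    (hunit : aeval ρ (paramCoord P δ e N b j) / (2 * aeval ρ N) ∈ localRing π y) :
    (aeval ρ N)⁻¹ • exteriorPower.ιMulti (FunField π) 3
      (fun m => KaehlerDifferential.D k (FunField π) (ρ m)) ∈ regularForms 3 (localRing π y) := by
  have : CharZero (FunField π) :=
    charZero_of_injective_algebraMap (algebraMap k (FunField π)).injective
  have hP : P * S = 1 := mul_eq_one_comm.mp hS
  have hN : aeval ρ N ≠ 0 := aeval_ne_zero_of_not_dvd hρ h.not_dvd
  have hF : aeval ρ (paramCoord P δ e N b j) ≠ 0 := aeval_ne_zero_of_not_dvd hρ hj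
  have hr : ρ 0 ≠ 0 := hρ.ne_zero 0
  obtain ⟨I, hI, hle, hR⟩ := exists_isFractionsAt hi j hy
  have hker := aeval_coord_eq_zero_iff hi j
  obtain ⟨hprin, -⟩ := isPrincipal_localRing π hdim hR fun p hp => hle ((hker p).mp hp)
  let R := localRing π y
  let x : Fin 6 → R := fun l => ⟨coord i j π l, by
    have h1 := hR.aeval_mem (MvPolynomial.X l)
    rwa [aeval_X] at h1⟩
  let c : R := ⟨_, hunit⟩
  -- The coordinates of the point in the normal form, scaled to `u₀ = 1`.
  let u : Fin 6 → R := c • (S.map (algebraMap k R) *ᵥ x)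
  have hcoord : (coord i j π) = (2 * aeval ρ N / aeval ρ (paramCoord P δ e N b j)) •
      (P.map (algebraMap k _) *ᵥ affinePoint (aeval ρ) δ e N b) := by
    ext l
    rw [hξ, paramCoord_eq hN, Pi.smul_apply, smul_eq_mul]
    ring
  have hu : ∀ l, (u l : FunField π) = affinePoint (aeval ρ) δ e N b l := by
    intro l
    have h1 : (((S.map (algebraMap k R) *ᵥ x) l : R) : FunField π) =
        (S.map (algebraMap k _) *ᵥ coord i j π) l := algHom_mulVec R.val S x l
    change (c : FunField π) * (((S.map (algebraMap k R) *ᵥ x) l : R) : FunField π) = _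
    rw [h1, hcoord, mulVec_smul, mulVec_mulVec, ← Matrix.map_mul, hS,
      Matrix.map_one _ (map_zero _) (map_one _), one_mulVec, Pi.smul_apply, smul_eq_mul,
      ← mul_assoc]
    change aeval ρ (paramCoord P δ e N b j) / (2 * aeval ρ N) * _ * _ = _
    rw [div_mul_div_cancel₀ (mul_ne_zero two_ne_zero hN), div_self hF, one_mul]
  refine h.smul_mem_regularForms hd hfrac hr hN u hu fun a c' hac => ?_
  have htr : Algebra.trdeg k R ≤ (3 : ℕ) := by
    have h1 := trdeg_le_of_injective R.val Subtype.val_injective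
    rwa [trdeg_eq_of_fractions hρ hfrac] at h1
  refine hR.jacobian hle hker hA' hB' x (fun _ => rfl) (m := 3) rfl htr hprin ?_
  have hu0 : u 0 = 1 := Subtype.ext ((hu 0).trans
    ((affinePoint_apply hN (by decide)).trans (by simp [conePoint])))
  have hc0 : residue R c ≠ 0 := by
    intro h0
    have h1 : residue R (c * (S.map (algebraMap k R) *ᵥ x) 0) = 1 := by
      rw [show c * (S.map (algebraMap k R) *ᵥ x) 0 = u 0 from rfl, hu0, map_one]
    rw [map_mul, h0, zero_mul] at h1
    exact zero_ne_one h1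
  let T := fun M : Matrix (Fin 6) (Fin 6) k => M.map (algebraMap k (ResidueField R))
  have hT : ∀ M M', T (M * M') = T M * T M' := fun M M' => Matrix.map_mul
  have hT1 : T 1 = 1 := Matrix.map_one _ (map_zero _) (map_one _)
  let res : R →ₐ[k] ResidueField R := IsScalarTower.toAlgHom k R _
  have hxu : T P *ᵥ (fun l => residue R (u l)) = residue R c • fun l => residue R (x l) := by
    have h1 : (fun l => residue R (u l)) = residue R c • (T S *ᵥ fun l => residue R (x l)) := by
      ext l
      exact (map_mul (residue R) c _).trans
        (congrArg (residue R c * ·) (algHom_mulVec res S x l))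
    rw [h1, mulVec_smul, mulVec_mulVec, ← hT, hP, hT1, one_mulVec]
  have hinj : ∀ v, T Pᵀ *ᵥ v = 0 → v = 0 := by
    intro v hv
    have h1 := congrArg (fun v => T Sᵀ *ᵥ v) hv
    simp only [mulVec_mulVec, mulVec_zero] at h1
    rwa [← hT, ← transpose_mul, hP, transpose_one, hT1, one_mulVec] at h1
  -- A relation between the differentials in the coordinates `u` is one in the coordinates `x`.
  have hac' : T Pᵀ *ᵥ (residue R c • (a • T A' *ᵥ (fun l => residue R (x l)) +
      c' • T B' *ᵥ (fun l => residue R (x l)))) = 0 := by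
    rw [← hac, ← hA, ← hB]
    change _ = a • T (Pᵀ * A' * P) *ᵥ _ + c' • T (Pᵀ * B' * P) *ᵥ _
    rw [hT, hT, hT, hT, ← mulVec_mulVec, ← mulVec_mulVec, ← mulVec_mulVec, ← mulVec_mulVec, hxu,
      mulVec_smul, mulVec_smul, mulVec_smul, mulVec_smul, mulVec_smul, mulVec_add, mulVec_smul,
      mulVec_smul, smul_add, smul_comm a, smul_comm c']
  exact (smul_eq_zero.mp (hinj _ hac')).resolve_left hc0

omit h hj in
include hS hA hB hA' hB' in
/-- The divisor `X₀ = 0` in the parametrization is exceptional of discrepancy at most zero over the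
intersection of the quadrics. -/
theorem IsNormalPencil.not_isTerminal (hB0 : IsNormalPencil B δ e)
    (hi : IsIntersectionOfQuadrics π A' B' i)
    (hnormal : ∀ x : X, IsIntegrallyClosed (X.presheaf.stalk x)) : ¬ IsTerminal π 3 := by
  intro hterm
  obtain ⟨N, b, h⟩ := hB0.exists_isParam
  obtain ⟨j, hj⟩ := h.exists_not_dvd_paramCoord hS
  let L := FractionRing (MvPolynomial (Fin 3) k)
  have : CharZero L := charZero_of_injective_algebraMap (algebraMap k L).injective
  let θ : MvPolynomial (Fin 3) k →ₐ[k] L := IsScalarTower.toAlgHom k _ L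
  have hθ : Function.Injective θ := IsFractionRing.injective (MvPolynomial (Fin 3) k) L
  have hne : ∀ {q : MvPolynomial (Fin 3) k}, ¬ MvPolynomial.X 0 ∣ q → θ q ≠ 0 := fun {q} hq h0 =>
    hq ((injective_iff_map_eq_zero _).mp hθ q h0 ▸ dvd_zero _)
  have hchart : Nonempty (i ⁻¹ᵁ (chart k 5 j).1) := nonempty_preimage_chart hi j
    (aeval (R := k) fun l => θ (paramCoord P δ e N b l) / θ (paramCoord P δ e N b j)).toRingHom
    (h.aeval_paramCoord hA hB (hne h.not_dvd) (hne hj))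
  have hker := aeval_coord_eq_zero_iff hi j
  obtain ⟨ρ, hρ, hfrac, hξ⟩ := h.exists_parameters hS hA hB hj hker
    (exists_eq_aeval_coord_div hi j) fun I hI hle => by
      obtain ⟨x, -, hx⟩ := exists_point_isFractionsAt hi j I hle
      exact ⟨_, hx⟩
  have : CharZero (FunField π) :=
    charZero_of_injective_algebraMap (algebraMap k (FunField π)).injective
  let F := paramCoord P δ e N b
  have hFj : aeval ρ (F j) ≠ 0 := aeval_ne_zero_of_not_dvd hρ hj
  have hN : aeval ρ N ≠ 0 := aeval_ne_zero_of_not_dvd hρ h.not_dvd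
  let V := divisorRing hρ
  let v : Fin 6 → V := fun l => ⟨coord i j π l, F l, F j, hj, hξ l⟩
  have hv : ∀ l, (v l : FunField π) = coord i j π l := fun _ => rfl
  have hvp : ∀ p : MvPolynomial (Fin 6) k, ((aeval v p : V) : FunField π) = aeval (coord i j π) p :=
    fun p => comp_aeval_apply v V.val p
  -- The centre `x` of `V`, as a prime ideal of the polynomial ring.
  let I : Ideal (MvPolynomial (Fin 6) k) := (IsLocalRing.maximalIdeal V).comap (aeval (R := k) v)
  have hI : I.IsPrime := Ideal.comap_isPrime _ _
  have hle : chartIdeal A' B' j ≤ I := by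
    intro p hp
    have h1 : aeval v p = 0 := Subtype.ext ((hvp p).trans ((hker p).mpr hp))
    rw [Ideal.mem_comap, h1]
    exact zero_mem _
  obtain ⟨x, hx, hR⟩ := exists_point_isFractionsAt hi j I hle
  have hdom : Dominates V (localRing π x) := hR.dominates hv
  have hdim : 2 ≤ ringKrullDim (X.presheaf.stalk x) := by
    by_contra hlt
    have hle1 : ringKrullDim (X.presheaf.stalk x) ≤ 1 :=
      Order.le_of_lt_succ (not_le.mp hlt)
    obtain ⟨-, hval⟩ := isPrincipal_localRing π hle1 hR fun p hp => hle ((hker p).mp hp)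
    -- By normality the local ring at `x` is a valuation ring, so it is equal to `V`.
    have heq : localRing π x = V := by
      refine le_antisymm hdom.1 (hdom.le_of_valuationRing hval fun f => ?_)
      obtain ⟨p, q, hq, hf⟩ := exists_eq_aeval_coord_div hi j f
      exact ⟨_, hR.aeval_mem p, _, hR.aeval_mem q, hq, hf⟩
    rw [heq] at hR
    exact h.not_isFractionsAt_divisorRing hj hρ hfrac (y := v) hξ hR
  have hd : ∀ l : Fin 3, ∃ d : Derivation k (FunField π) (FunField π),
      ∀ m, d (ρ m) = if l = m then 1 else 0 := fun l =>
    exists_partialDerivative hρ hfrac fun m => if l = m then 1 else 0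
  choose d hd using hd
  -- The coordinate `u₀` is a unit at `x`, since it is a unit in `V`.
  have hunit : aeval ρ (F j) / (2 * aeval ρ N) ∈ localRing π x := by
    have h2N : ¬ MvPolynomial.X 0 ∣ (C 2 * N : MvPolynomial (Fin 3) k) := fun hdvd => h.not_dvd
      ((IsUnit.dvd_mul_left ((isUnit_iff_ne_zero.mpr two_ne_zero).map C)).mp hdvd)
    have hC2 : aeval ρ (C 2 * N : MvPolynomial (Fin 3) k) = 2 * aeval ρ N := by
      rw [map_mul, aeval_C, map_ofNat]
    have h1 : 2 * aeval ρ N / aeval ρ (F j) ∈ localRing π x := by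
      have h2 : (S.map (algebraMap k _) *ᵥ coord i j π) 0 = 2 * aeval ρ N / aeval ρ (F j) := by
        have hcoord : (coord i j π) = (2 * aeval ρ N / aeval ρ (F j)) •
            (P.map (algebraMap k _) *ᵥ affinePoint (aeval ρ) δ e N b) := by
          ext l
          rw [hξ, paramCoord_eq hN, Pi.smul_apply, smul_eq_mul]
          ring
        rw [hcoord, mulVec_smul, mulVec_mulVec, ← Matrix.map_mul, hS,
          Matrix.map_one _ (map_zero _) (map_one _), one_mulVec, Pi.smul_apply,
          affinePoint_apply hN (by decide)]
        simp [conePoint]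
      rw [← h2]
      simp only [mulVec, dotProduct, map_apply]
      refine sum_mem fun l _ => mul_mem ((localRing π x).algebraMap_mem _) ?_
      have h3 := hR.aeval_mem (MvPolynomial.X l)
      rwa [aeval_X] at h3
    have h2 := hdom.2 _ h1 (by
      rw [inv_div, ← hC2]
      exact ⟨F j, C 2 * N, h2N, rfl⟩)
    rwa [inv_div] at h2
  let ω := (aeval ρ N)⁻¹ • exteriorPower.ιMulti (FunField π) 3
      (fun m => KaehlerDifferential.D k (FunField π) (ρ m))
  have hω : ω ∈ canonicalStalk π 3 x := by
    intro y hyx hydim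
    have := hnormal y
    exact h.smul_mem_regularForms_localRing hS hA hB hA' hB' hj hi hρ hfrac hξ hd
      (hyx.mem_open (i ⁻¹ᵁ (chart k 5 j).1).2 hx) hydim (localRing_le_of_specializes π hyx hunit)
  have hV : IsDivisorial V := isDivisorial_divisorRing hρ hfrac
  refine not_vanishesAlong hV hd
    (fun l f hf => derivation_mem_divisorRing hρ (d l) (fun m => ?_) hf)
    ?_ (inv_ne_zero hN) (hterm V hV x hdom hdim ω hω)
  · rw [hd]
    split_ifs
    exacts [one_mem _, zero_mem _]
  · rw [inv_inv]
    exact aeval_mem_divisorRing hρ N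

end Discrepancy

end

/-! ### Normal forms of pencils -/

section

open Matrix

section LinearAlgebra
variable {k : Type u} [Field k]

theorem finrank_ker_mulVecLin_add_rank {n : ℕ} (A : Matrix (Fin n) (Fin n) k) :
    Module.finrank k (LinearMap.ker A.mulVecLin) + A.rank = n := by
  rw [add_comm, Matrix.rank, LinearMap.finrank_range_add_finrank_ker,
    Module.finrank_fintype_fun_eq_card, Fintype.card_fin]

theorem dotProduct_mulVec_comm {n : ℕ} {A : Matrix (Fin n) (Fin n) k} (hA : A.IsSymm)
    (v w : Fin n → k) : v ⬝ᵥ A *ᵥ w = w ⬝ᵥ A *ᵥ v := by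
  rw [dotProduct_mulVec, ← mulVec_transpose, hA.eq, dotProduct_comm]

theorem exists_orthogonal [CharZero k] {n : ℕ} {A : Matrix (Fin n) (Fin n) k} (hA : A.IsSymm) :
    ∃ x : Module.Basis (Fin n) k (Fin n → k), ∀ a b, a ≠ b → x a ⬝ᵥ A *ᵥ x b = 0 := by
  have : Invertible (2 : k) := invertibleOfNonzero two_ne_zero
  have hs : (Matrix.toBilin' A).IsSymm := by
    refine ⟨fun v w => ?_⟩
    rw [Matrix.toBilin'_apply', Matrix.toBilin'_apply']
    exact dotProduct_mulVec_comm hA v w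
  obtain ⟨x, hx⟩ := LinearMap.BilinForm.exists_orthogonal_basis (B := Matrix.toBilin' A) ⟨hs.eq⟩
  let e := finCongr (Module.finrank_fin_fun k (n := n))
  refine ⟨x.reindex e, fun a b hab => ?_⟩
  have h1 := hx (i := e.symm a) (j := e.symm b) (fun h => hab (e.symm.injective h))
  rw [Module.Basis.reindex_apply, Module.Basis.reindex_apply]
  rw [← Matrix.toBilin'_apply']
  exact h1

theorem exists_orthonormal [CharZero k] [IsAlgClosed k] {n r : ℕ} {A : Matrix (Fin n) (Fin n) k}
    (hA : A.IsSymm) (hr : r ≤ A.rank) :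
    ∃ y : Fin r → Fin n → k, ∀ a b, y a ⬝ᵥ A *ᵥ y b = if a = b then 1 else 0 := by
  classical
  obtain ⟨x, hx⟩ := exists_orthogonal hA
  let Z := {a : Fin n // x a ⬝ᵥ A *ᵥ x a = 0}
  let Y := {a : Fin n // ¬ x a ⬝ᵥ A *ᵥ x a = 0}
  have hker : ∀ a : Z, x a ∈ LinearMap.ker A.mulVecLin := by
    intro a
    rw [LinearMap.mem_ker, mulVecLin_apply]
    refine dotProduct_eq_zero _ fun w => ?_
    rw [dotProduct_comm, ← x.sum_repr w, sum_dotProduct]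
    refine Finset.sum_eq_zero fun b _ => ?_
    rw [smul_dotProduct]
    by_cases hb : b = a
    · rw [hb, a.2, smul_zero]
    · rw [hx _ _ hb, smul_zero]
  have hcard : Fintype.card Z ≤ Module.finrank k (LinearMap.ker A.mulVecLin) := by
    have hli : LinearIndependent k fun a : Z => (⟨x a, hker a⟩ : LinearMap.ker A.mulVecLin) := by
      refine LinearIndependent.of_comp (LinearMap.ker A.mulVecLin).subtype ?_
      exact x.linearIndependent.comp _ Subtype.val_injective
    exact hli.fintype_card_le_finrank
  have h1 := finrank_ker_mulVecLin_add_rank A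
  have h2 : Fintype.card Z + Fintype.card Y = n := by
    have h3 := Fintype.card_congr (Equiv.sumCompl fun a : Fin n => x a ⬝ᵥ A *ᵥ x a = 0)
    rwa [Fintype.card_sum, Fintype.card_fin] at h3
  obtain ⟨f⟩ : Nonempty (Fin r ↪ Y) := Function.Embedding.nonempty_of_card_le (by
    rw [Fintype.card_fin]
    omega)
  have hs : ∀ a : Y, ∃ s : k, s * s * (x a ⬝ᵥ A *ᵥ x a) = 1 := by
    intro a
    obtain ⟨s, hs⟩ := IsAlgClosed.exists_eq_mul_self (x a ⬝ᵥ A *ᵥ x a)⁻¹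
    exact ⟨s, by rw [← hs, inv_mul_cancel₀ a.2]⟩
  choose s hs using hs
  refine ⟨fun a => s (f a) • x (f a), fun a b => ?_⟩
  rw [mulVec_smul, dotProduct_smul, smul_dotProduct, smul_eq_mul, smul_eq_mul]
  split_ifs with hab
  · subst hab
    rw [← mul_assoc]
    exact hs _
  · rw [hx _ _ fun h => hab (f.injective (Subtype.ext h)), mul_zero, mul_zero]

theorem exists_isotropic [CharZero k] [IsAlgClosed k] {n : ℕ} {B : Matrix (Fin n) (Fin n) k}
    (hB : B.IsSymm) (p q : Fin n → k) :
    ∃ c d : k, (c ≠ 0 ∨ d ≠ 0) ∧ (c • p + d • q) ⬝ᵥ B *ᵥ (c • p + d • q) = 0 := by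
  have h : ∀ c d : k, (c • p + d • q) ⬝ᵥ B *ᵥ (c • p + d • q) =
      c ^ 2 * (p ⬝ᵥ B *ᵥ p) + 2 * c * d * (p ⬝ᵥ B *ᵥ q) + d ^ 2 * (q ⬝ᵥ B *ᵥ q) := by
    intro c d
    simp only [mulVec_add, mulVec_smul, add_dotProduct, dotProduct_add, smul_dotProduct,
      dotProduct_smul, smul_eq_mul, dotProduct_mulVec_comm hB q p]
    ring
  simp only [h]
  by_cases hp : p ⬝ᵥ B *ᵥ p = 0
  · exact ⟨1, 0, Or.inl one_ne_zero, by rw [hp]; ring⟩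
  · obtain ⟨s, hs⟩ := IsAlgClosed.exists_eq_mul_self
      ((p ⬝ᵥ B *ᵥ q) ^ 2 - (p ⬝ᵥ B *ᵥ p) * (q ⬝ᵥ B *ᵥ q))
    refine ⟨(s - p ⬝ᵥ B *ᵥ q) / (p ⬝ᵥ B *ᵥ p), 1, Or.inr one_ne_zero, ?_⟩
    field_simp
    linear_combination -hs

/-- Vectors with the Gram matrix of the normal form, together with a basis of the kernel, are a
basis. -/
theorem exists_inverse_of_gram [CharZero k] {A : Matrix (Fin 6) (Fin 6) k} {δ : k}
    {v : Fin 6 → Fin 6 → k}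
    (hgram : ∀ a b, v a ⬝ᵥ A *ᵥ v b = coneMatrix δ a b)
    (hli : (δ ≠ 0 ∧ LinearIndependent k ![v 1, v 0]) ∨ LinearIndependent k ![v 5, v 1, v 0]) :
    ∃ P S : Matrix (Fin 6) (Fin 6) k, S * P = 1 ∧ Pᵀ * A * P = coneMatrix δ ∧
      ∀ (B : Matrix (Fin 6) (Fin 6) k) a b, (Pᵀ * B * P) a b = v a ⬝ᵥ B *ᵥ v b := by
  have hv : LinearIndependent k v := by
    rw [Fintype.linearIndependent_iff]
    intro g hg
    have h1 : ∀ b, ∑ a, g a * coneMatrix δ a b = 0 := by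
      intro b
      have h2 := congrArg (fun w => w ⬝ᵥ A *ᵥ v b) hg
      simp only [sum_dotProduct, smul_dotProduct, hgram, zero_dotProduct, smul_eq_mul] at h2
      exact h2
    have h2 : g 2 = 0 := by simpa [coneMatrix, Fin.sum_univ_six] using h1 3
    have h3 : g 3 = 0 := by simpa [coneMatrix, Fin.sum_univ_six] using h1 2
    have h4 : g 4 = 0 := by simpa [coneMatrix, Fin.sum_univ_six] using h1 4
    rw [Fin.sum_univ_six, h2, h3, h4] at hg
    have h015 : g 0 = 0 ∧ g 1 = 0 ∧ g 5 = 0 := by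
      rcases hli with ⟨hδ, hli⟩ | hli
      · have h5 : g 5 = 0 := by simpa [coneMatrix, Fin.sum_univ_six, hδ] using h1 5
        rw [Fintype.linearIndependent_iff] at hli
        have h6 := hli ![g 1, g 0] (by
          rw [← hg]
          simp only [h5, Fin.sum_univ_two, zero_smul, add_zero]
          exact add_comm _ _)
        exact ⟨h6 1, h6 0, h5⟩
      · rw [Fintype.linearIndependent_iff] at hli
        have h6 := hli ![g 5, g 1, g 0] (by
          rw [← hg]
          simp only [Fin.sum_univ_three, zero_smul, add_zero]
          change g 5 • v 5 + g 1 • v 1 + g 0 • v 0 = _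
          abel)
        exact ⟨h6 2, h6 1, h6 0⟩
    intro a
    fin_cases a
    exacts [h015.1, h015.2.1, h2, h3, h4, h015.2.2]
  have hu : IsUnit (Matrix.of v) := linearIndependent_rows_iff_isUnit.mp hv
  have hPB : ∀ (B : Matrix (Fin 6) (Fin 6) k) a b,
      ((Matrix.of v)ᵀᵀ * B * (Matrix.of v)ᵀ) a b = v a ⬝ᵥ B *ᵥ v b := by
    intro B a b
    rw [Matrix.mul_assoc]
    rfl
  refine ⟨(Matrix.of v)ᵀ, (Matrix.of v)ᵀ⁻¹, ?_, ?_, hPB⟩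
  · exact Matrix.nonsing_inv_mul _ ((isUnit_iff_isUnit_det _).mp ((isUnit_transpose _).mpr hu))
  · ext a b
    rw [hPB, hgram]

theorem exists_mem_notMem_span {V : Type*} [AddCommGroup V] [Module k V] {m : ℕ}
    {W : Submodule k V} (h : m < Module.finrank k W) (s : Fin m → V) :
    ∃ w ∈ W, w ∉ Submodule.span k (Set.range s) := by
  by_contra! hc
  have := FiniteDimensional.span_of_finite k (Set.finite_range s)
  have h1 := Submodule.finrank_mono (show W ≤ Submodule.span k (Set.range s) from hc)
  have h2 := finrank_range_le_card (R := k) s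
  rw [Fintype.card_fin, Set.finrank] at h2
  omega

theorem exists_isotropic_notMem_span [CharZero k] [IsAlgClosed k] {n m : ℕ}
    {B : Matrix (Fin n) (Fin n) k} (hB : B.IsSymm) {W : Submodule k (Fin n → k)}
    (h : m + 1 < Module.finrank k W) (s : Fin m → Fin n → k) :
    ∃ w ∈ W, w ∉ Submodule.span k (Set.range s) ∧ w ⬝ᵥ B *ᵥ w = 0 := by
  obtain ⟨p, hpW, hp⟩ := exists_mem_notMem_span (by omega : m < Module.finrank k W) s
  obtain ⟨q, hqW, hq⟩ := exists_mem_notMem_span h (Fin.cons p s : Fin (m + 1) → Fin n → k)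
  obtain ⟨c, d, hcd, h0⟩ := exists_isotropic hB p q
  refine ⟨_, W.add_mem (W.smul_mem c hpW) (W.smul_mem d hqW), fun hmem => ?_, h0⟩
  rw [Fin.range_cons] at hq
  by_cases hd : d = 0
  · rw [hd, zero_smul, add_zero] at hmem
    exact hp ((Submodule.smul_mem_iff _ (hcd.resolve_right (not_not.mpr hd))).mp hmem)
  · refine hq ((Submodule.smul_mem_iff _ hd).mp ?_)
    have h1 : d • q = (c • p + d • q) - c • p := by abel
    rw [h1]
    exact Submodule.sub_mem _ (Submodule.span_mono (Set.subset_insert _ _) hmem)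
      (Submodule.smul_mem _ _ (Submodule.subset_span (Set.mem_insert _ _)))

/-- Three orthonormal vectors span a space in which the quadratic form reads `2 (x y - z²)`. -/
theorem exists_conic_gram [CharZero k] [IsAlgClosed k] {n : ℕ} {A : Matrix (Fin n) (Fin n) k}
    {y : Fin 3 → Fin n → k} (hy : ∀ a b, y a ⬝ᵥ A *ᵥ y b = if a = b then 1 else 0) :
    ∃ z : Fin 3 → Fin n → k, (∀ a b, z a ⬝ᵥ A *ᵥ z b = !![0, 1, 0; 1, 0, 0; 0, 0, -2] a b) ∧
      ∀ w, (∀ a, y a ⬝ᵥ A *ᵥ w = 0) → ∀ a, z a ⬝ᵥ A *ᵥ w = 0 := by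
  obtain ⟨ι, hι⟩ := IsAlgClosed.exists_eq_mul_self (-1 : k)
  obtain ⟨s, hs⟩ := IsAlgClosed.exists_eq_mul_self (-2 : k)
  refine ⟨![(2⁻¹ : k) • (y 0 + ι • y 1), y 0 - ι • y 1, s • y 2], ?_, ?_⟩
  · intro a b
    fin_cases a <;> fin_cases b <;>
      simp [mulVec_add, mulVec_sub, mulVec_smul, hy, ← hι, ← hs] <;> norm_num
    · linear_combination (-1 / 4) * hι
    · linear_combination (1 / 2) * hι
  · intro w hw a
    fin_cases a <;> simp [hw]

/-- The Gram matrix of two kernel vectors together with vectors `z` spanning a conic and a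
vector orthogonal to them. -/
theorem coneMatrix_gram {A : Matrix (Fin 6) (Fin 6) k} (hA : A.IsSymm) {v0 v1 v5 : Fin 6 → k}
    {z : Fin 3 → Fin 6 → k} {δ : k} (h0 : A *ᵥ v0 = 0) (h1 : A *ᵥ v1 = 0)
    (hz : ∀ a b, z a ⬝ᵥ A *ᵥ z b = !![0, 1, 0; 1, 0, 0; 0, 0, -2] a b)
    (h5 : ∀ a, z a ⬝ᵥ A *ᵥ v5 = 0) (h55 : v5 ⬝ᵥ A *ᵥ v5 = -2 * δ) (a b : Fin 6) :
    ![v0, v1, z 0, z 1, z 2, v5] a ⬝ᵥ A *ᵥ ![v0, v1, z 0, z 1, z 2, v5] b =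
      coneMatrix δ a b := by
  have h0' : ∀ w, v0 ⬝ᵥ A *ᵥ w = 0 := fun w => by
    rw [dotProduct_mulVec_comm hA, h0, dotProduct_zero]
  have h1' : ∀ w, v1 ⬝ᵥ A *ᵥ w = 0 := fun w => by
    rw [dotProduct_mulVec_comm hA, h1, dotProduct_zero]
  have h5' : ∀ a, v5 ⬝ᵥ A *ᵥ z a = 0 := fun a => by
    rw [dotProduct_mulVec_comm hA, h5]
  fin_cases a <;> fin_cases b <;> simp [coneMatrix, h0, h1, h0', h1', h5, h5', h55, hz]

/-- A pencil whose member `A` has corank two with the vertex on `B`, or corank three, can be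
brought into normal form. -/
theorem exists_isNormalPencil [CharZero k] [IsAlgClosed k] {A B : Matrix (Fin 6) (Fin 6) k}
    (hA : A.IsSymm) (hB : B.IsSymm) (hdet : B.det ≠ 0)
    (h : A.rank = 3 ∨ A.rank = 4 ∧ ∀ v w, A *ᵥ v = 0 → A *ᵥ w = 0 → v ⬝ᵥ B *ᵥ w = 0) :
    ∃ (P S : Matrix (Fin 6) (Fin 6) k) (δ : k) (e : ℕ), S * P = 1 ∧
      Pᵀ * A * P = coneMatrix δ ∧ IsNormalPencil (Pᵀ * B * P) δ e := by
  have hfin := finrank_ker_mulVecLin_add_rank A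
  have hmem : ∀ {w}, w ∈ LinearMap.ker A.mulVecLin → A *ᵥ w = 0 := fun hw => hw
  have hsymm : ∀ P : Matrix (Fin 6) (Fin 6) k, (Pᵀ * B * P).IsSymm := fun P => by
    rw [Matrix.IsSymm, transpose_mul, transpose_mul, transpose_transpose, hB.eq, Matrix.mul_assoc]
  have hdet' : ∀ P S : Matrix (Fin 6) (Fin 6) k, S * P = 1 → (Pᵀ * B * P).det ≠ 0 := by
    intro P S hS
    have h1 : P.det ≠ 0 := by
      have := congrArg det hS
      rw [det_mul, det_one] at this
      exact right_ne_zero_of_mul_eq_one this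
    rw [det_mul, det_mul, det_transpose]
    exact mul_ne_zero (mul_ne_zero h1 hdet) h1
  rcases h with h3 | ⟨h4, hW⟩
  · obtain ⟨y, hy⟩ := exists_orthonormal hA h3.ge
    obtain ⟨z, hz, -⟩ := exists_conic_gram hy
    -- Either some isotropic vector of the kernel is not orthogonal to the kernel, which gives the
    -- normal form with `e = 0`, or the isotropic vectors span an isotropic subspace of dimension at
    -- least two, which gives the one with `e = 1`.
    by_cases hC : ∃ v0 v1, A *ᵥ v0 = 0 ∧ A *ᵥ v1 = 0 ∧ v1 ⬝ᵥ B *ᵥ v1 = 0 ∧ v1 ⬝ᵥ B *ᵥ v0 ≠ 0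
    · obtain ⟨v0, v1, h0, h1, h11, h10⟩ := hC
      obtain ⟨q, hqW, hq⟩ := exists_mem_notMem_span
        (by omega : 2 < Module.finrank k (LinearMap.ker A.mulVecLin)) ![v1, v0]
      -- Subtracting a multiple of `v0` makes a vector orthogonal to `v1`.
      have hadj : ∀ w, v1 ⬝ᵥ B *ᵥ (w - ((v1 ⬝ᵥ B *ᵥ w) / (v1 ⬝ᵥ B *ᵥ v0)) • v0) = 0 := by
        intro w
        rw [mulVec_sub, mulVec_smul, dotProduct_sub, dotProduct_smul, smul_eq_mul,
          div_mul_cancel₀ _ h10, sub_self]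
      generalize hv5 : q - ((v1 ⬝ᵥ B *ᵥ q) / (v1 ⬝ᵥ B *ᵥ v0)) • v0 = v5
      have hA5 : A *ᵥ v5 = 0 := by
        rw [← hv5, mulVec_sub, mulVec_smul, h0, hmem hqW, smul_zero, sub_zero]
      let z' : Fin 3 → Fin 6 → k := fun a => z a - ((v1 ⬝ᵥ B *ᵥ z a) / (v1 ⬝ᵥ B *ᵥ v0)) • v0
      have hz' : ∀ a b, z' a ⬝ᵥ A *ᵥ z' b = !![0, 1, 0; 1, 0, 0; 0, 0, -2] a b := by
        intro a b
        rw [← hz]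
        simp only [z', mulVec_sub, mulVec_smul, h0, smul_zero, sub_zero, sub_dotProduct,
          smul_dotProduct, dotProduct_mulVec_comm hA v0, dotProduct_zero]
      have hgram := coneMatrix_gram (δ := 0) hA h0 h1 hz' (v5 := v5)
        (fun a => by rw [hA5, dotProduct_zero]) (by rw [hA5, dotProduct_zero, mul_zero])
      have hli : LinearIndependent k ![v5, v1, v0] := by
        refine linearIndependent_finCons.mpr ⟨?_, fun hmem5 => hq ?_⟩
        · rw [LinearIndependent.pair_iff]
          intro c d hcd
          have h2 := congrArg (fun w => v1 ⬝ᵥ B *ᵥ w) hcd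
          rw [mulVec_add, mulVec_smul, mulVec_smul, dotProduct_add, dotProduct_smul,
            dotProduct_smul, h11, smul_zero, zero_add, mulVec_zero, dotProduct_zero, smul_eq_mul,
            mul_eq_zero, or_iff_left h10] at h2
          have hv1 : v1 ≠ 0 := fun hv1 => h10 (by rw [hv1, zero_dotProduct])
          rw [h2, zero_smul, add_zero, smul_eq_zero] at hcd
          exact ⟨hcd.resolve_right hv1, h2⟩
        · rw [← sub_add_cancel q (((v1 ⬝ᵥ B *ᵥ q) / (v1 ⬝ᵥ B *ᵥ v0)) • v0), hv5]
          exact Submodule.add_mem _ hmem5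
            (Submodule.smul_mem _ _ (Submodule.subset_span ⟨1, rfl⟩))
      obtain ⟨P, S, hS, hPA, hPB⟩ := exists_inverse_of_gram hgram (Or.inr hli)
      refine ⟨P, S, 0, 0, hS, hPA, hsymm P, hdet' P S hS, ?_, Or.inr ⟨rfl, rfl, ?_⟩⟩
      · rw [hPB]
        exact h11
      · simp only [hPB]
        refine ⟨hadj _, hadj _, hadj _, ?_⟩
        change v1 ⬝ᵥ B *ᵥ v5 = 0
        rw [← hv5]
        exact hadj q
    · push Not at hC
      obtain ⟨v1, hv1W, hv1, h11⟩ := exists_isotropic_notMem_span hB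
        (by omega : 0 + 1 < Module.finrank k (LinearMap.ker A.mulVecLin)) ![]
      obtain ⟨v0, hv0W, hv0, h00⟩ := exists_isotropic_notMem_span hB
        (by omega : 1 + 1 < Module.finrank k (LinearMap.ker A.mulVecLin)) ![v1]
      obtain ⟨v5, hv5W, hv5⟩ := exists_mem_notMem_span
        (by omega : 2 < Module.finrank k (LinearMap.ker A.mulVecLin)) ![v0, v1]
      have h10 := hC v0 v1 hv0W hv1W h11
      have hgram := coneMatrix_gram (δ := 0) hA (hmem hv1W) (hmem hv0W) hz (v5 := v5)
        (fun a => by rw [hmem hv5W, dotProduct_zero]) (by rw [hmem hv5W, dotProduct_zero, mul_zero])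
      have hli : LinearIndependent k ![v5, v0, v1] :=
        linearIndependent_finCons.mpr ⟨linearIndependent_finCons.mpr
          ⟨linearIndependent_finCons.mpr ⟨linearIndependent_empty_type, hv1⟩, hv0⟩, hv5⟩
      obtain ⟨P, S, hS, hPA, hPB⟩ := exists_inverse_of_gram hgram (Or.inr hli)
      refine ⟨P, S, 0, 1, hS, hPA, hsymm P, hdet' P S hS, ?_, Or.inl ⟨rfl, ?_, ?_⟩⟩
      · rw [hPB]
        exact h00
      · rw [hPB]
        exact h11
      · rw [hPB, dotProduct_mulVec_comm hB]
        exact h10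
  · obtain ⟨y, hy⟩ := exists_orthonormal hA h4.ge
    obtain ⟨z, hz, hzy⟩ := exists_conic_gram (A := A) (y := fun a => y a.castSucc) fun a b => by
      simp only [hy, Fin.castSucc_inj]
    obtain ⟨s, hs⟩ := IsAlgClosed.exists_eq_mul_self (-2 : k)
    obtain ⟨v1, hv1W, hv1⟩ := exists_mem_notMem_span
      (by omega : 0 < Module.finrank k (LinearMap.ker A.mulVecLin)) ![]
    obtain ⟨v0, hv0W, hv0⟩ := exists_mem_notMem_span
      (by omega : 1 < Module.finrank k (LinearMap.ker A.mulVecLin)) ![v1]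
    have hgram := coneMatrix_gram (δ := 1) hA (hmem hv1W) (hmem hv0W) hz (v5 := s • y (Fin.last 3))
      (fun a => by
        rw [mulVec_smul, dotProduct_smul, hzy _ (fun b => ?_), smul_zero]
        rw [hy, if_neg (Fin.castSucc_lt_last b).ne])
      (by
        rw [mulVec_smul, dotProduct_smul, smul_dotProduct, hy, if_pos rfl, smul_eq_mul,
          smul_eq_mul, mul_one, mul_one, hs])
    have hli : LinearIndependent k ![v0, v1] :=
      linearIndependent_finCons.mpr
        ⟨linearIndependent_finCons.mpr ⟨linearIndependent_empty_type, hv1⟩, hv0⟩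
    obtain ⟨P, S, hS, hPA, hPB⟩ := exists_inverse_of_gram hgram (Or.inl ⟨one_ne_zero, hli⟩)
    refine ⟨P, S, 1, 1, hS, hPA, hsymm P, hdet' P S hS, ?_, Or.inl ⟨rfl, ?_, ?_⟩⟩
    · rw [hPB]
      exact hW _ _ hv0W hv0W
    · rw [hPB]
      exact hW _ _ hv1W hv1W
    · rw [hPB]
      exact hW _ _ hv0W hv1W

end LinearAlgebra

end

/-! ### Quadrics of rank at most two -/

section

open MvPolynomial Matrix

section RankTwo
variable {k : Type u} [Field k]

/-- A symmetric matrix of rank `r` is a sum of `r` squares of linear forms. -/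
theorem exists_eq_sum_vecMulVec [CharZero k] [IsAlgClosed k] {n : ℕ}
    {A : Matrix (Fin n) (Fin n) k} (hA : A.IsSymm) :
    ∃ u : Fin A.rank → Fin n → k, A = ∑ a, vecMulVec (u a) (u a) := by
  obtain ⟨y, hy⟩ := exists_orthonormal hA le_rfl
  let φ : (Fin n → k) →ₗ[k] (Fin A.rank → k) := (Matrix.of y * A).mulVecLin
  have hφ : ∀ v a, φ v a = y a ⬝ᵥ A *ᵥ v := fun v a => by
    change ((Matrix.of y * A) *ᵥ v) a = _
    rw [← mulVec_mulVec]
    rfl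
  have hsum : ∀ v : Fin A.rank → k, φ (∑ a, v a • y a) = v := by
    intro v
    ext b
    simp [hφ, mulVec_sum, mulVec_smul, dotProduct_sum, hy]
  have hker : LinearMap.ker A.mulVecLin = LinearMap.ker φ := by
    refine Submodule.eq_of_le_of_finrank_eq (fun v hv => ?_) ?_
    · rw [LinearMap.mem_ker, mulVecLin_apply] at hv
      ext a
      rw [hφ, hv, dotProduct_zero]
      rfl
    · have h1 := finrank_ker_mulVecLin_add_rank A
      have h2 := LinearMap.finrank_range_add_finrank_ker φ
      rw [LinearMap.range_eq_top.mpr fun v => ⟨_, hsum v⟩, finrank_top,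
        Module.finrank_fin_fun, Module.finrank_fin_fun] at h2
      omega
  refine ⟨fun a => A *ᵥ y a, Matrix.ext_of_mulVec_single fun c => ?_⟩
  generalize (Pi.single c 1 : Fin n → k) = v
  have h1 : v - ∑ a, φ v a • y a ∈ LinearMap.ker A.mulVecLin := by
    rw [hker, LinearMap.mem_ker, map_sub, hsum, sub_self]
  rw [LinearMap.mem_ker, mulVecLin_apply, mulVec_sub, sub_eq_zero] at h1
  rw [h1, mulVec_sum, Matrix.sum_mulVec]
  refine Finset.sum_congr rfl fun a _ => ?_
  rw [mulVec_smul, vecMulVec_mulVec, hφ, dotProduct_mulVec, ← mulVec_transpose, hA.eq]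
  ext b
  simp [mul_comm]

/-- A quadratic form of rank at most two is a product of two linear forms. -/
theorem exists_eq_vecMulVec_add_vecMulVec [CharZero k] [IsAlgClosed k] {n : ℕ}
    {A : Matrix (Fin n) (Fin n) k} (hA : A.IsSymm) (hr : A.rank ≤ 2) :
    ∃ l m : Fin n → k, A = (2⁻¹ : k) • (vecMulVec l m + vecMulVec m l) := by
  obtain ⟨u, hu⟩ := exists_eq_sum_vecMulVec hA
  obtain ⟨ι, hι⟩ := IsAlgClosed.exists_eq_mul_self (-1 : k)
  obtain ⟨p, q, hpq⟩ : ∃ p q : Fin n → k, A = vecMulVec p p + vecMulVec q q := by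
    generalize A.rank = r at u hr
    interval_cases r
    · exact ⟨0, 0, by simpa using hu⟩
    · exact ⟨u 0, 0, by simpa using hu⟩
    · exact ⟨u 0, u 1, by simpa using hu⟩
  refine ⟨p + ι • q, p - ι • q, ?_⟩
  rw [hpq]
  ext a b
  simp only [Matrix.add_apply, Matrix.smul_apply, vecMulVec_apply, Pi.add_apply, Pi.sub_apply,
    Pi.smul_apply, smul_eq_mul]
  linear_combination (-(q a * q b)) * hι

/-- A linear form `l` which is not a multiple of `m` does not vanish on the kernel of `m`; within
this kernel, the `j`-th coordinate can be made zero by a vector `v` in the kernel of both. -/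
theorem exists_dotProduct_ne_zero {n : ℕ} {l m v : Fin n → k} {j : Fin n} (hv : v j = 1)
    (hl : l ⬝ᵥ v = 0) (hm : m ⬝ᵥ v = 0) (hm0 : m ≠ 0) (hlm : ∀ c : k, l ≠ c • m) :
    ∃ w : Fin n → k, w j = 0 ∧ m ⬝ᵥ w = 0 ∧ l ⬝ᵥ w ≠ 0 := by
  obtain ⟨c, hc⟩ := Function.ne_iff.mp hm0
  obtain ⟨d, hd⟩ := Function.ne_iff.mp (hlm (l c / m c))
  let x : Fin n → k := m c • Pi.single d 1 - m d • Pi.single c 1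
  refine ⟨x - x j • v, by simp [hv], ?_, ?_⟩
  · rw [dotProduct_sub, dotProduct_smul, hm]
    simp [x, dotProduct_sub]
    ring
  · rw [dotProduct_sub, dotProduct_smul, hl]
    simp only [x, dotProduct_sub, dotProduct_smul, dotProduct_single, smul_eq_mul, mul_one,
      mul_zero, sub_zero, ne_eq]
    intro h
    refine hd ?_
    rw [Pi.smul_apply, smul_eq_mul, div_mul_eq_mul_div, eq_div_iff hc]
    linear_combination h

/-- Two linear forms and a quadratic form in six variables have common zeros outside any given
plane, since the linear forms leave a space of dimension four. -/
theorem exists_isotropic_apply_eq_one [CharZero k] [IsAlgClosed k] {B : Matrix (Fin 6) (Fin 6) k}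
    (hB : B.IsSymm) (l m : Fin 6 → k) (s : Fin 2 → Fin 6 → k) :
    ∃ (v : Fin 6 → k) (j : Fin 6), l ⬝ᵥ v = 0 ∧ m ⬝ᵥ v = 0 ∧
      v ∉ Submodule.span k (Set.range s) ∧ v ⬝ᵥ B *ᵥ v = 0 ∧ v j = 1 := by
  let W := LinearMap.ker (Matrix.of ![l, m]).mulVecLin
  have hW : ∀ {v}, v ∈ W → l ⬝ᵥ v = 0 ∧ m ⬝ᵥ v = 0 := fun hv =>
    ⟨congrFun hv 0, congrFun hv 1⟩
  have hfin : 2 + 1 < Module.finrank k W := by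
    have h1 := LinearMap.finrank_range_add_finrank_ker (Matrix.of ![l, m]).mulVecLin
    have h2 := Submodule.finrank_le (LinearMap.range (Matrix.of ![l, m]).mulVecLin)
    rw [Module.finrank_fin_fun] at h1 h2
    change 2 + 1 < Module.finrank k (LinearMap.ker _)
    omega
  obtain ⟨v, hvW, hvs, hvv⟩ := exists_isotropic_notMem_span hB hfin s
  obtain ⟨j, hj⟩ : ∃ j, v j ≠ 0 := Function.ne_iff.mp fun h : v = 0 => hvs (h ▸ zero_mem _)
  have hmem := W.smul_mem (v j)⁻¹ hvW
  refine ⟨(v j)⁻¹ • v, j, (hW hmem).1, (hW hmem).2,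
    fun h => hvs ((Submodule.smul_mem_iff _ (inv_ne_zero hj)).mp h), ?_, inv_mul_cancel₀ hj⟩
  rw [mulVec_smul, dotProduct_smul, smul_dotProduct, hvv, smul_zero, smul_zero]

end RankTwo

section Intersection
variable {k : Type u} [Field k] {X : Scheme.{u}} {n : ℕ} {π : X ⟶ Spec (.of k)}
  {Q₁ Q₂ A B : Matrix (Fin (n + 1)) (Fin (n + 1)) k} {i : X ⟶ projectiveSpace k n}

/-- The intersection of two quadrics only depends on the pencil they span. -/
theorem IsIntersectionOfQuadrics.of_pencil (hi : IsIntersectionOfQuadrics π Q₁ Q₂ i) {a : k}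
    (ha : a ≠ 0) (b : k) : IsIntersectionOfQuadrics π (a • Q₁ + b • Q₂) Q₂ i := by
  refine ⟨hi.comp_eq, hi.closedImmersion, fun j => ?_⟩
  have h1 : dehomogenize (a • Q₁ + b • Q₂) j =
      toChart j (C a) * dehomogenize Q₁ j + toChart j (C b) * dehomogenize Q₂ j := by
    simp only [← toChart_quadraticPoly, ← map_mul, ← map_add]
    congr 1
    simp only [quadraticPoly, Finset.mul_sum, ← Finset.sum_add_distrib]
    refine Finset.sum_congr rfl fun c _ => Finset.sum_congr rfl fun d _ => ?_
    simp only [Matrix.add_apply, Matrix.smul_apply, smul_eq_mul, C_add, C_mul]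
    ring
  have h2 : toChart j (C a⁻¹) * toChart j (C a) = 1 := by
    rw [← map_mul, ← C_mul, inv_mul_cancel₀ ha, C_1, map_one]
  rw [hi.ideal_eq, h1]
  apply le_antisymm <;> refine Ideal.span_le.mpr ?_ <;> rintro _ (rfl | rfl) <;>
    refine Ideal.mem_span_pair.mpr ?_
  · refine ⟨toChart j (C a⁻¹), -(toChart j (C a⁻¹) * toChart j (C b)), ?_⟩
    linear_combination dehomogenize Q₁ j * h2
  · exact ⟨0, 1, by ring⟩
  · exact ⟨_, _, rfl⟩
  · exact ⟨0, 1, by ring⟩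

theorem quadraticPoly_vecMulVec_add [CharZero k] (l m : Fin (n + 1) → k) :
    quadraticPoly ((2⁻¹ : k) • (vecMulVec l m + vecMulVec m l)) =
      (∑ a, C (l a) * MvPolynomial.X a) * ∑ a, C (m a) * MvPolynomial.X a := by
  have h : (C 2⁻¹ : MvPolynomial (Fin (n + 1)) k) * 2 = 1 := by
    rw [show (2 : MvPolynomial (Fin (n + 1)) k) = C 2 from (map_ofNat C 2).symm, ← C_mul,
      inv_mul_cancel₀ two_ne_zero, C_1]
  have h1 : quadraticPoly ((2⁻¹ : k) • (vecMulVec l m + vecMulVec m l)) = C 2⁻¹ *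
      ((∑ a, C (l a) * MvPolynomial.X a) * (∑ a, C (m a) * MvPolynomial.X a) +
        (∑ a, C (m a) * MvPolynomial.X a) * ∑ a, C (l a) * MvPolynomial.X a) := by
    rw [Finset.sum_mul_sum, Finset.sum_mul_sum, quadraticPoly]
    simp only [← Finset.sum_add_distrib, Finset.mul_sum]
    refine Finset.sum_congr rfl fun a _ => Finset.sum_congr rfl fun b _ => ?_
    simp only [Matrix.smul_apply, Matrix.add_apply, vecMulVec_apply, smul_eq_mul, C_add, C_mul]
    ring
  rw [h1]
  linear_combination ((∑ a, C (l a) * MvPolynomial.X a) * ∑ a, C (m a) * MvPolynomial.X a) * h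

end Intersection

section Integral
variable {k : Type u} [Field k] [IsAlgClosed k] [CharZero k] {X : Scheme.{u}} [IsIntegral X]
  {π : X ⟶ Spec (.of k)} {A B : Matrix (Fin 6) (Fin 6) k} {i : X ⟶ projectiveSpace k 5}

/-- If one quadric of the pencil is a pair of hyperplanes, then `X` is not integral: one of the two
linear forms vanishes on `X`, although at a general point `v` of `X` where both vanish it does not
vanish on the tangent space. -/
theorem rank_eq_zero_of_rank_le_two (hA : A.IsSymm) (hB : B.IsSymm) (hdet : B.det ≠ 0)
    (hi : IsIntersectionOfQuadrics π A B i) (hr : A.rank ≤ 2) : A = 0 := by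
  by_contra hA0
  obtain ⟨l, m, hlm⟩ := exists_eq_vecMulVec_add_vecMulVec hA hr
  have hl0 : l ≠ 0 := by rintro rfl; exact hA0 (by simpa using hlm)
  have hm0 : m ≠ 0 := by rintro rfl; exact hA0 (by simpa using hlm)
  -- By the choice of `v`, neither `l` nor `m` is proportional to the tangent functional `B v`.
  obtain ⟨v, j, hlv, hmv, hvs, hvv, hvj⟩ :=
    exists_isotropic_apply_eq_one hB l m ![B⁻¹ *ᵥ l, B⁻¹ *ᵥ m]
  have hAv : A *ᵥ v = 0 := by
    rw [hlm, smul_mulVec, add_mulVec, vecMulVec_mulVec, vecMulVec_mulVec, hlv, hmv]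
    simp
  have hzero : ∀ w : Fin 6 → k, w j = 0 → (B *ᵥ v) ⬝ᵥ w = 0 → ∀ p ∈ chartIdeal A B j,
      aeval (fun l => (TrivSqZeroExt.inl (v l) + TrivSqZeroExt.inr (w l) : DualNumber k)) p =
        0 := by
    intro w hwj hwB
    have hmap : ∀ M : Matrix (Fin 6) (Fin 6) k, M.map (algebraMap k k) = M := fun M => rfl
    refine aeval_dualNumber_eq_zero v w hA hB hvj hwj ?_ ?_ ?_ ?_ <;> rw [hmap]
    · rw [hAv, dotProduct_zero]
    · exact hvv
    · rw [hAv, dotProduct_zero]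
    · rw [dotProduct_comm]
      exact hwB
  have : Nontrivial (DualNumber k) := ⟨⟨TrivSqZeroExt.inl 0, TrivSqZeroExt.inl 1, fun h =>
    zero_ne_one (congrArg TrivSqZeroExt.fst h)⟩⟩
  have : Nonempty (i ⁻¹ᵁ (chart k 5 j).1) := nonempty_preimage_chart hi j
      (f := (aeval (R := k) fun l => (TrivSqZeroExt.inl (v l) +
        TrivSqZeroExt.inr ((0 : Fin 6 → k) l) : DualNumber k)).toRingHom)
      fun p hp => hzero 0 rfl (dotProduct_zero _) p hp
  -- A linear form vanishing on `X` also vanishes on the tangent vectors `w`.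
  have key : ∀ t : Fin 6 → k, t ≠ 0 → t ⬝ᵥ v = 0 →
      B⁻¹ *ᵥ t ∈ Set.range ![B⁻¹ *ᵥ l, B⁻¹ *ᵥ m] →
      aeval (coord i j π) (∑ a, C (t a) * MvPolynomial.X a) ≠ 0 := by
    intro t ht0 htv htm ht
    rw [aeval_coord_eq_zero_iff hi] at ht
    have hinv : B⁻¹ *ᵥ B *ᵥ v = v := by
      rw [mulVec_mulVec, nonsing_inv_mul _ (isUnit_iff_ne_zero.mpr hdet), one_mulVec]
    have hBv : B *ᵥ v ≠ 0 := by
      intro h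
      rw [h, mulVec_zero] at hinv
      rw [← hinv] at hvj
      exact zero_ne_one hvj
    obtain ⟨w, hwj, hwB, hwt⟩ := exists_dotProduct_ne_zero hvj htv
      ((dotProduct_comm _ _).trans hvv) hBv (l := t) fun c hc => by
        have hc0 : c ≠ 0 := by rintro rfl; exact ht0 (by rw [hc, zero_smul])
        refine hvs ((Submodule.smul_mem_iff _ hc0).mp ?_)
        rw [← hinv, ← mulVec_smul, ← hc]
        exact Submodule.subset_span htm
    have h1 := congrArg TrivSqZeroExt.snd (hzero w hwj hwB _ ht)
    refine hwt ?_
    simpa [TrivSqZeroExt.snd_sum, TrivSqZeroExt.algebraMap_eq_inl', dotProduct] using h1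
  have hmem : quadraticPoly A ∈ chartIdeal A B j :=
    Ideal.subset_span (Set.mem_insert_of_mem _ (Set.mem_insert _ _))
  rw [← aeval_coord_eq_zero_iff hi (π := π)] at hmem
  rw [hlm, quadraticPoly_vecMulVec_add, map_mul, mul_eq_zero] at hmem
  rcases hmem with h | h
  · exact key l hl0 hlv ⟨0, rfl⟩ h
  · exact key m hm0 hmv ⟨1, rfl⟩ h

end Integral

end

/-! ### The dimension of a quadric -/

section

open MvPolynomial Matrix

section Dimension
variable {k : Type u} [Field k]

theorem ringKrullDim_mvPolynomial_fin (n : ℕ) :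
    ringKrullDim (MvPolynomial (Fin n) k) = n := by
  rw [MvPolynomial.ringKrullDim_of_isNoetherianRing, ringKrullDim_eq_zero_of_field, zero_add,
    Nat.card_eq_fintype_card, Fintype.card_fin]

/-- The ideal of a point of affine `n`-space has height `n`: translations act transitively. -/
theorem height_ker_aeval [IsAlgClosed k] {n : ℕ} (v : Fin n → k) :
    ((RingHom.ker (aeval (R := k) v)).height : WithBot ℕ∞) = n := by
  have hdim := ringKrullDim_mvPolynomial_fin (k := k) n
  have : FiniteRingKrullDim (MvPolynomial (Fin n) k) := by
    rw [finiteRingKrullDim_iff_ne_bot_and_top, hdim]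
    exact ⟨WithBot.coe_ne_bot, fun h => ENat.natCast_ne_top n (WithBot.coe_injective h)⟩
  obtain ⟨p, hp, hheight⟩ := Ideal.exists_isMaximal_height (R := MvPolynomial (Fin n) k)
  obtain ⟨w, rfl⟩ := MvPolynomial.isMaximal_iff_eq_vanishingIdeal_singleton.mp hp
  have h1 : ∀ a b : Fin n → k, (aeval (R := k) fun l => X l + C (a l)).comp
      (aeval (R := k) fun l => (X l + C (b l) : MvPolynomial (Fin n) k)) =
      aeval (R := k) fun l => X l + C (a l + b l) := fun a b => by
    ext1 l
    simp [add_assoc]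
  let e : MvPolynomial (Fin n) k ≃ₐ[k] MvPolynomial (Fin n) k :=
    AlgEquiv.ofAlgHom (aeval fun l => X l + C ((v - w) l)) (aeval fun l => X l + C ((w - v) l))
      (by rw [h1]; ext1 l; simp) (by rw [h1]; ext1 l; simp)
  rw [← hdim, ← hheight, ← RingEquiv.height_comap e.toRingEquiv (vanishingIdeal k {w})]
  congr 2
  ext p
  have h2 : (aeval (R := k) w).comp e.toAlgHom = aeval v := by
    ext1 l
    simp [e]
  rw [RingHom.mem_ker, Ideal.mem_comap, mem_vanishingIdeal_singleton_iff, ← h2]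
  rfl

/-- If `m` equations have a common zero, then they cut out a scheme of codimension at most `m`. -/
theorem le_ringKrullDim_quotient [IsAlgClosed k] {n : ℕ} (s : Set (MvPolynomial (Fin n) k)) {m : ℕ}
    (hs : s.encard ≤ m) (v : Fin n → k) (hv : ∀ p ∈ s, aeval v p = 0) :
    (n : WithBot ℕ∞) ≤ ringKrullDim (MvPolynomial (Fin n) k ⧸ Ideal.span s) + m := by
  rw [← height_ker_aeval v]
  have := RingHom.ker_isPrime (aeval (R := k) v)
  refine (Ideal.height_le_ringKrullDim_quotient_add_encard (p := RingHom.ker (aeval (R := k) v)) s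
    fun p hp => hv p hp).trans ?_
  gcongr
  exact_mod_cast hs

theorem ringKrullDim_le_topologicalKrullDim {X : Scheme.{u}} {U : X.Opens} (hU : IsAffineOpen U) :
    ringKrullDim Γ(X, U) ≤ topologicalKrullDim X := by
  rw [← PrimeSpectrum.topologicalKrullDim_eq_ringKrullDim]
  exact hU.fromSpec.isOpenEmbedding.isInducing.topologicalKrullDim_le

variable [IsAlgClosed k] [CharZero k] {X : Scheme.{u}}
  {π : X ⟶ Spec (.of k)} {B : Matrix (Fin 6) (Fin 6) k} {i : X ⟶ projectiveSpace k 5}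

/-- A single quadric in `ℙ⁵` has dimension at least four. -/
theorem topologicalKrullDim_ne_three (hB : B.IsSymm)
    (hi : IsIntersectionOfQuadrics π 0 B i) : topologicalKrullDim X ≠ 3 := by
  intro hdim
  obtain ⟨v, j, -, -, -, hv, hj⟩ := exists_isotropic_apply_eq_one hB 0 0 0
  have h0 : chartIdeal 0 B j = Ideal.span {MvPolynomial.X j - 1, quadraticPoly B} := by
    rw [chartIdeal]
    have : quadraticPoly (0 : Matrix (Fin 6) (Fin 6) k) = 0 := by simp [quadraticPoly]
    rw [this, Ideal.span_insert, Ideal.span_insert, Ideal.span_insert,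
      Ideal.span_singleton_eq_bot.mpr rfl, bot_sup_eq]
  have h1 := le_ringKrullDim_quotient {MvPolynomial.X j - 1, quadraticPoly B} (m := 2)
    ((Set.encard_insert_le _ _).trans (by rw [Set.encard_singleton]; rfl)) v (by
      rintro p (rfl | rfl)
      · simp [hj]
      · rw [aeval_quadraticPoly]
        exact hv)
  have hker : RingHom.ker (toSections i j) =
      Ideal.span {MvPolynomial.X j - 1, quadraticPoly B} := by
    rw [← h0]
    ext p
    exact toSections_eq_zero_iff hi j p
  rw [← hker, ringKrullDim_eq_of_ringEquiv
    (RingHom.quotientKerEquivOfSurjective (toSections_surjective hi j))] at h1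
  have h2 := ringKrullDim_le_topologicalKrullDim (isAffineOpen_preimage_chart hi j)
  rw [hdim] at h2
  have h3 := h1.trans (add_le_add_left h2 _)
  exact absurd h3 (by decide)

end Dimension

end

/-! ### Minors of the pencil -/

section

open MvPolynomial Matrix

section Minors
variable {k : Type u} [Field k]

theorem det_submatrix_eq_zero_of_rank_lt {n m : ℕ} {A : Matrix (Fin n) (Fin n) k} (h : A.rank < m)
    (r c : Fin m → Fin n) : (A.submatrix r c).det = 0 := by
  by_contra h0
  have h1 := rank_of_isUnit _ ((isUnit_iff_isUnit_det _).mpr (isUnit_iff_ne_zero.mpr h0))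
  rw [Fintype.card_fin] at h1
  exact absurd (rank_submatrix_le A r c) (by omega)

/-- A first-order deformation of a matrix whose first row is zero and whose other rows are those of
the identity: its determinant is the deformation of the corner entry. -/
theorem det_border_add_smul {m : ℕ} {A B : Matrix (Fin (m + 1)) (Fin (m + 1)) k} {c : k}
    (h0 : ∀ b, A 0 b = 0) (hA : ∀ a b, a ≠ 0 → A a b = if a = b then 1 else 0) :
    (A.map (algebraMap k (DualNumber k)) +
      (TrivSqZeroExt.inr c : DualNumber k) • B.map (algebraMap k (DualNumber k))).det =
        TrivSqZeroExt.inr (c * B 0 0) := by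
  set f := algebraMap k (DualNumber k)
  set G := A.map f + (TrivSqZeroExt.inr c : DualNumber k) • B.map f with hG
  have h1 : G = G.updateRow 0 ((TrivSqZeroExt.inr c : DualNumber k) • fun b => f (B 0 b)) := by
    refine Matrix.ext fun a b => ?_
    rw [updateRow_apply]
    split_ifs with ha
    · simp [hG, ha, h0]
    · rfl
  rw [h1, det_updateRow_smul]
  have h2 : (TrivSqZeroExt.fstHom k k k) (G.updateRow 0 fun b => f (B 0 b)).det = B 0 0 := by
    rw [AlgHom.map_det, det_of_isUpperTriangular, Fin.prod_univ_succ]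
    · rw [Finset.prod_eq_one, mul_one]
      · simp [f, TrivSqZeroExt.algebraMap_eq_inl']
      · intro a _
        simp [hG, hA, f, TrivSqZeroExt.algebraMap_eq_inl']
    · intro a b hab
      have ha : a ≠ 0 := (lt_of_le_of_lt (Fin.zero_le b) hab).ne'
      simp [hG, ha, hA, f, TrivSqZeroExt.algebraMap_eq_inl', (id hab : b < a).ne']
  ext
  · simp
  · have h3 := congrArg (c * ·) h2
    simpa using h3

/-- If the symmetric matrix `A` has corank two and `B` does not vanish identically on its kernel,
then some minor of corank one of `A + ε B` does not vanish. -/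
theorem exists_det_submatrix_add_smul_ne_zero [CharZero k] [IsAlgClosed k]
    {A B : Matrix (Fin 6) (Fin 6) k} (hA : A.IsSymm) (hr : A.rank = 4) {w : Fin 6 → k}
    (hw : A *ᵥ w = 0) (hBw : w ⬝ᵥ B *ᵥ w ≠ 0) {c : k} (hc : c ≠ 0) :
    ∃ a b : Fin 6, ((A.map (algebraMap k (DualNumber k)) +
      (TrivSqZeroExt.inr c : DualNumber k) • B.map (algebraMap k (DualNumber k))).submatrix
        a.succAbove b.succAbove).det ≠ 0 := by
  -- Otherwise the adjugate vanishes, and it still does after the change of coordinates to a basis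
  -- `x, w, y₀, …, y₃` with `y` orthonormal for `A`, where one of its entries is `c B(w, w) ε`.
  by_contra! hcon
  set f := algebraMap k (DualNumber k)
  set N := A.map f + (TrivSqZeroExt.inr c : DualNumber k) • B.map f
  have hadj : N.adjugate = 0 := by
    ext1 a b
    rw [adjugate_fin_succ_eq_det_submatrix, hcon, mul_zero, Matrix.zero_apply]
  obtain ⟨y, hy⟩ := exists_orthonormal hA hr.ge
  have hw' : ∀ v, w ⬝ᵥ A *ᵥ v = 0 := fun v => by
    rw [dotProduct_mulVec_comm hA, hw, dotProduct_zero]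
  obtain ⟨x, -, hx⟩ := exists_mem_notMem_span (k := k) (W := (⊤ : Submodule k (Fin 6 → k)))
    (by rw [finrank_top, Module.finrank_fin_fun]; norm_num) (Fin.cons w y : Fin 5 → Fin 6 → k)
  have hli : LinearIndependent k (Fin.cons x (Fin.cons w y : Fin 5 → Fin 6 → k) :
      Fin 6 → Fin 6 → k) := by
    refine linearIndependent_finCons.mpr ⟨Fintype.linearIndependent_iff.mpr fun g hg => ?_, hx⟩
    rw [Fin.sum_univ_succ] at hg
    simp only [Fin.cons_zero, Fin.cons_succ] at hg
    have h1 : ∀ b, g (Fin.succ b) = 0 := by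
      intro b
      have h2 := congrArg (fun v => v ⬝ᵥ A *ᵥ y b) hg
      simpa [sum_dotProduct, hw', hy] using h2
    have h2 : g 0 = 0 := by
      simp only [h1, zero_smul, Finset.sum_const_zero, add_zero, smul_eq_zero] at hg
      exact hg.resolve_right fun h => hBw (by rw [h, zero_dotProduct])
    exact Fin.cases h2 h1
  let P : Matrix (Fin 6) (Fin 6) k := Matrix.of (Fin.cons x (Fin.cons w y : Fin 5 → Fin 6 → k))
  have hgram : ∀ (M : Matrix (Fin 6) (Fin 6) k) a b, (P * M * Pᵀ) a b = P a ⬝ᵥ M *ᵥ P b := by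
    intro M a b
    rw [Matrix.mul_assoc]
    rfl
  have hconj : (P.map f * N * (Pᵀ).map f) = (P * A * Pᵀ).map f +
      (TrivSqZeroExt.inr c : DualNumber k) • (P * B * Pᵀ).map f := by
    simp only [N, Matrix.map_mul, Matrix.mul_add, Matrix.add_mul, Matrix.mul_smul, Matrix.smul_mul]
  have h1 : (P.map f * N * (Pᵀ).map f).adjugate 0 0 = 0 := by
    rw [adjugate_mul_distrib, adjugate_mul_distrib, hadj, Matrix.zero_mul, Matrix.mul_zero,
      Matrix.zero_apply]
  rw [adjugate_fin_succ_eq_det_submatrix, hconj] at h1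
  have h2 := det_border_add_smul (c := c) (A := (P * A * Pᵀ).submatrix Fin.succ Fin.succ)
    (B := (P * B * Pᵀ).submatrix Fin.succ Fin.succ) ?_ ?_
  · have h3 := h1.symm.trans ((congrArg ((-1) ^ 0 * ·) h2))
    have h4 := congrArg TrivSqZeroExt.snd h3
    simp only [pow_zero, one_mul, TrivSqZeroExt.snd_zero, TrivSqZeroExt.snd_inr, submatrix_apply,
      hgram] at h4
    exact mul_ne_zero hc hBw h4.symm
  · intro b
    rw [submatrix_apply, hgram]
    exact hw' _
  · intro a b ha
    obtain ⟨a, rfl⟩ := Fin.exists_succ_eq.mpr ha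
    rw [submatrix_apply, hgram]
    refine Fin.cases ?_ (fun b => ?_) b
    · rw [if_neg ha]
      change y a ⬝ᵥ A *ᵥ w = 0
      rw [hw, dotProduct_zero]
    · simp only [Fin.succ_inj]
      exact hy a b

end Minors

section Segre
variable {k : Type u} [Field k] {Q₁ Q₂ : Matrix (Fin 6) (Fin 6) k} {p : ℙ k (Fin 2 → k)}

/-- Modulo the linear form of `p` the generic matrix of the pencil is proportional to its value
at `p`. -/
theorem linearForm_dvd_det_submatrix (hp : p.rep 0 ≠ 0)
    (hr : (p.rep 0 • Q₁ + p.rep 1 • Q₂).rank < 5) (r c : Fin 5 → Fin 6) :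
    linearForm p ∣ ((pencil Q₁ Q₂).submatrix r c).det := by
  rw [← Ideal.mem_span_singleton, ← Ideal.Quotient.eq_zero_iff_mem, RingHom.map_det]
  set q := Ideal.Quotient.mk (Ideal.span {linearForm p})
  have hl : q (C (p.rep 1)) * q (X 0) - q (C (p.rep 0)) * q (X 1) = 0 := by
    rw [← map_mul, ← map_mul, ← map_sub]
    exact Ideal.Quotient.eq_zero_iff_mem.mpr (Ideal.mem_span_singleton_self _)
  have h1 : q (C (p.rep 0)⁻¹) * q (C (p.rep 0)) = 1 := by
    rw [← map_mul, ← C_mul, inv_mul_cancel₀ hp, C_1, map_one]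
  have h2 : q.mapMatrix ((pencil Q₁ Q₂).submatrix r c) = (q (C (p.rep 0)⁻¹) * q (X 0)) •
      (q.comp C).mapMatrix ((p.rep 0 • Q₁ + p.rep 1 • Q₂).submatrix r c) := by
    ext a b
    simp only [pencil, RingHom.mapMatrix_apply, Matrix.map_apply, submatrix_apply,
      Matrix.add_apply, Matrix.smul_apply, smul_eq_mul, map_add, map_mul, RingHom.comp_apply]
    linear_combination (-(q (X 0) * q (C (Q₁ (r a) (c b)))) -
      q (X 1) * q (C (Q₂ (r a) (c b)))) * h1 - q (C (p.rep 0)⁻¹) * q (C (Q₂ (r a) (c b))) * hl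
  rw [h2, det_smul, ← RingHom.map_det, det_submatrix_eq_zero_of_rank_lt hr, map_zero, mul_zero]

theorem exists_not_linearForm_sq_dvd [CharZero k] [IsAlgClosed k] (hQ₁ : Q₁.IsSymm)
    (hQ₂ : Q₂.IsSymm) (hp : p.rep 0 ≠ 0) (hr : (p.rep 0 • Q₁ + p.rep 1 • Q₂).rank = 4)
    {w : Fin 6 → k} (hw : (p.rep 0 • Q₁ + p.rep 1 • Q₂) *ᵥ w = 0) (hBw : w ⬝ᵥ Q₂ *ᵥ w ≠ 0) :
    ∃ a b : Fin 6,
      ¬ linearForm p ^ 2 ∣ ((pencil Q₁ Q₂).submatrix a.succAbove b.succAbove).det := by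
  obtain ⟨a, b, hab⟩ := exists_det_submatrix_add_smul_ne_zero
    ((hQ₁.smul _).add (hQ₂.smul _)) hr hw hBw (neg_ne_zero.mpr (inv_ne_zero hp))
  refine ⟨a, b, fun hdvd => hab ?_⟩
  -- The tangent direction at `p` along which `linearForm p` becomes the infinitesimal `ε`.
  let θ : MvPolynomial (Fin 2) k →ₐ[k] DualNumber k := aeval ![TrivSqZeroExt.inl (p.rep 0),
    TrivSqZeroExt.inl (p.rep 1) - TrivSqZeroExt.inr (p.rep 0)⁻¹]
  have hl : θ (linearForm p ^ 2) = 0 := by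
    rw [map_pow]
    have h1 : θ (linearForm p) = TrivSqZeroExt.inr 1 := by
      ext <;> simp [θ, linearForm, TrivSqZeroExt.algebraMap_eq_inl', hp, mul_comm]
    rw [h1, pow_two, TrivSqZeroExt.inr_mul_inr]
  have h2 : θ.mapMatrix ((pencil Q₁ Q₂).submatrix a.succAbove b.succAbove) =
      (((p.rep 0 • Q₁ + p.rep 1 • Q₂).map (algebraMap k (DualNumber k)) +
        (TrivSqZeroExt.inr (-(p.rep 0)⁻¹) : DualNumber k) •
          Q₂.map (algebraMap k (DualNumber k))).submatrix a.succAbove b.succAbove) := by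
    ext c d <;> simp [θ, pencil, TrivSqZeroExt.algebraMap_eq_inl']
  rw [← h2, ← AlgHom.map_det]
  obtain ⟨s, hs⟩ := hdvd
  rw [hs, map_mul, hl, zero_mul]

/-- If the quadric at `p` has corank two and another quadric of the pencil does not contain its
vertex line, then the point is a simple zero of some minor of order five. -/
theorem minorMultiplicity_one_eq_one [CharZero k] [IsAlgClosed k] (hQ₁ : Q₁.IsSymm)
    (hQ₂ : Q₂.IsSymm) (hp : p.rep 0 ≠ 0) (hr : (p.rep 0 • Q₁ + p.rep 1 • Q₂).rank = 4)
    {w : Fin 6 → k} (hw : (p.rep 0 • Q₁ + p.rep 1 • Q₂) *ᵥ w = 0) (hBw : w ⬝ᵥ Q₂ *ᵥ w ≠ 0) :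
    minorMultiplicity Q₁ Q₂ p 1 = 1 := by
  obtain ⟨a, b, hab⟩ := exists_not_linearForm_sq_dvd hQ₁ hQ₂ hp hr hw hBw
  rw [minorMultiplicity]
  have h : (⨅ (r : Fin (5 + 1 - 1) ↪o Fin (5 + 1)) (c : Fin (5 + 1 - 1) ↪o Fin (5 + 1)),
      emultiplicity (linearForm p) ((pencil Q₁ Q₂).submatrix r c).det) = 1 := by
    apply le_antisymm
    · refine (iInf₂_le (Fin.succAboveOrderEmb a) (Fin.succAboveOrderEmb b)).trans ?_
      have h1 := emultiplicity_lt_iff_not_dvd.mpr hab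
      exact Order.le_of_lt_add_one (by exact_mod_cast h1)
    · refine le_iInf₂ fun r c => ?_
      have h1 := linearForm_dvd_det_submatrix hp (hr.trans_lt (by norm_num)) r c
      rw [← pow_one (linearForm p)] at h1
      exact_mod_cast le_emultiplicity_of_pow_dvd h1
  rw [h]
  rfl

end Segre

end

/-! ### The Segre symbol -/

section

open Matrix

section Main
variable {k : Type u} [Field k]

theorem rep_zero_ne_zero_of_mem_roots {Q₁ Q₂ : Matrix (Fin 6) (Fin 6) k} (hdet : Q₂.det ≠ 0)
    {p : ℙ k (Fin 2 → k)} (hp : p ∈ roots Q₁ Q₂) : p.rep 0 ≠ 0 := by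
  intro h
  have h2 : MvPolynomial.eval p.rep (discriminant Q₁ Q₂) = 0 := hp
  rw [eval_discriminant, h, zero_smul, zero_add, Matrix.det_smul, mul_eq_zero,
    or_iff_left hdet] at h2
  apply p.rep_nonzero
  ext j
  fin_cases j
  · exact h
  · exact eq_zero_of_pow_eq_zero h2

theorem exists_quadratic_ne_zero [CharZero k] {B : Matrix (Fin 6) (Fin 6) k} (hB : B.IsSymm)
    {W : Submodule k (Fin 6 → k)} {v w : Fin 6 → k} (hv : v ∈ W) (hw : w ∈ W)
    (h : v ⬝ᵥ B *ᵥ w ≠ 0) : ∃ x ∈ W, x ⬝ᵥ B *ᵥ x ≠ 0 := by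
  by_contra! hc
  have h1 := hc _ (W.add_mem hv hw)
  rw [mulVec_add, dotProduct_add, add_dotProduct, add_dotProduct, hc v hv, hc w hw,
    dotProduct_mulVec_comm hB w v, zero_add, add_zero, ← two_mul] at h1
  exact h ((mul_eq_zero.mp h1).resolve_left two_ne_zero)

variable [IsAlgClosed k] [CharZero k] {X : Scheme.{u}} [IsIntegral X] {π : X ⟶ Spec (.of k)}
  {A B : Matrix (Fin 6) (Fin 6) k} {i : X ⟶ projectiveSpace k 5}

/-- A quadric `A` of the pencil has corank at most two, and if it has corank two, then `X` does not
contain its vertex line. -/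
theorem rank_of_isDelPezzoThreefold (hX : IsDelPezzoThreefold π 4) (hA : A.IsSymm) (hB : B.IsSymm)
    (hdet : B.det ≠ 0) (hi : IsIntersectionOfQuadrics π A B i) :
    5 ≤ A.rank ∨ A.rank = 4 ∧ ∃ w, A *ᵥ w = 0 ∧ w ⬝ᵥ B *ᵥ w ≠ 0 := by
  by_contra! h
  have h3 : ¬ A.rank ≤ 2 := fun hr => by
    obtain rfl := rank_eq_zero_of_rank_le_two hA hB hdet hi hr
    exact topologicalKrullDim_ne_three hB hi hX.dim_eq
  have hbad : A.rank = 3 ∨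
      A.rank = 4 ∧ ∀ v w, A *ᵥ v = 0 → A *ᵥ w = 0 → v ⬝ᵥ B *ᵥ w = 0 := by
    rcases (by omega : A.rank = 3 ∨ A.rank = 4) with h4 | h4
    · exact Or.inl h4
    · refine Or.inr ⟨h4, fun v w hv hw => ?_⟩
      by_contra hvw
      obtain ⟨x, hx, hxx⟩ := exists_quadratic_ne_zero hB
        (W := LinearMap.ker A.mulVecLin) hv hw hvw
      exact hxx (h.2 h4 x hx)
  obtain ⟨P, S, δ, e, hS, hPA, hPB⟩ := exists_isNormalPencil hA hB hdet hbad
  exact hPB.not_isTerminal hS hPA rfl hA hB hi hX.singularities.normal hX.singularities.terminal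

end Main

end

end DelPezzo

end

theorem mainTheorem8 {k : Type u} [Field k] [IsAlgClosed k] [CharZero k]
    {X : Scheme.{u}} [IsIntegral X] (π : X ⟶ Spec (.of k))
    (hX : DelPezzo.IsDelPezzoThreefold π 4)
    (Q₁ Q₂ : Matrix (Fin 6) (Fin 6) k) (hQ₁ : Q₁.IsSymm) (hQ₂ : Q₂.IsSymm)
    (hdet : Q₂.det ≠ 0) (i : X ⟶ DelPezzo.projectiveSpace k 5)
    (hi : DelPezzo.IsIntersectionOfQuadrics π Q₁ Q₂ i) :
    ∀ b ∈ DelPezzo.segreSymbol Q₁ Q₂ hdet,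
      b.length ≤ 2 ∧ (b.length = 2 → ∃ a : ℕ, b = [a, 1]) := by
  intro b hb
  obtain ⟨p, hp, rfl⟩ := Multiset.mem_map.mp hb
  have hp0 : p.rep 0 ≠ 0 := DelPezzo.rep_zero_ne_zero_of_mem_roots hdet
    ((DelPezzo.roots_finite Q₁ Q₂ hdet).mem_toFinset.mp hp)
  rcases DelPezzo.rank_of_isDelPezzoThreefold hX ((hQ₁.smul _).add (hQ₂.smul _)) hQ₂ hdet
    (hi.of_pencil hp0 (p.rep 1)) with h5 | ⟨h4, w, hw, hBw⟩
  · have hd : DelPezzo.vertexDim Q₁ Q₂ p = 0 := Nat.sub_eq_zero_of_le h5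
    simp [DelPezzo.characteristicNumbers, hd]
  · have hd : DelPezzo.vertexDim Q₁ Q₂ p = 1 := by rw [DelPezzo.vertexDim, h4]
    have h1 := DelPezzo.minorMultiplicity_one_eq_one hQ₁ hQ₂ hp0 h4 hw hBw
    simp [DelPezzo.characteristicNumbers, hd, h1, List.range_succ]
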